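/- Let $\gamma>0$, let $(Z_n)_{n\in\mathbb Z}$ be iid real random variables such that, as $z\to\infty$, $$\frac{P(Z_0>z)}{z^{-1/\gamma}L(z)}\to\pi_1,\qquad \frac{P(Z_0\le -z)}{z^{-1/\gamma}L(z)}\to\pi_2$$ for some $\pi_1,\pi_2\ge 0$ with $\pi_1+\pi_2=1$ and some function $L$ with $L(yz)/L(z)\to1$ as $z\to\infty$ for every $y>0$. Let $(c_j)_{j\ge0}$ be real numbers, not all zero, with $\sum_j|c_j|^\delta<\infty$ for some $0<\delta<\min(1/\gamma,1)$, and let $X_n=\sum_{j=0}^\infty c_jZ_{n-j}$; this series converges absolutely almost surely. Let $F_{|X|}$ be the distribution function of $|X_0|$, let $b_{|X|}(t)=\inf\{y: 1/(1-F_{|X|}(y))\ge t\}$, let $\sigma^*$ be a positive function with $$\lim_{t\to\infty}\sup_{x>0}\left|P\big(|X_0|-t\le x\,\big|\,|X_0|>t\big)-\left[1-\left(1+\tfrac{\gamma}{\sigma^*(t)}x\right)^{-1/\gamma}\right]\right|=0,$$ and put $\sigma(t)=\sigma^*(b_{|X|}(t))$. Write $|X|_{n,1}\le\dots\le|X|_{n,n}$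 for the order statistics of $|X_1|,\dots,|X_n|$. Let $r<0$ and let $k=k_n$ be a sequence of natural numbers with $k\to\infty$ and $n/k\to\infty$ as $n\to\infty$. Let $(\hat\gamma_{LME},\hat\sigma_{LME})$ be likelihood moment estimators, that is, at every outcome where the system $$\frac1k\sum_{i=0}^{k-1}\log\left(1+\tfrac{g}{s}\big(|X|_{n,n-i}-|X|_{n,n-k}\big)\right)=g,\qquad \frac1k\sum_{i=0}^{k-1}\left(1+\tfrac{g}{s}\big(|X|_{n,n-i}-|X|_{n,n-k}\big)\right)^{r/g}=\frac1{1-r}$$ has a solution $(g,s)$ with $g\neq 0$, $s>0$ and $1+\tfrac gs(|X|_{n,n-i}-|X|_{n,n-k})>0$ for $0\le i<k$, the pair $(\hat\gamma_{LME},\hat\sigma_{LME})$ is such a solution; at the other outcomes its values are arbitrary. Then, as $n\to\infty$, $$\left(\hat\gamma_{LME},\ \hat\sigma_{LME}/\sigma(n/k)\right)\ \xrightarrow{P}\ (\gamma,\,1).$$ -/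

import Mathlib

open MeasureTheory ProbabilityTheory Filter Topology

noncomputable section

/-- `L` is slowly varying at infinity. -/
def SlowlyVarying (L : ℝ → ℝ) : Prop :=
  ∀ y : ℝ, 0 < y → Tendsto (fun z => L (y * z) / L z) atTop (𝓝 1)

/-- The random variable `Z` has balanced regularly varying tails of index `-1/γ`:
`P(Z > z) ~ π₁ z^(-1/γ) L(z)` and `P(Z ≤ -z) ~ π₂ z^(-1/γ) L(z)` as `z → ∞`, where
`π₁, π₂ ≥ 0`, `π₁ + π₂ = 1` and `L` is slowly varying. Each relation is stated as convergence
of the quotient to `πᵢ`, which is also the meaning of the relation if `πᵢ = 0`. -/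
def RegVaryingTails {Ω : Type*} [MeasurableSpace Ω] (μ : Measure Ω) (γ : ℝ) (Z : Ω → ℝ) : Prop :=
  ∃ (L : ℝ → ℝ) (π₁ π₂ : ℝ), SlowlyVarying L ∧ 0 ≤ π₁ ∧ 0 ≤ π₂ ∧ π₁ + π₂ = 1 ∧
    Tendsto (fun z : ℝ => μ.real {ω | z < Z ω} / (z ^ (-1 / γ) * L z)) atTop (𝓝 π₁) ∧
    Tendsto (fun z : ℝ => μ.real {ω | Z ω ≤ -z} / (z ^ (-1 / γ) * L z)) atTop (𝓝 π₂)

/-- The linear process `X_n = ∑_{j ≥ 0} c_j Z_{n-j}`. -/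
def linearProcess {Ω : Type*} (c : ℕ → ℝ) (Z : ℤ → Ω → ℝ) (n : ℤ) (ω : Ω) : ℝ :=
  ∑' j : ℕ, c j * Z (n - j) ω

/-- The distribution function of `|X|`. -/
def absCDF {Ω : Type*} [MeasurableSpace Ω] (μ : Measure Ω) (X : Ω → ℝ) (y : ℝ) : ℝ :=
  μ.real {ω | |X ω| ≤ y}

/-- The `(1 - 1/t)`-quantile of `|X|`. For `t > 0` the condition `1 - 1/t ≤ F(y)` is
`1/(1 - F(y)) ≥ t`, with `1/0 = ∞`. -/
def absQuantile {Ω : Type*} [MeasurableSpace Ω] (μ : Measure Ω) (X : Ω → ℝ) (t : ℝ) : ℝ :=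
  sInf {y : ℝ | 1 - 1 / t ≤ absCDF μ X y}

/-- The conditional excess distribution function `P(|X| - t ≤ x | |X| > t)`. -/
def excessCDF {Ω : Type*} [MeasurableSpace Ω] (μ : Measure Ω) (X : Ω → ℝ) (t x : ℝ) : ℝ :=
  (ProbabilityTheory.cond μ {ω | t < |X ω|}).real {ω | |X ω| - t ≤ x}

/-- The Generalized Pareto distribution function with shape `γ` and scale `s`
(for `γ, s > 0` and `x ≥ 0`). -/
def gpdCDF (γ s x : ℝ) : ℝ := 1 - (1 + γ / s * x) ^ (-1 / γ)

/-- `σstar` is a scale function for the excesses of `|X|`: it is positive and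
`sup_{x > 0} |P(|X| - t ≤ x | |X| > t) - (1 - (1 + γ x / σstar(t))^(-1/γ))| → 0`
as `t → ∞`. -/
def IsGPDScale {Ω : Type*} [MeasurableSpace Ω] (μ : Measure Ω) (γ : ℝ) (X : Ω → ℝ)
    (σstar : ℝ → ℝ) : Prop :=
  (∀ t : ℝ, 0 < t → 0 < σstar t) ∧
    TendstoUniformlyOn (fun t x => excessCDF μ X t x - gpdCDF γ (σstar t) x) (fun _ => 0)
      atTop (Set.Ioi 0)

/-- The `m`-th smallest of the `n` numbers `x 0, …, x (n-1)`, `1 ≤ m ≤ n`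
(and `0` for other `m`). -/
def orderStat {n : ℕ} (x : Fin n → ℝ) (m : ℕ) : ℝ :=
  if h : 1 ≤ m ∧ m ≤ n then x (Tuple.sort x ⟨m - 1, by omega⟩) else 0

/-- The order statistic `|X|_{n,m}`: the `m`-th smallest of `|X_1|, …, |X_n|`. -/
def absOrderStat {Ω : Type*} (X : ℤ → Ω → ℝ) (n m : ℕ) (ω : Ω) : ℝ :=
  orderStat (fun i : Fin n => |X ((i : ℕ) + 1 : ℤ) ω|) m

/-- The excess `|X|_{n,n-i} - |X|_{n,n-k}`. -/
def excess {Ω : Type*} (X : ℤ → Ω → ℝ) (n k i : ℕ) (ω : Ω) : ℝ :=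
  absOrderStat X n (n - i) ω - absOrderStat X n (n - k) ω

/-- `(g, s)` solves the likelihood moment equations with parameter `r` for the data
`y 0, …, y (k-1)`. There is no solution with `g = 0` if `r ≠ 0`, since the left side of the
second equation is then `1` (or `0` if `k = 0`). -/
structure IsLMESolution (r : ℝ) (k : ℕ) (y : ℕ → ℝ) (g s : ℝ) : Prop where
  scale_pos : 0 < s
  domain : ∀ i < k, 0 < 1 + g / s * y i
  eq_log : (1 / (k : ℝ)) * ∑ i ∈ Finset.range k, Real.log (1 + g / s * y i) = g
  eq_pow : (1 / (k : ℝ)) * ∑ i ∈ Finset.range k, (1 + g / s * y i) ^ (r / g) = (1 - r)⁻¹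

/-- `(γhat, σhat)` are likelihood moment estimators based on the `k` largest excesses among
`|X_1|, …, |X_n|`: they solve the likelihood moment equations at each outcome at which these
have a solution. At the other outcomes their values are not restricted. -/
def IsLMEstimator {Ω : Type*} (r : ℝ) (X : ℤ → Ω → ℝ) (n k : ℕ) (γhat σhat : Ω → ℝ) : Prop :=
  ∀ ω : Ω, (∃ g s : ℝ, IsLMESolution r k (fun i => excess X n k i ω) g s) →
    IsLMESolution r k (fun i => excess X n k i ω) (γhat ω) (σhat ω)

end

/-! The proof has a probabilistic half, a law of large numbers for the excesses, and an analytic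
half, the monotonicity of the estimating equations.

Tails. Write `α = 1/γ` and let `H` be the tail of `|Z|`, regularly varying with index `-α`. Two
independent summands are jointly large with negligible probability, so tail constants add
(`RegVarTail.absTail_add`) and finite parts of the process have tail `∑ |c j| ^ α` times `H`. The
infinite remainder is controlled by `RegVarTail.exists_tail_tsum_bound`: a union bound handles one
large term, and Hölder, Markov and Karamata handle the sum of truncated terms. Hence `|X|` has tail
asymptotic to a constant times `H`; its quantile `b = b(n/k)` satisfies `(n/k) P(|X| > v b) → v ^
(-α)`, and the scale function satisfies `σstar(t)/t → γ`. It therefore suffices to show that the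
shape estimator and the scale estimator divided by `b` both tend to `γ`.

Law of large numbers. For a primitive of a density `g ≤ C/v` supported away from `0`, the sum over
`|X_i|/b`, divided by `k`, converges in probability to `∫ g v ^ (-α)` (`tendsto_tailSum`).
Truncating both the density and the series gives bounded `m`-dependent summands, whose normalized
sum has variance of order `1/k`; the replacement error is small in mean. Ramp functions bracket
exceedance counts, so the intermediate order statistic divided by `b` tends to `1`, and then the
same limits hold for the excesses (`tendsto_excessSum`).

Equations. Put `θ = g/s`. The first equation gives `g` as the mean of `log (1 + θ y_i)`, and the
second becomes `powMean θ = (1 - r)⁻¹`. The function `powMean` is nonincreasing (`powMean_anti`):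
the functions `log (1 + θ y)` divided by their means have equal mean for different `θ`, and their
ratio is monotone in `y`, so they cross only once, which orders the means of the convex function
`exp (r ·)`. The comparison also covers negative `θ`, so it applies to every solution and not only
to those with `g > 0`.

Conclusion. At `θ = τ/b` the mean tends to a functional of the Pareto law that equals `(1 - r)⁻¹` at
`τ = 1` and is strictly monotone in `τ` (`powLimit_strictMono`). With probability tending to one the
level is thus crossed strictly between `(1 - ε)/b` and `(1 + ε)/b`. This gives a solution by the
intermediate value theorem and confines all solutions there. The value of `g` follows from the mean
logarithm at `1/b`, which tends to `γ`, and `s = g/θ`. -/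

/-! ### Regularly varying tail functions -/

/-- `H` is a positive nonincreasing function, regularly varying at infinity with index `-α`. -/
structure RegVarTail (H : ℝ → ℝ) (α : ℝ) : Prop where
  anti : Antitone H
  pos : ∀ t, 0 < H t
  tendsto_ratio : ∀ y, 0 < y → Tendsto (fun t => H (y * t) / H t) atTop (𝓝 (y ^ (-α)))

/-- Upper Potter bound. -/
lemma RegVarTail.potter {H : ℝ → ℝ} {α : ℝ} (hH : RegVarTail H α) {β : ℝ} (hβ : 0 ≤ β)
    (hβα : β < α) :
    ∃ t₀ > 0, ∀ t ≥ t₀, ∀ v ≥ (1 : ℝ), H (v * t) ≤ 2 ^ β * v ^ (-β) * H t := by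
  have h2 : (2 : ℝ) ^ (-α) < 2 ^ (-β) :=
    Real.rpow_lt_rpow_of_exponent_lt (by norm_num) (by linarith)
  obtain ⟨t₁, ht₁⟩ := eventually_atTop.1 ((hH.tendsto_ratio 2 two_pos).eventually_lt_const h2)
  refine ⟨max t₁ 1, by positivity, fun t ht v hv => ?_⟩
  have htpos : 0 < t := lt_of_lt_of_le (by positivity) ht
  have key : ∀ n : ℕ, H (2 ^ n * t) ≤ ((2 : ℝ) ^ (-β)) ^ n * H t := by
    intro n
    induction n with
    | zero => simp
    | succ n ih =>
      have h1 : t₁ ≤ 2 ^ n * t := (le_max_left _ _).trans <| ht.trans <|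
        le_mul_of_one_le_left htpos.le (one_le_pow₀ one_le_two)
      have h3 := (div_lt_iff₀ (hH.pos _)).1 (ht₁ _ h1)
      calc H (2 ^ (n + 1) * t) = H (2 * (2 ^ n * t)) := by ring_nf
        _ ≤ 2 ^ (-β) * H (2 ^ n * t) := h3.le
        _ ≤ 2 ^ (-β) * (((2 : ℝ) ^ (-β)) ^ n * H t) := by gcongr
        _ = _ := by ring
  obtain ⟨n, hn1, hn2⟩ := exists_nat_pow_near hv one_lt_two
  calc H (v * t) ≤ H (2 ^ n * t) := hH.anti (by gcongr)
    _ ≤ ((2 : ℝ) ^ (-β)) ^ n * H t := key n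
    _ ≤ _ := by
      gcongr
      · exact (hH.pos t).le
      have h4 : ((2 : ℝ) ^ (n + 1)) ^ (-β) ≤ v ^ (-β) :=
        Real.rpow_le_rpow_of_nonpos (by positivity) hn2.le (by linarith)
      calc ((2 : ℝ) ^ (-β)) ^ n = 2 ^ β * ((2 : ℝ) ^ (n + 1)) ^ (-β) := by
            rw [← Real.rpow_natCast, ← Real.rpow_natCast, ← Real.rpow_mul two_pos.le,
              ← Real.rpow_mul two_pos.le, ← Real.rpow_add two_pos]
            congr 1
            push_cast
            ring
        _ ≤ _ := by gcongr

/-- Upper Karamata bound for truncated moments, in dyadic form. -/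
lemma RegVarTail.karamata {H : ℝ → ℝ} {α : ℝ} (hH : RegVarTail H α) {p : ℝ}
    (hαp : α < p) :
    ∃ C > 0, ∃ t₀ > 0, ∀ M : ℝ → ℝ, (∀ t, 0 < t → M (2 * t) ≤ M t + (2 * t) ^ p * H t) →
      (∀ t, 0 < t → M t ≤ t ^ p) → ∀ t ≥ t₀, M t ≤ C * t ^ p * H t := by
  obtain ⟨q, hq1, hq2⟩ := exists_between hαp
  have h2 : (2 : ℝ) ^ (-q) < 2 ^ (-α) :=
    Real.rpow_lt_rpow_of_exponent_lt (by norm_num) (by linarith)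
  obtain ⟨t₁, ht₁⟩ := eventually_atTop.1 ((hH.tendsto_ratio 2 two_pos).eventually_const_lt h2)
  set t₀ := max t₁ 1
  have ht₀ : 0 < t₀ := by positivity
  set ρ : ℝ := 2 ^ (q - p)
  have hρ : ρ < 1 := Real.rpow_lt_one_of_one_lt_of_neg one_lt_two (by linarith)
  have hρ0 : 0 < ρ := by positivity
  -- The first entry makes the trivial bound `M t ≤ t ^ p` sufficient on `[t₀, 2 t₀]`. The second is
  -- the fixed point of `C ↦ (C + 2 ^ p) ρ`, the map by which one doubling step changes the
  -- constant.
  set C := max (1 / H (2 * t₀)) (2 ^ p * ρ / (1 - ρ))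
  have hC1 : 1 ≤ C * H (2 * t₀) := by
    rw [← div_le_iff₀ (hH.pos _)]; exact le_max_left _ _
  have hC2 : (C + 2 ^ p) * ρ ≤ C := by
    have : 2 ^ p * ρ / (1 - ρ) ≤ C := le_max_right _ _
    rw [div_le_iff₀ (by linarith)] at this
    linarith
  have hC : 0 < C := lt_of_lt_of_le (one_div_pos.2 (hH.pos _)) (le_max_left _ _)
  refine ⟨C, hC, t₀, ht₀, fun M hM hM0 => ?_⟩
  have key : ∀ n : ℕ, ∀ t, t₀ ≤ t → t ≤ 2 ^ (n + 1) * t₀ → M t ≤ C * t ^ p * H t := by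
    intro n
    induction n with
    | zero =>
      intro t h1 h2
      have ht : 0 < t := ht₀.trans_le h1
      have : 1 ≤ C * H t := hC1.trans (by gcongr; exact hH.anti (by simpa using h2))
      calc M t ≤ t ^ p * 1 := by simpa using hM0 t ht
        _ ≤ t ^ p * (C * H t) := by gcongr
        _ = _ := by ring
    | succ n ih =>
      intro t h1 h2
      rcases le_total t (2 * t₀) with h | h
      · exact ih t h1 (h.trans (by
          gcongr; exact le_self_pow₀ one_le_two (by omega)))
      obtain ⟨s, rfl⟩ : ∃ s, t = 2 * s := ⟨t / 2, by ring⟩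
      have hs1 : t₀ ≤ s := by linarith
      have hs : 0 < s := ht₀.trans_le hs1
      have hs2 : s ≤ 2 ^ (n + 1) * t₀ := by
        have : (2 : ℝ) ^ (n + 1 + 1) * t₀ = 2 * (2 ^ (n + 1) * t₀) := by ring
        linarith
      have h3 : H s ≤ 2 ^ q * H (2 * s) := by
        have := (lt_div_iff₀ (hH.pos _)).1 (ht₁ s ((le_max_left _ _).trans hs1))
        calc H s = 2 ^ q * (2 ^ (-q) * H s) := by
              rw [← mul_assoc, ← Real.rpow_add two_pos]; simp
          _ ≤ _ := by gcongr
      have h4 : (2 * s) ^ p = 2 ^ p * s ^ p := Real.mul_rpow two_pos.le hs.le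
      have h5 : (2 : ℝ) ^ q = ρ * 2 ^ p := by rw [← Real.rpow_add two_pos]; simp
      calc M (2 * s) ≤ M s + (2 * s) ^ p * H s := hM s hs
        _ ≤ C * s ^ p * H s + (2 * s) ^ p * H s := by gcongr; exact ih s hs1 hs2
        _ = (C + 2 ^ p) * s ^ p * H s := by rw [h4]; ring
        _ ≤ (C + 2 ^ p) * s ^ p * (2 ^ q * H (2 * s)) := by gcongr
        _ = ((C + 2 ^ p) * ρ) * ((2 * s) ^ p * H (2 * s)) := by rw [h4, h5]; ring
        _ ≤ C * ((2 * s) ^ p * H (2 * s)) := by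
            gcongr
            exact mul_nonneg (by positivity) (hH.pos _).le
        _ = _ := by ring
  intro t ht
  obtain ⟨n, hn⟩ := pow_unbounded_of_one_lt (t / t₀) one_lt_two
  refine key n t ht ?_
  rw [div_lt_iff₀ ht₀] at hn
  refine hn.le.trans ?_
  gcongr
  · exact one_le_two
  · omega

/-! ### Uniform tail bounds for weighted infinite sums -/

section Remainder

variable {Ω : Type*} [MeasurableSpace Ω] {μ : Measure Ω} [IsProbabilityMeasure μ]

lemma integrable_min_rpow {W : Ω → ℝ} (hW : Measurable W) (hW0 : ∀ ω, 0 ≤ W ω) {p t : ℝ}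
    (hp : 0 < p) (ht : 0 < t) : Integrable (fun ω => min (W ω) t ^ p) μ := by
  refine Integrable.of_bound (C := t ^ p) ?_ (ae_of_all _ fun ω => ?_)
  · exact ((hW.min measurable_const).pow_const p).aestronglyMeasurable
  · have h0 : 0 ≤ min (W ω) t := le_min (hW0 ω) ht.le
    rw [Real.norm_of_nonneg (by positivity)]
    exact Real.rpow_le_rpow h0 (min_le_right _ _) hp.le

/-- Karamata bound for the truncated moments of a random variable with regularly varying tail. -/
lemma RegVarTail.integral_min_rpow_le {H : ℝ → ℝ} {α : ℝ} (hH : RegVarTail H α) {p : ℝ}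
    (hp : 0 < p) (hαp : α < p) :
    ∃ C > 0, ∃ t₀ > 0, ∀ W : Ω → ℝ, Measurable W → (∀ ω, 0 ≤ W ω) →
      (∀ t, μ.real {ω | t < W ω} = H t) → ∀ t ≥ t₀,
      ∫ ω, min (W ω) t ^ p ∂μ ≤ C * t ^ p * H t := by
  obtain ⟨C, hC, t₀, ht₀, h⟩ := hH.karamata hαp
  refine ⟨C, hC, t₀, ht₀, fun W hW hW0 hWH => h (fun t => ∫ ω, min (W ω) t ^ p ∂μ) ?_ ?_⟩
  · intro t ht
    have hms : MeasurableSet {ω | t < W ω} := measurableSet_lt measurable_const hW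
    have hi : Integrable ({ω | t < W ω}.indicator fun _ => (2 * t) ^ p) μ :=
      (integrable_const _).indicator hms
    -- Raising the truncation level from `t` to `2 t` only matters on `{W > t}`, where the integrand
    -- is at most `(2 t) ^ p`.
    calc ∫ ω, min (W ω) (2 * t) ^ p ∂μ
        ≤ ∫ ω, (min (W ω) t ^ p + {ω | t < W ω}.indicator (fun _ => (2 * t) ^ p) ω) ∂μ := by
          refine integral_mono (integrable_min_rpow hW hW0 hp (by positivity))
            ((integrable_min_rpow hW hW0 hp ht).add hi) fun ω => ?_
          by_cases hω : t < W ω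
          · have h0 : 0 ≤ min (W ω) t := le_min (hW0 ω) ht.le
            have h1 : 0 ≤ min (W ω) (2 * t) := le_min (hW0 ω) (by linarith)
            simp only [Set.indicator, Set.mem_ofPred_eq, hω, if_true]
            have := Real.rpow_le_rpow h1 (min_le_right (W ω) (2 * t)) hp.le
            have := Real.rpow_nonneg h0 p
            linarith
          · simp only [Set.indicator, Set.mem_ofPred_eq, hω, if_false, add_zero]
            rw [min_eq_left (by linarith), min_eq_left (by linarith)]
      _ = _ := by
          rw [integral_add (integrable_min_rpow hW hW0 hp ht) hi, integral_indicator_const _ hms,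
            hWH, smul_eq_mul, mul_comm (H t)]
  · intro t ht
    calc ∫ ω, min (W ω) t ^ p ∂μ ≤ ∫ _, t ^ p ∂μ := by
          refine integral_mono (integrable_min_rpow hW hW0 hp ht) (integrable_const _) fun ω => ?_
          exact Real.rpow_le_rpow (le_min (hW0 ω) ht.le) (min_le_right _ _) hp.le
      _ = t ^ p := by simp

/-- A form of Hölder's inequality for series. -/
lemma tsum_mul_rpow_le {p q : ℝ} (hpq : p.HolderConjugate q) (u v : ℕ → ENNReal)
    (hu : ∑' j, u j ^ q ≤ 1) : (∑' j, u j * v j) ^ p ≤ ∑' j, v j ^ p := by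
  have h := ENNReal.lintegral_mul_le_Lp_mul_Lq (Measure.count : Measure ℕ) hpq
    (f := v) (g := u) (measurable_of_countable _).aemeasurable
    (measurable_of_countable _).aemeasurable
  simp only [lintegral_count, Pi.mul_apply] at h
  have hp := hpq.pos
  calc (∑' j, u j * v j) ^ p = (∑' j, v j * u j) ^ p := by simp_rw [mul_comm]
    _ ≤ ((∑' j, v j ^ p) ^ (1 / p) * (∑' j, u j ^ q) ^ (1 / q)) ^ p := by gcongr
    _ ≤ ((∑' j, v j ^ p) ^ (1 / p) * 1) ^ p := by
        gcongr
        exact ENNReal.rpow_le_one hu (one_div_nonneg.2 hpq.symm.nonneg)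
    _ = _ := by rw [mul_one, ← ENNReal.rpow_mul, one_div_mul_cancel hp.ne', ENNReal.rpow_one]

/-- If `W j ≥ 0` have the common regularly varying tail `H` and `∑ a j ^ δ ≤ 1`, then the tail of
`∑ a j W j` is at most a constant times `(∑ a j ^ δ) H`, uniformly in `a` and `W`. -/
lemma RegVarTail.exists_tail_tsum_bound {H : ℝ → ℝ} {α : ℝ} (hH : RegVarTail H α) (hα : 0 < α)
    {δ : ℝ} (hδ : 0 < δ) (hδα : δ < α) (hδ1 : δ < 1) :
    ∃ K > 0, ∃ t₀ > 0, ∀ (a : ℕ → ℝ) (W : ℕ → Ω → ℝ), (∀ j, 0 ≤ a j) → (∀ j, a j ≤ 1) →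
      Summable (fun j => a j ^ δ) → ∑' j, a j ^ δ ≤ 1 → (∀ j, Measurable (W j)) →
      (∀ j ω, 0 ≤ W j ω) → (∀ j t, μ.real {ω | t < W j ω} = H t) → ∀ t ≥ t₀,
      μ {ω | ENNReal.ofReal t < ∑' j, ENNReal.ofReal (a j * W j ω)} ≤
        ENNReal.ofReal (K * (∑' j, a j ^ δ) * H t) := by
  -- The moment order must exceed `α` for Karamata and `1` for Hölder, while `p δ < α` makes `p δ`
  -- an admissible Potter exponent. Such `p` exists because `δ < min α 1`.
  obtain ⟨p, hp1, hp2⟩ : ∃ p, max α 1 < p ∧ p < α / δ := exists_between (by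
    rw [lt_div_iff₀ hδ]
    rcases le_total α 1 with h | h
    · rw [max_eq_right h]; linarith
    · rw [max_eq_left h]; nlinarith)
  have hpα : α < p := (le_max_left _ _).trans_lt hp1
  have hp1 : 1 < p := (le_max_right _ _).trans_lt hp1
  have hp : 0 < p := by linarith
  rw [lt_div_iff₀ hδ] at hp2
  set β := p * δ
  have hβ : 0 < β := by positivity
  set q := p / (p - 1)
  have hpq : p.HolderConjugate q := Real.HolderConjugate.conjExponent hp1
  obtain ⟨t₁, ht₁, hpot⟩ := hH.potter hβ.le hp2
  obtain ⟨C, hC, t₂, ht₂, hkar⟩ := hH.integral_min_rpow_le (μ := μ) hp hpα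
  refine ⟨2 ^ β + C * 2 ^ β, by positivity, max t₁ t₂, by positivity,
    fun a W ha0 ha1 hsum hle hWm hW0 hWH t ht => ?_⟩
  have ht1 : t₁ ≤ t := (le_max_left _ _).trans ht
  have ht2 : t₂ ≤ t := (le_max_right _ _).trans ht
  have ht0 : 0 < t := ht₁.trans_le ht1
  have hHt := hH.pos t
  have hpot' : ∀ j, 0 < a j → H (t / a j) ≤ 2 ^ β * a j ^ β * H t := by
    intro j hj
    have := hpot t ht1 (a j)⁻¹ ((one_le_inv₀ hj).2 (ha1 j))
    rwa [Real.inv_rpow hj.le, Real.rpow_neg hj.le, inv_inv, inv_mul_eq_div] at this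
  have htail : ∀ j, μ {ω | t < a j * W j ω} ≤ ENNReal.ofReal (2 ^ β * H t * a j ^ δ) := by
    intro j
    rcases (ha0 j).eq_or_lt with h | h
    · simp [← h, ht0.not_gt]
    · have : {ω | t < a j * W j ω} = {ω | t / a j < W j ω} := by
        ext ω; simp only [Set.mem_ofPred_eq]; rw [div_lt_iff₀ h, mul_comm]
      rw [this, ← ofReal_measureReal, hWH]
      apply ENNReal.ofReal_le_ofReal
      refine (hpot' j h).trans ?_
      have : a j ^ β ≤ a j ^ δ := Real.rpow_le_rpow_of_exponent_ge h (ha1 j) (by nlinarith)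
      calc 2 ^ β * a j ^ β * H t ≤ 2 ^ β * a j ^ δ * H t := by gcongr
        _ = _ := by ring
  -- The Hölder weights `a j ^ e` satisfy `(a j ^ e) ^ q = a j ^ δ`, which sums to at most `1`.
  -- Dividing the truncated terms by these weights leaves moments of order `a j ^ (β - e p) = a j ^
  -- δ`, which are again summable.
  set e := δ / q
  have hq : 0 < q := hpq.symm.pos
  have he : e * p = δ * (p - 1) := by
    have : p - 1 ≠ 0 := by linarith
    simp only [e, q]; field_simp
  set v : ℕ → Ω → ℝ := fun j ω => a j ^ (-e) * min (a j * W j ω) t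
  have hv0 : ∀ j ω, 0 ≤ v j ω := fun j ω => mul_nonneg (Real.rpow_nonneg (ha0 j) _)
    (le_min (mul_nonneg (ha0 j) (hW0 j ω)) ht0.le)
  have hvm : ∀ j, Measurable (v j) := fun j =>
    (((hWm j).const_mul (a j)).min measurable_const).const_mul _
  have hmom : ∀ j, ∫⁻ ω, ENNReal.ofReal (v j ω) ^ p ∂μ
      ≤ ENNReal.ofReal (C * 2 ^ β * H t * t ^ p * a j ^ δ) := by
    intro j
    rcases (ha0 j).eq_or_lt with h | h
    · have : ∀ ω, v j ω = 0 := fun ω => by simp [v, ← h, ht0.le]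
      simp [this, ENNReal.zero_rpow_of_pos hp]
    have hta : t₂ ≤ t / a j := ht2.trans (by rw [le_div_iff₀ h]; nlinarith [ha1 j])
    have hv : ∀ ω, v j ω ^ p = a j ^ (-e * p) * a j ^ p * min (W j ω) (t / a j) ^ p := by
      intro ω
      have h1 : min (a j * W j ω) t = a j * min (W j ω) (t / a j) := by
        rw [mul_min_of_nonneg _ _ h.le, mul_div_cancel₀ _ h.ne']
      have h2 : 0 ≤ min (W j ω) (t / a j) := le_min (hW0 j ω) (by positivity)
      simp only [v]
      rw [h1, Real.mul_rpow (by positivity) (by positivity), Real.mul_rpow h.le h2,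
        ← Real.rpow_mul h.le, mul_assoc]
    calc ∫⁻ ω, ENNReal.ofReal (v j ω) ^ p ∂μ = ∫⁻ ω, ENNReal.ofReal (v j ω ^ p) ∂μ := by
          simp_rw [ENNReal.ofReal_rpow_of_nonneg (hv0 j _) hp.le]
      _ = ENNReal.ofReal (∫ ω, v j ω ^ p ∂μ) := by
          rw [ofReal_integral_eq_lintegral_ofReal]
          · simp_rw [hv]
            exact (integrable_min_rpow (hWm j) (hW0 j) hp (by positivity)).const_mul _
          · exact ae_of_all _ fun ω => Real.rpow_nonneg (hv0 j ω) _
      _ ≤ _ := by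
          apply ENNReal.ofReal_le_ofReal
          simp_rw [hv]
          rw [integral_const_mul]
          calc a j ^ (-e * p) * a j ^ p * ∫ ω, min (W j ω) (t / a j) ^ p ∂μ
              ≤ a j ^ (-e * p) * a j ^ p * (C * (t / a j) ^ p * H (t / a j)) := by
                gcongr
                exact hkar (W j) (hWm j) (hW0 j) (hWH j) _ hta
            _ ≤ a j ^ (-e * p) * a j ^ p * (C * (t / a j) ^ p * (2 ^ β * a j ^ β * H t)) := by
                gcongr
                exact hpot' j h
            _ = C * 2 ^ β * H t * t ^ p * (a j ^ (-e * p) * a j ^ β) := by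
                rw [Real.div_rpow ht0.le h.le]
                have := (Real.rpow_pos_of_pos h p).ne'
                field_simp
            _ = _ := by
                rw [← Real.rpow_add h]
                congr 2
                simp only [β]; linarith
  have hsum1 : ∀ c : ℝ, 0 ≤ c →
      ∑' j, ENNReal.ofReal (c * a j ^ δ) = ENNReal.ofReal (c * ∑' j, a j ^ δ) := by
    intro c hc
    rw [← ENNReal.ofReal_tsum_of_nonneg (fun j => mul_nonneg hc (Real.rpow_nonneg (ha0 j) _))
      (hsum.mul_left c), tsum_mul_left]
  have hu : ∑' j, ENNReal.ofReal (a j ^ e) ^ q ≤ 1 := by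
    have : ∀ j, ENNReal.ofReal (a j ^ e) ^ q = ENNReal.ofReal (1 * a j ^ δ) := fun j => by
      rw [ENNReal.ofReal_rpow_of_nonneg (Real.rpow_nonneg (ha0 j) _) hq.le,
        ← Real.rpow_mul (ha0 j), div_mul_cancel₀ _ hq.ne', one_mul]
    simp_rw [this]
    rw [hsum1 1 zero_le_one, one_mul]
    exact ENNReal.ofReal_le_one.2 hle
  set B := {ω | ENNReal.ofReal (t ^ p) ≤ ∑' j, ENNReal.ofReal (v j ω) ^ p}
  have hB : μ B ≤ ENNReal.ofReal (C * 2 ^ β * H t * ∑' j, a j ^ δ) := by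
    have hm : Measurable fun ω => ∑' j, ENNReal.ofReal (v j ω) ^ p :=
      Measurable.tsum fun j => ((hvm j).ennreal_ofReal).pow_const p
    have h1 := mul_meas_ge_le_lintegral (μ := μ) hm (ENNReal.ofReal (t ^ p))
    rw [lintegral_tsum fun j => (((hvm j).ennreal_ofReal).pow_const p).aemeasurable] at h1
    have h2 := h1.trans (ENNReal.tsum_le_tsum hmom)
    rw [hsum1 _ (by positivity)] at h2
    have htp : 0 < t ^ p := by positivity
    have h3 : C * 2 ^ β * H t * t ^ p * ∑' j, a j ^ δ
        = t ^ p * (C * 2 ^ β * H t * ∑' j, a j ^ δ) := by ring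
    rw [h3, ENNReal.ofReal_mul htp.le] at h2
    exact (ENNReal.mul_le_mul_iff_right (by simpa using htp) (by simp)).1 h2
  -- Either some single term exceeds `t`, or truncation at `t` changes no term and Hölder turns a
  -- large sum into a large sum of `p`-th powers.
  have hsub : {ω | ENNReal.ofReal t < ∑' j, ENNReal.ofReal (a j * W j ω)}
      ⊆ (⋃ j, {ω | t < a j * W j ω}) ∪ B := by
    intro ω hω
    by_cases h : ∃ j, t < a j * W j ω
    · exact Or.inl (Set.mem_iUnion.2 h)
    · push Not at h
      right
      have h1 : ∀ j, ENNReal.ofReal (a j * W j ω)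
          = ENNReal.ofReal (a j ^ e) * ENNReal.ofReal (v j ω) := by
        intro j
        rw [← ENNReal.ofReal_mul (Real.rpow_nonneg (ha0 j) _)]
        congr 1
        simp only [v]
        rw [min_eq_left (h j)]
        rcases (ha0 j).eq_or_lt with h0 | h0
        · simp [← h0]
        · rw [← mul_assoc, ← Real.rpow_add h0]; simp
      simp only [Set.mem_ofPred_eq, h1] at hω
      simp only [B, Set.mem_ofPred_eq]
      refine le_trans ?_ (tsum_mul_rpow_le hpq _ _ hu)
      rw [← ENNReal.ofReal_rpow_of_nonneg ht0.le hp.le]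
      exact ENNReal.rpow_le_rpow hω.le hp.le
  have hs0 : 0 ≤ ∑' j, a j ^ δ := tsum_nonneg fun j => Real.rpow_nonneg (ha0 j) _
  calc μ {ω | ENNReal.ofReal t < ∑' j, ENNReal.ofReal (a j * W j ω)}
      ≤ μ (⋃ j, {ω | t < a j * W j ω}) + μ B := (measure_mono hsub).trans (measure_union_le _ _)
    _ ≤ ∑' j, ENNReal.ofReal (2 ^ β * H t * a j ^ δ)
        + ENNReal.ofReal (C * 2 ^ β * H t * ∑' j, a j ^ δ) := by
        gcongr
        exact (measure_iUnion_le _).trans (ENNReal.tsum_le_tsum htail)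
    _ = _ := by
        rw [hsum1 _ (by positivity), ← ENNReal.ofReal_add (by positivity) (by positivity)]
        congr 1
        ring

end Remainder

/-! ### Tails of sums -/

/-- The tail function `t ↦ P(|U| > t)`. -/
noncomputable def absTail {Ω : Type*} [MeasurableSpace Ω] (μ : Measure Ω) (U : Ω → ℝ) (t : ℝ) : ℝ :=
  μ.real {ω | t < |U ω|}

/-- The finite part `∑_{j < m} c_j Z_{n-j}` of a linear process. -/
noncomputable def truncSeries {Ω : Type*} (c : ℕ → ℝ) (Z : ℤ → Ω → ℝ) (m : ℕ) (n : ℤ) (ω : Ω) : ℝ :=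
  ∑ j ∈ Finset.range m, c j * Z (n - j) ω

lemma RegVarTail.tendsto_comp_mul {H F : ℝ → ℝ} {α : ℝ} (hH : RegVarTail H α) {L : ℝ}
    (hF : Tendsto (fun t => F t / H t) atTop (𝓝 L)) {y : ℝ} (hy : 0 < y) :
    Tendsto (fun t => F (y * t) / H t) atTop (𝓝 (L * y ^ (-α))) := by
  have h1 : Tendsto (fun t : ℝ => y * t) atTop atTop := tendsto_id.const_mul_atTop hy
  refine ((hF.comp h1).mul (hH.tendsto_ratio y hy)).congr fun t => ?_
  have := (hH.pos (y * t)).ne'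
  simp only [Function.comp]
  field_simp

/-- A function that is close to functions asymptotic to multiples of `H` is itself asymptotic to a
multiple of `H`. -/
lemma RegVarTail.tendsto_of_sandwich {H f : ℝ → ℝ} {α : ℝ} (hH : RegVarTail H α) {L : ℝ}
    (h : ∀ ε, 0 < ε → ε < 1 → ∃ (F : ℝ → ℝ) (L' : ℝ), Tendsto (fun t => F t / H t) atTop (𝓝 L') ∧
      |L' - L| ≤ ε ∧ ∀ᶠ t in atTop, f t ≤ F ((1 - ε) * t) + ε * H t ∧
        F ((1 + ε) * t) - ε * H t ≤ f t) :
    Tendsto (fun t => f t / H t) atTop (𝓝 L) := by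
  -- The bounds divided by `H` tend to `L' (1 ± ε) ^ (-α)` up to an error `ε`, with `L'` within `ε`
  -- of `L`. By continuity at `ε = 0` a suitably small `ε` beats any given strict inequality.
  have hsmall : ∀ᶠ ε in 𝓝[>] (0 : ℝ), 0 < ε ∧ ε < 1 := by
    filter_upwards [Ioo_mem_nhdsGT (zero_lt_one' ℝ)] with ε hε using hε
  refine tendsto_order.2 ⟨fun a ha => ?_, fun a ha => ?_⟩
  · have hc : ContinuousAt (fun ε : ℝ => (L - ε) * (1 + ε) ^ (-α) - ε) 0 :=
      ((continuousAt_const.sub continuousAt_id).mul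
        ((continuousAt_const.add continuousAt_id).rpow_const (Or.inl (by simp)))).sub continuousAt_id
    have h1 : ∀ᶠ ε in 𝓝[>] (0 : ℝ), a < (L - ε) * (1 + ε) ^ (-α) - ε :=
      (hc.tendsto.mono_left nhdsWithin_le_nhds).eventually_const_lt (by simpa using ha)
    obtain ⟨ε, hε, hε0, hε1⟩ := (h1.and hsmall).exists
    obtain ⟨F, L', hF, hL, hev⟩ := h ε hε0 hε1
    have hlim := (hH.tendsto_comp_mul hF (y := 1 + ε) (by linarith)).sub_const ε
    have hlt : a < L' * (1 + ε) ^ (-α) - ε := by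
      refine hε.trans_le ?_
      have := (abs_le.1 hL).1
      gcongr
      linarith
    filter_upwards [hev, hlim.eventually_const_lt hlt] with t ht1 ht2
    rw [lt_div_iff₀ (hH.pos t)]
    rw [lt_sub_iff_add_lt, lt_div_iff₀ (hH.pos t)] at ht2
    linarith [ht1.2]
  · have hc : ContinuousAt (fun ε : ℝ => (L + ε) * (1 - ε) ^ (-α) + ε) 0 :=
      ((continuousAt_const.add continuousAt_id).mul
        ((continuousAt_const.sub continuousAt_id).rpow_const (Or.inl (by simp)))).add continuousAt_id
    have h1 : ∀ᶠ ε in 𝓝[>] (0 : ℝ), (L + ε) * (1 - ε) ^ (-α) + ε < a :=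
      (hc.tendsto.mono_left nhdsWithin_le_nhds).eventually_lt_const (by simpa using ha)
    obtain ⟨ε, hε, hε0, hε1⟩ := (h1.and hsmall).exists
    obtain ⟨F, L', hF, hL, hev⟩ := h ε hε0 hε1
    have hlim := (hH.tendsto_comp_mul hF (y := 1 - ε) (by linarith)).add_const ε
    have hlt : L' * (1 - ε) ^ (-α) + ε < a := by
      refine lt_of_le_of_lt ?_ hε
      have := (abs_le.1 hL).2
      have : 0 ≤ (1 - ε) ^ (-α) := Real.rpow_nonneg (by linarith) _
      gcongr
      linarith
    filter_upwards [hev, hlim.eventually_lt_const hlt] with t ht1 ht2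
    rw [div_lt_iff₀ (hH.pos t)]
    rw [← lt_sub_iff_add_lt, div_lt_iff₀ (hH.pos t)] at ht2
    linarith [ht1.1]

/-- Positivity of `f` needs no hypothesis: `f / H` is eventually positive, so `f` is positive at
arbitrarily large points, and by monotonicity everywhere. -/
lemma RegVarTail.of_tendsto_div {H f : ℝ → ℝ} {α K : ℝ} (hH : RegVarTail H α) (hf : Antitone f)
    (hK : 0 < K) (hfH : Tendsto (fun t => f t / H t) atTop (𝓝 K)) :
    RegVarTail f α := by
  have hpos : ∀ t, 0 < f t := by
    intro t
    obtain ⟨s, hs1, hs2⟩ := ((hfH.eventually_const_lt hK).and (eventually_ge_atTop t)).exists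
    exact ((div_pos_iff_of_pos_right (hH.pos s)).1 hs1).trans_le (hf hs2)
  refine ⟨hf, hpos, fun y hy => ?_⟩
  have h1 := (hH.tendsto_comp_mul hfH hy).div hfH hK.ne'
  rw [mul_div_cancel_left₀ _ hK.ne'] at h1
  refine h1.congr fun t => ?_
  have := (hH.pos t).ne'
  have := (hpos t).ne'
  simp only [Pi.div_apply]
  field_simp

lemma RegVarTail.tendsto_zero {H : ℝ → ℝ} {α : ℝ} (hH : RegVarTail H α) (hα : 0 < α) :
    Tendsto H atTop (𝓝 0) := by
  obtain ⟨t₀, ht₀, h⟩ := hH.potter (β := α / 2) (by positivity) (by linarith)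
  have h1 : Tendsto (fun v : ℝ => 2 ^ (α / 2) * (v / t₀) ^ (-(α / 2)) * H t₀) atTop (𝓝 0) := by
    have := ((tendsto_rpow_neg_atTop (y := α / 2) (by positivity)).comp
      (tendsto_id.atTop_div_const ht₀)).const_mul (2 ^ (α / 2)) |>.mul_const (H t₀)
    simpa using this
  refine tendsto_of_tendsto_of_tendsto_of_le_of_le' tendsto_const_nhds h1
    (Eventually.of_forall fun t => (hH.pos t).le) ?_
  filter_upwards [eventually_ge_atTop t₀] with v hv
  have := h t₀ le_rfl (v / t₀) (by rwa [ge_iff_le, one_le_div ht₀])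
  rwa [div_mul_cancel₀ _ ht₀.ne'] at this

section

variable {Ω : Type*} [MeasurableSpace Ω] {μ : Measure Ω} [IsProbabilityMeasure μ]

lemma absTail_nonneg (U : Ω → ℝ) (t : ℝ) : 0 ≤ absTail μ U t := measureReal_nonneg

lemma absTail_antitone (U : Ω → ℝ) : Antitone (absTail μ U) := fun _ _ h =>
  measureReal_mono fun _ hω => lt_of_le_of_lt h hω

lemma measurableSet_absTail {U : Ω → ℝ} (hU : Measurable U) (t : ℝ) :
    MeasurableSet {ω | t < |U ω|} := measurableSet_lt measurable_const (by fun_prop)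

lemma absTail_add_le (U V : Ω → ℝ) (s t : ℝ) :
    absTail μ (fun ω => U ω + V ω) (s + t) ≤ absTail μ U s + absTail μ V t := by
  refine (measureReal_mono fun ω hω => ?_).trans (measureReal_union_le _ _)
  simp only [Set.mem_ofPred_eq, Set.mem_union] at hω ⊢
  by_contra! h
  linarith [abs_add_le (U ω) (V ω)]

/-- The balanced tail condition makes the tail of `|Z|` regularly varying. -/
lemma RegVaryingTails.regVarTail {Z : Ω → ℝ} (hZm : Measurable Z) {γ : ℝ}
    (hZ : RegVaryingTails μ γ Z) :
    RegVarTail (absTail μ Z) (1 / γ) := by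
  obtain ⟨L, π₁, π₂, hL, -, -, hπ, h1, h2⟩ := hZ
  set α := 1 / γ
  have hα : -1 / γ = -α := by simp only [α]; ring
  rw [hα] at h1 h2
  set G : ℝ → ℝ := fun z => μ.real {ω | z < Z ω} + μ.real {ω | Z ω ≤ -z}
  set l : ℝ → ℝ := fun z => z ^ (-α) * L z
  have hGl : Tendsto (fun z => G z / l z) atTop (𝓝 1) := by
    rw [← hπ]
    exact (h1.add h2).congr fun z => by simp only [G, l]; ring
  have hG0 : ∀ z, 0 ≤ G z := fun z => add_nonneg measureReal_nonneg measureReal_nonneg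
  have hGanti : Antitone G := fun a b h => add_le_add
    (measureReal_mono fun ω hω => lt_of_le_of_lt h hω)
    (measureReal_mono fun ω hω => by simp only [Set.mem_ofPred_eq] at hω ⊢; linarith)
  have hGpos : ∀ t, 0 < G t := by
    intro t
    obtain ⟨s, hs1, hs2⟩ :=
      ((hGl.eventually_const_lt one_pos).and (eventually_ge_atTop t)).exists
    refine lt_of_lt_of_le ((hG0 s).lt_of_ne fun h => ?_) (hGanti hs2)
    rw [← h, zero_div] at hs1
    exact lt_irrefl _ hs1
  -- No sign of `L` is assumed. A zero of `l` would make the quotient `0` by the division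
  -- convention, contradicting the limit `1`.
  have hlne : ∀ᶠ z in atTop, l z ≠ 0 := by
    filter_upwards [hGl.eventually_const_lt one_pos] with z hz h
    rw [h, div_zero] at hz
    exact lt_irrefl _ hz
  have hGreg : RegVarTail G α := by
    refine ⟨hGanti, hGpos, fun y hy => ?_⟩
    have hy1 : Tendsto (fun t : ℝ => y * t) atTop atTop := tendsto_id.const_mul_atTop hy
    have h3 := (((hGl.comp hy1).mul ((hL y hy).const_mul (y ^ (-α)))).div hGl one_ne_zero)
    simp only [mul_one, one_mul, div_one] at h3
    refine h3.congr' ?_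
    filter_upwards [hlne, hy1.eventually hlne, eventually_gt_atTop 0] with t ht1 ht2 ht3
    have hG := (hGpos t).ne'
    have hLt : L t ≠ 0 := fun h => ht1 (by simp [l, h])
    have hLyt : L (y * t) ≠ 0 := fun h => ht2 (by simp [l, h])
    have e1 : y ^ (-α) ≠ 0 := (Real.rpow_pos_of_pos hy _).ne'
    have e2 : t ^ (-α) ≠ 0 := (Real.rpow_pos_of_pos ht3 _).ne'
    simp only [Pi.div_apply, Function.comp, l]
    rw [Real.mul_rpow hy.le ht3.le]
    field_simp
  -- `G` and the tail of `|Z|` differ only through an atom at `-z`, which the arguments `(1 ± ε) t`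
  -- absorb.
  refine hGreg.of_tendsto_div (absTail_antitone _) one_pos ?_
  refine hGreg.tendsto_of_sandwich fun ε hε0 hε1 => ⟨G, 1, ?_, by simpa using hε0.le, ?_⟩
  · exact tendsto_const_nhds.congr fun t => (div_self (hGpos t).ne').symm
  · filter_upwards [eventually_gt_atTop 0] with t ht
    have hεG : 0 ≤ ε * G t := mul_nonneg hε0.le (hG0 t)
    constructor
    · have : absTail μ Z t ≤ G t := by
        refine (measureReal_mono fun ω hω => ?_).trans (measureReal_union_le _ _)
        simp only [Set.mem_ofPred_eq, Set.mem_union] at hω ⊢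
        rcases lt_abs.1 hω with h | h
        · exact Or.inl h
        · exact Or.inr (by linarith)
      have := hGanti (show (1 - ε) * t ≤ t by nlinarith)
      linarith
    · have hle : G ((1 + ε) * t) ≤ absTail μ Z t := by
        have hlt : t < (1 + ε) * t := by nlinarith
        have hdisj : Disjoint {ω | (1 + ε) * t < Z ω} {ω | Z ω ≤ -((1 + ε) * t)} := by
          rw [Set.disjoint_left]
          intro ω h3 h4
          simp only [Set.mem_ofPred_eq] at h3 h4
          linarith
        rw [show G ((1 + ε) * t) = _ from
          (measureReal_union hdisj (measurableSet_le hZm measurable_const)).symm]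
        refine measureReal_mono fun ω hω => ?_
        simp only [Set.mem_ofPred_eq, Set.mem_union, lt_abs] at hω ⊢
        rcases hω with h | h
        · left; linarith
        · right; linarith
      linarith

/-- If `U` and `V` are independent and have tails asymptotic to multiples of the regularly
varying `H`, then the tail constants add up. -/
lemma RegVarTail.absTail_add {H : ℝ → ℝ} {α : ℝ} (hH : RegVarTail H α) (hα : 0 < α)
    {U V : Ω → ℝ} (hU : Measurable U) (hV : Measurable V) (hUV : IndepFun U V μ) {u v : ℝ}
    (hu : Tendsto (fun t => absTail μ U t / H t) atTop (𝓝 u))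
    (hv : Tendsto (fun t => absTail μ V t / H t) atTop (𝓝 v)) :
    Tendsto (fun t => absTail μ (fun ω => U ω + V ω) t / H t) atTop (𝓝 (u + v)) := by
  have hprod : ∀ s t, μ.real ({ω | s < |U ω|} ∩ {ω | t < |V ω|}) = absTail μ U s * absTail μ V t := by
    intro s t
    have := hUV.measure_inter_preimage_eq_mul {x | s < |x|} {x | t < |x|}
      (measurableSet_lt measurable_const (by fun_prop))
      (measurableSet_lt measurable_const (by fun_prop))
    simp only [measureReal_def, absTail, ← ENNReal.toReal_mul]
    exact congrArg _ this
  have hV0 : Tendsto (absTail μ V) atTop (𝓝 0) := by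
    have := hv.mul (hH.tendsto_zero hα)
    rw [mul_zero] at this
    exact this.congr fun t => div_mul_cancel₀ _ (hH.pos t).ne'
  refine hH.tendsto_of_sandwich fun ε hε0 hε1 =>
    ⟨fun t => absTail μ U t + absTail μ V t, u + v, ?_, by simpa using hε0.le, ?_⟩
  · exact (hu.add hv).congr fun t => by rw [add_div]
  -- Both variables exceeding `ε t` has probability `o(H t)`: by independence it is a product of a
  -- term of order `H t` and a term tending to `0`.
  have hcross : Tendsto (fun t => absTail μ U (ε * t) / H t * absTail μ V (ε * t)) atTop (𝓝 0) := by
    have := (hH.tendsto_comp_mul hu hε0).mul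
      (hV0.comp ((tendsto_id (α := ℝ)).const_mul_atTop hε0))
    simpa using this
  filter_upwards [hcross.eventually_lt_const (half_pos hε0), eventually_gt_atTop 0] with t h1 ht
  have h2 : absTail μ U (ε * t) * absTail μ V (ε * t) ≤ ε / 2 * H t := by
    rw [div_mul_eq_mul_div, div_lt_iff₀ (hH.pos t)] at h1
    exact h1.le
  have hHt := hH.pos t
  constructor
  -- A large sum needs one summand above `(1 - ε) t`, unless both exceed `ε t`.
  · have hsub : {ω | t < |U ω + V ω|} ⊆ ({ω | (1 - ε) * t < |U ω|} ∪ {ω | (1 - ε) * t < |V ω|}) ∪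
        ({ω | ε * t < |U ω|} ∩ {ω | ε * t < |V ω|}) := by
      intro ω hω
      simp only [Set.mem_ofPred_eq, Set.mem_union, Set.mem_inter_iff] at hω ⊢
      by_contra! h
      obtain ⟨⟨h3, h4⟩, h5⟩ := h
      have := abs_add_le (U ω) (V ω)
      have h6 : ε * t < |U ω| := by linarith
      linarith [h5 h6]
    have := (measureReal_mono (μ := μ) hsub).trans ((measureReal_union_le _ _).trans
      (add_le_add_left (measureReal_union_le _ _) _))
    rw [hprod] at this
    simp only [absTail] at *
    nlinarith
  -- Conversely, one summand above `(1 + ε) t` with the other at most `ε t` forces a large sum. The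
  -- two events of this kind are disjoint, so their probabilities add.
  · set A := {ω | (1 + ε) * t < |U ω|} \ {ω | ε * t < |V ω|}
    set B := {ω | (1 + ε) * t < |V ω|} \ {ω | ε * t < |U ω|}
    have hA : absTail μ U ((1 + ε) * t) - absTail μ U (ε * t) * absTail μ V (ε * t) ≤ μ.real A := by
      have h3 := measureReal_sdiff_add_inter (μ := μ) (s := {ω | (1 + ε) * t < |U ω|})
        (measurableSet_absTail hV (ε * t))
      rw [hprod] at h3
      have h4 : absTail μ U ((1 + ε) * t) ≤ absTail μ U (ε * t) :=
        absTail_antitone _ (by nlinarith)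
      have h5 := mul_le_mul_of_nonneg_right h4 (absTail_nonneg (μ := μ) V (ε * t))
      simp only [A]
      change _ = absTail μ U ((1 + ε) * t) at h3
      linarith
    have hB : absTail μ V ((1 + ε) * t) - absTail μ U (ε * t) * absTail μ V (ε * t) ≤ μ.real B := by
      have h3 := measureReal_sdiff_add_inter (μ := μ) (s := {ω | (1 + ε) * t < |V ω|})
        (measurableSet_absTail hU (ε * t))
      rw [Set.inter_comm, hprod] at h3
      have h4 : absTail μ V ((1 + ε) * t) ≤ absTail μ V (ε * t) :=
        absTail_antitone _ (by nlinarith)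
      have h5 := mul_le_mul_of_nonneg_left h4 (absTail_nonneg (μ := μ) U (ε * t))
      simp only [B]
      change _ = absTail μ V ((1 + ε) * t) at h3
      linarith
    have hAB : Disjoint A B := by
      rw [Set.disjoint_left]
      rintro ω ⟨h3, -⟩ ⟨-, h4⟩
      simp only [Set.mem_ofPred_eq] at h3 h4
      nlinarith
    have hmB : MeasurableSet B := (measurableSet_absTail hV _).diff (measurableSet_absTail hU _)
    have hsub : A ∪ B ⊆ {ω | t < |U ω + V ω|} := by
      rintro ω (⟨h3, h4⟩ | ⟨h3, h4⟩) <;> simp only [Set.mem_ofPred_eq, not_lt] at h3 h4 ⊢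
      · have := abs_sub_abs_le_abs_sub (U ω) (-V ω)
        rw [abs_neg, sub_neg_eq_add] at this
        linarith
      · have := abs_sub_abs_le_abs_sub (V ω) (-U ω)
        rw [abs_neg, sub_neg_eq_add, add_comm (V ω)] at this
        linarith
    have h5 := measureReal_mono (μ := μ) hsub
    rw [measureReal_union hAB hmB] at h5
    simp only [absTail] at *
    linarith


/-- Independent copies `Z n` of a random variable with regularly varying tail, with coefficients
for which the linear process is well defined. -/
structure HeavyTailedInnovations (μ : Measure Ω) (Z : ℤ → Ω → ℝ) (c : ℕ → ℝ) (H : ℝ → ℝ)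
    (α δ : ℝ) : Prop where
  meas : ∀ n, Measurable (Z n)
  indep : iIndepFun Z μ
  ident : ∀ n, IdentDistrib (Z n) (Z 0) μ μ
  tail : ∀ n t, absTail μ (Z n) t = H t
  regVar : RegVarTail H α
  index_pos : 0 < α
  exp_pos : 0 < δ
  exp_lt : δ < α
  exp_lt_one : δ < 1
  summable : Summable fun j => |c j| ^ δ
  exists_ne : ∃ j, c j ≠ 0

/-! ### Convergence and tail of the linear process -/

namespace HeavyTailedInnovations

variable {Z : ℤ → Ω → ℝ} {c : ℕ → ℝ} {H : ℝ → ℝ} {α δ : ℝ}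

/-- The tails of the remainder series are eventually negligible compared to `H`. -/
lemma eventually_remainder_le (h : HeavyTailedInnovations μ Z c H α δ) {η : ℝ} (hη : 0 < η) :
    ∀ᶠ m in atTop, ∃ t₀ : ℝ, ∀ t ≥ t₀, ∀ n : ℤ,
      μ {ω | ENNReal.ofReal t < ∑' j, ENNReal.ofReal |c (j + m) * Z (n - (j + m : ℕ)) ω|}
        ≤ ENNReal.ofReal (η * H t) := by
  obtain ⟨K, hK, t₀, ht₀, hb⟩ := h.regVar.exists_tail_tsum_bound (μ := μ) h.index_pos h.exp_pos
    h.exp_lt h.exp_lt_one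
  have h0 := tendsto_sum_nat_add fun j => |c j| ^ δ
  -- The uniform bound requires coefficients at most `1` with `∑ |c j| ^ δ ≤ 1`; summability
  -- provides both far enough out.
  have h1 : ∀ᶠ m in atTop, ∀ j, |c (j + m)| ≤ 1 := by
    have := h.summable.tendsto_atTop_zero.eventually_lt_const one_pos
    obtain ⟨m₀, hm₀⟩ := eventually_atTop.1 this
    filter_upwards [eventually_ge_atTop m₀] with m hm j
    by_contra! hlt
    exact (hm₀ (j + m) (by omega)).not_ge (Real.one_le_rpow hlt.le h.exp_pos.le)
  filter_upwards [h0.eventually_lt_const one_pos, h1,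
    h0.eventually_lt_const (div_pos hη hK)] with m hm1 hm2 hm3
  refine ⟨t₀, fun t ht n => ?_⟩
  have := hb (fun j => |c (j + m)|) (fun j ω => |Z (n - (j + m : ℕ)) ω|) (fun j => abs_nonneg _)
    hm2 ((summable_nat_add_iff m).2 h.summable) hm1.le (fun j => (h.meas _).abs)
    (fun j ω => abs_nonneg _) (fun j t => h.tail _ t) t ht
  simp_rw [abs_mul]
  refine this.trans (ENNReal.ofReal_le_ofReal ?_)
  rw [lt_div_iff₀' hK] at hm3
  exact mul_le_mul_of_nonneg_right hm3.le (h.regVar.pos t).le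

/-- A divergent remainder exceeds every level `t`, so divergence has probability at most `H t` for
all large `t`, and `H t → 0`. Adding finitely many terms does not affect summability. -/
lemma ae_summable (h : HeavyTailedInnovations μ Z c H α δ) (n : ℤ) :
    ∀ᵐ ω ∂μ, Summable fun j : ℕ => |c j * Z (n - j) ω| := by
  obtain ⟨m, t₀, hm⟩ := (h.eventually_remainder_le one_pos).exists
  set S : Ω → ENNReal := fun ω => ∑' j, ENNReal.ofReal |c (j + m) * Z (n - (j + m : ℕ)) ω|
  have hS : μ {ω | S ω = ⊤} = 0 := by
    have h1 : Tendsto (fun t => ENNReal.ofReal (1 * H t)) atTop (𝓝 0) := by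
      have := ENNReal.tendsto_ofReal ((h.regVar.tendsto_zero h.index_pos).const_mul 1)
      simpa using this
    refine le_antisymm (ge_of_tendsto h1 ?_) zero_le
    filter_upwards [eventually_ge_atTop t₀] with t ht
    refine (measure_mono fun ω hω => ?_).trans (hm t ht n)
    simp only [Set.mem_ofPred_eq] at hω ⊢
    change _ < S ω
    rw [hω]
    exact ENNReal.ofReal_lt_top
  have hS' : ∀ᵐ ω ∂μ, S ω ≠ ⊤ := by
    rw [ae_iff]
    simpa using hS
  filter_upwards [hS'] with ω hω
  rw [← summable_nat_add_iff m]
  refine (ENNReal.summable_toReal hω).congr fun j => ?_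
  rw [ENNReal.toReal_ofReal (abs_nonneg _)]

lemma linearProcess_measurable (h : HeavyTailedInnovations μ Z c H α δ) (n : ℤ) :
    Measurable (linearProcess c Z n) :=
  Measurable.tsum fun j => (h.meas _).const_mul (c j)

lemma measurable_truncSeries (h : HeavyTailedInnovations μ Z c H α δ) (m : ℕ) (n : ℤ) :
    Measurable (truncSeries c Z m n) :=
  Finset.measurable_fun_sum _ fun j _ => (h.meas _).const_mul (c j)

/-- The tail of the difference between the linear process and its finite part. -/
lemma eventually_absTail_sub_le (h : HeavyTailedInnovations μ Z c H α δ) {η : ℝ} (hη : 0 < η) :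
    ∀ᶠ m in atTop, ∀ᶠ t in atTop, ∀ n : ℤ,
      absTail μ (fun ω => linearProcess c Z n ω - truncSeries c Z m n ω) t ≤ η * H t := by
  filter_upwards [h.eventually_remainder_le hη] with m hm
  obtain ⟨t₀, ht₀⟩ := hm
  filter_upwards [eventually_ge_atTop t₀, eventually_ge_atTop 0] with t ht ht0 n
  have hηH : 0 ≤ η * H t := mul_nonneg hη.le (h.regVar.pos t).le
  have hsub : ∀ᵐ ω ∂μ, t < |(linearProcess c Z n ω - truncSeries c Z m n ω)| →
      ENNReal.ofReal t < ∑' j, ENNReal.ofReal |c (j + m) * Z (n - (j + m : ℕ)) ω| := by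
    filter_upwards [h.ae_summable n] with ω hω hlt
    have hs := (summable_nat_add_iff m).2 hω
    have h1 : linearProcess c Z n ω - truncSeries c Z m n ω
        = ∑' j, c (j + m) * Z (n - (j + m : ℕ)) ω := by
      have := hω.of_abs.sum_add_tsum_nat_add m
      simp only [linearProcess, truncSeries]
      linarith
    rw [h1] at hlt
    have h2 : t < ∑' j, |c (j + m) * Z (n - (j + m : ℕ)) ω| := by
      refine hlt.trans_le ?_
      have h3 := norm_tsum_le_tsum_norm (f := fun j => c (j + m) * Z (n - (j + m : ℕ)) ω) hs
      simpa only [Real.norm_eq_abs] using h3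
    have h4 := ENNReal.ofReal_tsum_of_nonneg
      (f := fun j => |c (j + m) * Z (n - (j + m : ℕ)) ω|) (fun j => abs_nonneg _) hs
    rw [← h4]
    exact (ENNReal.ofReal_lt_ofReal_iff_of_nonneg ht0).2 h2
  have h3 : μ {ω | t < |(linearProcess c Z n ω - truncSeries c Z m n ω)|} ≤
      μ {ω | ENNReal.ofReal t < ∑' j, ENNReal.ofReal |c (j + m) * Z (n - (j + m : ℕ)) ω|} := by
    apply measure_mono_ae
    filter_upwards [hsub] with ω hω using hω
  exact ENNReal.toReal_le_of_le_ofReal hηH (h3.trans (ht₀ t ht n))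

lemma tendsto_absTail_const_mul (h : HeavyTailedInnovations μ Z c H α δ) (a : ℝ) (n : ℤ) :
    Tendsto (fun t => absTail μ (fun ω => a * Z n ω) t / H t) atTop (𝓝 (|a| ^ α)) := by
  rcases eq_or_ne a 0 with rfl | ha
  · rw [abs_zero, Real.zero_rpow h.index_pos.ne']
    refine tendsto_const_nhds.congr' ?_
    filter_upwards [eventually_ge_atTop 0] with t ht
    simp [absTail, ht.not_gt]
  · have ha' : 0 < |a| := abs_pos.2 ha
    have h1 := h.regVar.tendsto_ratio |a|⁻¹ (inv_pos.2 ha')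
    rw [Real.inv_rpow ha'.le, Real.rpow_neg ha'.le, inv_inv] at h1
    refine h1.congr fun t => ?_
    rw [← h.tail n]
    congr 1
    simp only [absTail, abs_mul, inv_mul_lt_iff₀ ha']

/-- The tail of a finite part of the linear process. -/
lemma tendsto_absTail_truncSeries (h : HeavyTailedInnovations μ Z c H α δ) (m : ℕ) (n : ℤ) :
    Tendsto (fun t => absTail μ (truncSeries c Z m n) t / H t) atTop
      (𝓝 (∑ j ∈ Finset.range m, |c j| ^ α)) := by
  induction m with
  | zero =>
    refine tendsto_const_nhds.congr' ?_
    filter_upwards [eventually_ge_atTop 0] with t ht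
    simp [absTail, truncSeries, ht.not_gt]
  | succ m ih =>
    rw [Finset.sum_range_succ]
    have hind : iIndepFun (fun (j : ℕ) ω => c j * Z (n - j) ω) μ :=
      (h.indep.precomp (g := fun j : ℕ => n - j) (fun a b hab => by simpa using hab)).comp
        (fun j x => c j * x) (fun j => measurable_const_mul _)
    have h1 := hind.indepFun_finsetSum_of_notMem (fun j => (h.meas _).const_mul (c j))
      (s := Finset.range m) (i := m) (by simp)
    have h2 : (∑ j ∈ Finset.range m, fun ω => c j * Z (n - j) ω) = truncSeries c Z m n := by
      ext ω; simp [truncSeries]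
    rw [h2] at h1
    have h3 := h.regVar.absTail_add h.index_pos (h.measurable_truncSeries m n)
      ((h.meas _).const_mul (c m)) h1 ih (h.tendsto_absTail_const_mul (c m) (n - m))
    have h4 : truncSeries c Z (m + 1) n
        = fun ω => truncSeries c Z m n ω + c m * Z (n - m) ω := by
      ext ω
      exact Finset.sum_range_succ _ _
    rw [h4]
    exact h3

/-- Summability forces `|c j| ≤ 1` eventually, and then the larger exponent `α > δ` gives smaller
terms. -/
lemma summable_rpow_index (h : HeavyTailedInnovations μ Z c H α δ) :
    Summable fun j => |c j| ^ α := by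
  refine Summable.of_norm_bounded_eventually_nat h.summable ?_
  filter_upwards [h.summable.tendsto_atTop_zero.eventually_lt_const one_pos] with j hj
  have h1 : |c j| ≤ 1 := by
    by_contra! hlt
    exact hj.not_ge (Real.one_le_rpow hlt.le h.exp_pos.le)
  rw [Real.norm_of_nonneg (Real.rpow_nonneg (abs_nonneg _) _)]
  rcases (abs_nonneg (c j)).eq_or_lt with h0 | h0
  · rw [← h0, Real.zero_rpow h.index_pos.ne', Real.zero_rpow h.exp_pos.ne']
  · exact Real.rpow_le_rpow_of_exponent_ge h0 h1 h.exp_lt.le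

lemma tsum_rpow_index_pos (h : HeavyTailedInnovations μ Z c H α δ) :
    0 < ∑' j, |c j| ^ α := by
  obtain ⟨j, hj⟩ := h.exists_ne
  exact h.summable_rpow_index.tsum_pos (fun j => Real.rpow_nonneg (abs_nonneg _) _) j
    (Real.rpow_pos_of_pos (abs_pos.2 hj) _)

/-- The tail of the linear process is asymptotic to `∑ |c j| ^ α` times that of the innovations. -/
lemma linearProcess_tendsto_absTail (h : HeavyTailedInnovations μ Z c H α δ) (n : ℤ) :
    Tendsto (fun t => absTail μ (linearProcess c Z n) t / H t) atTop (𝓝 (∑' j, |c j| ^ α)) := by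
  refine h.regVar.tendsto_of_sandwich fun ε hε0 hε1 => ?_
  -- The remainder is compared at level `ε t`, where `H (ε t) ≤ (ε ^ (-α) + 1) H t` eventually. This
  -- choice of constant turns the remainder bound into `ε H t`.
  have hη : 0 < ε * (ε ^ (-α) + 1)⁻¹ := by positivity
  have h1 := h.summable_rpow_index.hasSum.tendsto_sum_nat
  obtain ⟨m, hm1, hm2⟩ := ((h.eventually_absTail_sub_le hη).and
    (h1.eventually (Metric.closedBall_mem_nhds _ hε0))).exists
  refine ⟨_, _, h.tendsto_absTail_truncSeries m n, by simpa [Real.dist_eq] using hm2, ?_⟩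
  have h2 : Tendsto (fun t : ℝ => ε * t) atTop atTop := tendsto_id.const_mul_atTop hε0
  filter_upwards [h2.eventually hm1, (h.regVar.tendsto_ratio ε hε0).eventually_lt_const
    (lt_add_one _)] with t ht1 ht2
  have hR : absTail μ (fun ω => linearProcess c Z n ω - truncSeries c Z m n ω) (ε * t)
      ≤ ε * H t := by
    refine (ht1 n).trans ?_
    rw [div_lt_iff₀ (h.regVar.pos t)] at ht2
    calc ε * (ε ^ (-α) + 1)⁻¹ * H (ε * t) ≤ ε * (ε ^ (-α) + 1)⁻¹ * ((ε ^ (-α) + 1) * H t) := by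
          gcongr
      _ = _ := by field_simp
  constructor
  · have := absTail_add_le (μ := μ) (truncSeries c Z m n)
      (fun ω => linearProcess c Z n ω - truncSeries c Z m n ω) ((1 - ε) * t) (ε * t)
    simp only [add_sub_cancel] at this
    rw [show (1 - ε) * t + ε * t = t by ring] at this
    exact this.trans (by gcongr)
  · have := absTail_add_le (μ := μ) (linearProcess c Z n)
      (fun ω => -(linearProcess c Z n ω - truncSeries c Z m n ω)) t (ε * t)
    simp only [neg_sub, add_sub_cancel] at this
    have h3 : absTail μ (fun ω => truncSeries c Z m n ω - linearProcess c Z n ω) (ε * t)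
        = absTail μ (fun ω => linearProcess c Z n ω - truncSeries c Z m n ω) (ε * t) := by
      simp only [absTail, abs_sub_comm]
    rw [h3, show t + ε * t = (1 + ε) * t by ring] at this
    linarith

lemma linearProcess_regVarTail (h : HeavyTailedInnovations μ Z c H α δ) (n : ℤ) :
    RegVarTail (absTail μ (linearProcess c Z n)) α :=
  h.regVar.of_tendsto_div (absTail_antitone _) h.tsum_rpow_index_pos
    (h.linearProcess_tendsto_absTail n)

end HeavyTailedInnovations

end

/-! ### Quantiles and scale functions -/

section Quantile

variable {Ω : Type*} [MeasurableSpace Ω] {μ : Measure Ω} [IsProbabilityMeasure μ] {X : Ω → ℝ}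
  {α : ℝ}

lemma RegVarTail.tendsto_div {H : ℝ → ℝ} (hH : RegVarTail H α) {v w : ℝ} (hv : 0 < v) (hw : 0 < w) :
    Tendsto (fun t => H (v * t) / H (w * t)) atTop (𝓝 (v ^ (-α) / w ^ (-α))) := by
  refine ((hH.tendsto_ratio v hv).div (hH.tendsto_ratio w hw)
    (Real.rpow_pos_of_pos hw _).ne').congr fun t => ?_
  exact div_div_div_cancel_right₀ (hH.pos t).ne' _ _

lemma absCDF_eq (hX : Measurable X) (y : ℝ) : absCDF μ X y = 1 - absTail μ X y := by
  have h := probReal_compl_eq_one_sub (μ := μ) (measurableSet_absTail hX y)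
  rw [absTail, ← h, absCDF]
  congr 1
  ext ω
  simp

lemma absQuantile_eq (hX : Measurable X) (t : ℝ) :
    absQuantile μ X t = sInf {y | absTail μ X y ≤ 1 / t} := by
  simp only [absQuantile, absCDF_eq hX, sub_le_sub_iff_left]

lemma absTail_le_of_absQuantile_lt (hX : Measurable X) (hT : RegVarTail (absTail μ X) α)
    (hα : 0 < α) {t y : ℝ} (ht : 0 < t) (hy : absQuantile μ X t < y) :
    absTail μ X y ≤ 1 / t := by
  rw [absQuantile_eq hX] at hy
  have hne : {y | absTail μ X y ≤ 1 / t}.Nonempty :=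
    (((hT.tendsto_zero hα).eventually_lt_const (one_div_pos.2 ht)).exists).imp fun _ h => h.le
  obtain ⟨z, hz, hzy⟩ := exists_lt_of_csInf_lt hne hy
  exact (absTail_antitone _ hzy.le).trans hz

/-- For `y < 0` the tail equals `1 > 1 / t`. Without `1 < t` the set could be all of `ℝ`, and its
`sInf` would be a default value. -/
lemma bddBelow_absTail_le {t : ℝ} (ht : 1 < t) : BddBelow {y | absTail μ X y ≤ 1 / t} := by
  refine ⟨0, fun y hy => ?_⟩
  by_contra! h
  have h1 : absTail μ X y = 1 := by
    rw [absTail, show {ω | y < |X ω|} = Set.univ from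
      Set.eq_univ_of_forall fun ω => h.trans_le (abs_nonneg _)]
    simp
  simp only [Set.mem_ofPred_eq, h1] at hy
  rw [le_div_iff₀ (by linarith)] at hy
  linarith

lemma lt_absTail_of_lt_absQuantile (hX : Measurable X) {t y : ℝ} (ht : 1 < t)
    (hy : y < absQuantile μ X t) : 1 / t < absTail μ X y := by
  rw [absQuantile_eq hX] at hy
  by_contra! h
  exact (csInf_le (bddBelow_absTail_le ht) h).not_gt hy

lemma tendsto_absQuantile (hX : Measurable X) (hT : RegVarTail (absTail μ X) α) (hα : 0 < α) :
    Tendsto (absQuantile μ X) atTop atTop := by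
  refine tendsto_atTop.2 fun M => ?_
  filter_upwards [eventually_gt_atTop (1 / absTail μ X (M + 1)), eventually_gt_atTop 0] with t h1 h2
  by_contra! h
  have h3 := absTail_le_of_absQuantile_lt hX hT hα h2 (h.trans (lt_add_one M))
  rw [div_lt_iff₀ (hT.pos _)] at h1
  rw [le_div_iff₀ h2] at h3
  linarith

/-- The tail may jump at the quantile, so it need not equal `1 / t` there. But `1 / t` lies between
its values at `w` times the quantile for `w < 1` and for `w > 1`, and regular variation lets `w →
1`. -/
lemma tendsto_mul_absTail_absQuantile (hX : Measurable X) (hT : RegVarTail (absTail μ X) α)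
    (hα : 0 < α) {v : ℝ} (hv : 0 < v) :
    Tendsto (fun t => t * absTail μ X (v * absQuantile μ X t)) atTop (𝓝 (v ^ (-α))) := by
  have hq := tendsto_absQuantile hX hT hα
  have hc : ContinuousAt (fun w : ℝ => v ^ (-α) / w ^ (-α)) 1 :=
    continuousAt_const.div (continuousAt_id.rpow_const (Or.inl one_ne_zero)) (by simp)
  have hc1 : v ^ (-α) / (1 : ℝ) ^ (-α) = v ^ (-α) := by simp
  refine tendsto_order.2 ⟨fun a ha => ?_, fun a ha => ?_⟩
  · have h1 : ∀ᶠ w in 𝓝[<] (1 : ℝ), a < v ^ (-α) / w ^ (-α) :=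
      (hc.tendsto.mono_left nhdsWithin_le_nhds).eventually_const_lt (by rwa [hc1])
    obtain ⟨w, hw, hw0, hw1⟩ := (h1.and (Ioo_mem_nhdsLT (zero_lt_one' ℝ))).exists
    filter_upwards [((hT.tendsto_div hv hw0).comp hq).eventually_const_lt hw,
      eventually_gt_atTop 1, hq.eventually_gt_atTop 0] with t h2 h3 h4
    have h5 := lt_absTail_of_lt_absQuantile (μ := μ) hX h3
      (show w * absQuantile μ X t < absQuantile μ X t by nlinarith)
    refine lt_of_lt_of_le h2 ?_
    simp only [Function.comp]
    rw [div_le_iff₀ (hT.pos _)]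
    rw [div_lt_iff₀ (by linarith)] at h5
    nlinarith [hT.pos (v * absQuantile μ X t)]
  · have h1 : ∀ᶠ w in 𝓝[>] (1 : ℝ), v ^ (-α) / w ^ (-α) < a :=
      (hc.tendsto.mono_left nhdsWithin_le_nhds).eventually_lt_const (by rwa [hc1])
    obtain ⟨w, hw, hw1⟩ := (h1.and (eventually_mem_nhdsWithin)).exists
    replace hw1 : 1 < w := hw1
    have hw0 : 0 < w := by linarith
    filter_upwards [((hT.tendsto_div hv hw0).comp hq).eventually_lt_const hw,
      eventually_gt_atTop 0, hq.eventually_gt_atTop 0] with t h2 h3 h4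
    have h5 := absTail_le_of_absQuantile_lt hX hT hα h3
      (show absQuantile μ X t < w * absQuantile μ X t by nlinarith)
    refine lt_of_le_of_lt ?_ h2
    simp only [Function.comp]
    rw [le_div_iff₀ (hT.pos _)]
    rw [le_div_iff₀ h3] at h5
    nlinarith [hT.pos (v * absQuantile μ X t)]

/-- A scale function for the excesses is asymptotically linear. -/
lemma IsGPDScale.tendsto_div {γ : ℝ} (hγ : 0 < γ) {σstar : ℝ → ℝ} (hσ : IsGPDScale μ γ X σstar)
    (hX : Measurable X) (hT : RegVarTail (absTail μ X) (1 / γ)) :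
    Tendsto (fun t => σstar t / t) atTop (𝓝 γ) := by
  obtain ⟨hpos, hunif⟩ := hσ
  -- Of the uniform convergence only the point `x = t` is used. There the conditional tail is `P(|X|
  -- > 2t) / P(|X| > t) → 2 ^ (-1/γ)`, so `(1 + γ t / σstar t) ^ (-1/γ)` has the same limit, and
  -- inverting the power gives `γ t / σstar t → 1`.
  have hex : ∀ t, 0 < t → excessCDF μ X t t = 1 - absTail μ X (2 * t) / absTail μ X t := by
    intro t ht
    have hms := measurableSet_absTail hX t
    have h1 : {ω | t < |X ω|} ∩ {ω | |X ω| - t ≤ t} = {ω | t < |X ω|} \ {ω | 2 * t < |X ω|} := by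
      ext ω
      simp only [Set.mem_inter_iff, Set.mem_ofPred_eq, Set.mem_sdiff, not_lt]
      constructor <;> rintro ⟨h1, h2⟩ <;> exact ⟨h1, by linarith⟩
    have h2 : {ω | 2 * t < |X ω|} ⊆ {ω | t < |X ω|} := fun ω hω => by
      simp only [Set.mem_ofPred_eq] at hω ⊢; linarith
    rw [excessCDF, measureReal_def, cond_apply hms, ENNReal.toReal_mul, ENNReal.toReal_inv,
      ← measureReal_def, ← measureReal_def, h1, measureReal_sdiff h2 (measurableSet_absTail hX _)]
    have := (hT.pos t).ne'
    simp only [absTail] at this ⊢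
    field_simp
  have h0 : Tendsto (fun t => excessCDF μ X t t - gpdCDF γ (σstar t) t) atTop (𝓝 0) := by
    rw [Metric.tendsto_nhds]
    intro ε hε
    filter_upwards [Metric.tendstoUniformlyOn_iff.1 hunif ε hε, eventually_gt_atTop 0] with t h1 h2
    rw [dist_comm]
    exact h1 t h2
  have h1 : Tendsto (fun t => (1 + γ / σstar t * t) ^ (-1 / γ)) atTop (𝓝 (2 ^ (-(1 / γ)))) := by
    have := h0.add (hT.tendsto_ratio 2 two_pos)
    rw [zero_add] at this
    refine this.congr' ?_
    filter_upwards [eventually_gt_atTop 0] with t ht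
    rw [hex t ht, gpdCDF]
    ring
  have h2 : Tendsto (fun t => ((1 + γ / σstar t * t) ^ (-1 / γ)) ^ (-γ)) atTop (𝓝 2) := by
    have := h1.rpow_const (p := -γ) (Or.inl (by positivity))
    rwa [← Real.rpow_mul two_pos.le, show -(1 / γ) * -γ = 1 by field_simp, Real.rpow_one] at this
  have h3 : Tendsto (fun t => γ / (((1 + γ / σstar t * t) ^ (-1 / γ)) ^ (-γ) - 1)) atTop (𝓝 γ) := by
    have := (tendsto_const_nhds (x := γ)).div (h2.sub_const 1) (by norm_num)
    rwa [show γ / (2 - 1) = γ by norm_num] at this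
  refine h3.congr' ?_
  filter_upwards [eventually_gt_atTop 0] with t ht
  have hs := hpos t ht
  rw [← Real.rpow_mul (by positivity), show -1 / γ * -γ = 1 by field_simp, Real.rpow_one,
    add_sub_cancel_left]
  field_simp

end Quantile

/-! ### Functionals of the tail -/

/-- A nonnegative density that vanishes on `(-∞, s]` and is at most `C / v` at `v > s`. -/
structure IsTailKernel (g : ℝ → ℝ) (s C : ℝ) : Prop where
  meas : Measurable g
  nonneg : ∀ v, 0 ≤ g v
  start_pos : 0 < s
  zero : ∀ v ≤ s, g v = 0
  le : ∀ v, s < v → g v ≤ C / v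

/-- The primitive of `g` that vanishes at `0`. -/
noncomputable def prim (g : ℝ → ℝ) (x : ℝ) : ℝ := ∫ v in (0 : ℝ)..x, g v

namespace IsTailKernel

variable {g : ℝ → ℝ} {s C : ℝ}

lemma const_nonneg (hg : IsTailKernel g s C) : 0 ≤ C := by
  have h := (hg.nonneg (s + 1)).trans (hg.le (s + 1) (lt_add_one s))
  have : 0 < s + 1 := by linarith [hg.start_pos]
  rwa [le_div_iff₀ this, zero_mul] at h

lemma le_const (hg : IsTailKernel g s C) (v : ℝ) : g v ≤ C / s := by
  rcases le_or_gt v s with h | h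
  · rw [hg.zero v h]
    exact div_nonneg hg.const_nonneg hg.start_pos.le
  · exact (hg.le v h).trans (div_le_div_of_nonneg_left hg.const_nonneg hg.start_pos h.le)

lemma intervalIntegrable (hg : IsTailKernel g s C) (x y : ℝ) :
    IntervalIntegrable g volume x y := by
  refine (intervalIntegrable_const (c := C / s)).mono_fun' hg.meas.aestronglyMeasurable ?_
  exact ae_of_all _ fun v => (Real.norm_of_nonneg (hg.nonneg v)).trans_le (hg.le_const v)

lemma prim_sub (hg : IsTailKernel g s C) (x y : ℝ) : prim g y - prim g x = ∫ v in x..y, g v :=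
  intervalIntegral.integral_interval_sub_left (hg.intervalIntegrable _ _)
    (hg.intervalIntegrable _ _)

lemma prim_mono (hg : IsTailKernel g s C) : Monotone (prim g) := fun x y hxy => by
  rw [← sub_nonneg, hg.prim_sub]
  exact intervalIntegral.integral_nonneg hxy fun v _ => hg.nonneg v

lemma prim_of_le (hg : IsTailKernel g s C) {x : ℝ} (hx : x ≤ s) : prim g x = 0 := by
  rw [prim, intervalIntegral.integral_congr (g := fun _ => 0), intervalIntegral.integral_zero]
  intro v hv
  exact hg.zero v (hv.2.trans (max_le hg.start_pos.le hx))

lemma prim_nonneg (hg : IsTailKernel g s C) (x : ℝ) : 0 ≤ prim g x := by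
  rcases le_total x s with h | h
  · rw [hg.prim_of_le h]
  · rw [← hg.prim_of_le le_rfl]; exact hg.prim_mono h

lemma abs_prim_sub_le (hg : IsTailKernel g s C) (x y : ℝ) :
    |prim g y - prim g x| ≤ C / s * |y - x| := by
  rw [hg.prim_sub]
  exact intervalIntegral.norm_integral_le_of_norm_le_const fun v _ => by
    rw [Real.norm_of_nonneg (hg.nonneg v)]; exact hg.le_const v

lemma continuous_prim (hg : IsTailKernel g s C) : Continuous (prim g) := by
  refine (LipschitzWith.of_dist_le_mul (K := (C / s).toNNReal) fun x y => ?_).continuous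
  rw [Real.dist_eq, Real.dist_eq,
    Real.coe_toNNReal _ (div_nonneg hg.const_nonneg hg.start_pos.le)]
  exact hg.abs_prim_sub_le y x

lemma prim_le (hg : IsTailKernel g s C) {x : ℝ} (hx : 0 ≤ x) : prim g x ≤ C / s * x := by
  have h := hg.abs_prim_sub_le 0 x
  rw [hg.prim_of_le hg.start_pos.le, sub_zero, sub_zero, abs_of_nonneg hx] at h
  exact (le_abs_self _).trans h

/-- Cutting the density rather than the variable keeps both pieces in the class: one has a bounded
primitive, the other a small normalized mean when `M` is large. -/
lemma truncate (hg : IsTailKernel g s C) (M : ℝ) :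
    IsTailKernel ((Set.Iic M).indicator g) s C where
  meas := hg.meas.indicator measurableSet_Iic
  nonneg := fun v => Set.indicator_nonneg (fun v _ => hg.nonneg v) v
  start_pos := hg.start_pos
  zero := fun v hv => by simp only [Set.indicator]; split_ifs; exacts [hg.zero v hv, rfl]
  le := fun v hv => by
    simp only [Set.indicator]; split_ifs
    · exact hg.le v hv
    · exact div_nonneg hg.const_nonneg (hg.start_pos.trans hv).le

lemma truncate_compl (hg : IsTailKernel g s C) (M : ℝ) :
    IsTailKernel ((Set.Ioi M).indicator g) s C where
  meas := hg.meas.indicator measurableSet_Ioi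
  nonneg := fun v => Set.indicator_nonneg (fun v _ => hg.nonneg v) v
  start_pos := hg.start_pos
  zero := fun v hv => by simp only [Set.indicator]; split_ifs; exacts [hg.zero v hv, rfl]
  le := fun v hv => by
    simp only [Set.indicator]; split_ifs
    · exact hg.le v hv
    · exact div_nonneg hg.const_nonneg (hg.start_pos.trans hv).le

lemma prim_truncate_add (hg : IsTailKernel g s C) (M x : ℝ) :
    prim ((Set.Iic M).indicator g) x + prim ((Set.Ioi M).indicator g) x = prim g x := by
  rw [prim, prim, ← intervalIntegral.integral_add ((hg.truncate M).intervalIntegrable _ _)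
    ((hg.truncate_compl M).intervalIntegrable _ _)]
  congr 1
  ext v
  rw [← Set.compl_Iic, Set.indicator_self_add_compl_apply]

lemma prim_truncate_le (hg : IsTailKernel g s C) {M : ℝ} (hM : 0 ≤ M) (x : ℝ) :
    prim ((Set.Iic M).indicator g) x ≤ C / s * M := by
  refine le_trans ?_ ((hg.truncate M).prim_le hM)
  rcases le_total x M with h | h
  · exact (hg.truncate M).prim_mono h
  · rw [← sub_nonpos, (hg.truncate M).prim_sub,
      intervalIntegral.integral_congr_uIoo (g := fun _ => 0), intervalIntegral.integral_zero]
    intro v hv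
    rw [Set.uIoo_of_le h] at hv
    exact Set.indicator_of_notMem (by simpa using hv.1) _

section Moments

variable {Ω : Type*} [MeasurableSpace Ω] {μ : Measure Ω} [IsProbabilityMeasure μ]

/-- The layer cake formula. -/
lemma integrable_prim_and_integral_eq (hg : IsTailKernel g s C) {V : Ω → ℝ} (hV : Measurable V)
    (hV0 : ∀ ω, 0 ≤ V ω)
    (hint : IntegrableOn (fun v => g v * μ.real {ω | v < V ω}) (Set.Ioi s)) :
    Integrable (fun ω => prim g (V ω)) μ ∧
      ∫ ω, prim g (V ω) ∂μ = ∫ v in Set.Ioi s, g v * μ.real {ω | v < V ω} := by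
  have hnn : ∀ v, 0 ≤ g v * μ.real {ω | v < V ω} := fun v =>
    mul_nonneg (hg.nonneg v) measureReal_nonneg
  have h1 := lintegral_comp_eq_lintegral_meas_lt_mul μ (f := V) (g := g) (ae_of_all _ hV0)
    hV.aemeasurable (fun t _ => hg.intervalIntegrable 0 t) (ae_of_all _ hg.nonneg)
  have h2 : ∫⁻ v in Set.Ioi 0, μ {ω | v < V ω} * ENNReal.ofReal (g v)
      = ENNReal.ofReal (∫ v in Set.Ioi s, g v * μ.real {ω | v < V ω}) := by
    rw [ofReal_integral_eq_lintegral_ofReal hint (ae_of_all _ hnn),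
      ← lintegral_indicator measurableSet_Ioi, ← lintegral_indicator measurableSet_Ioi]
    congr 1
    ext v
    simp only [Set.indicator, Set.mem_Ioi]
    have hs := hg.start_pos
    split_ifs with h3 h4 h4
    · rw [ENNReal.ofReal_mul (hg.nonneg v), ofReal_measureReal, mul_comm]
    · simp [hg.zero v (not_lt.1 h4)]
    · exact absurd (hs.trans h4) h3
    · rfl
  rw [h2] at h1
  have hm : AEStronglyMeasurable (fun ω => prim g (V ω)) μ :=
    (hg.continuous_prim.measurable.comp hV).aestronglyMeasurable
  have hnn' : 0 ≤ᵐ[μ] fun ω => prim g (V ω) := ae_of_all _ fun ω => hg.prim_nonneg _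
  have hI : Integrable (fun ω => prim g (V ω)) μ := by
    rw [← lintegral_ofReal_ne_top_iff_integrable hm hnn']
    exact h1 ▸ ENNReal.ofReal_ne_top
  refine ⟨hI, ?_⟩
  rw [integral_eq_lintegral_of_nonneg_ae hnn' hm]
  change (∫⁻ ω, ENNReal.ofReal (∫ t in (0 : ℝ)..V ω, g t) ∂μ).toReal = _
  rw [h1, ENNReal.toReal_ofReal (setIntegral_nonneg measurableSet_Ioi fun v _ => hnn v)]

lemma integrableOn_rpow (hg : IsTailKernel g s C) {β : ℝ} (hβ : 0 < β) :
    IntegrableOn (fun v => g v * v ^ (-β)) (Set.Ioi s) := by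
  refine Integrable.mono' ((integrableOn_Ioi_rpow_of_lt (a := -1 - β) (by linarith)
    hg.start_pos).const_mul C) ?_ ?_
  · exact (hg.meas.mul (measurable_id.pow_const _)).aestronglyMeasurable
  · filter_upwards [ae_restrict_mem measurableSet_Ioi] with v hv
    have hv0 : 0 < v := hg.start_pos.trans hv
    have h1 : 0 < v ^ (-β) := Real.rpow_pos_of_pos hv0 _
    rw [Real.norm_of_nonneg (mul_nonneg (hg.nonneg v) h1.le)]
    calc g v * v ^ (-β) ≤ C / v * v ^ (-β) := by gcongr; exact hg.le v hv
      _ = C * v ^ (-1 - β) := by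
        rw [sub_eq_add_neg, Real.rpow_add hv0, Real.rpow_neg_one]; ring

/-- Convergence of normalized moments of a random variable with regularly varying tail. -/
lemma tendsto_mul_integral_prim (hg : IsTailKernel g s C) {X : Ω → ℝ} {α : ℝ} (hX : Measurable X)
    (hT : RegVarTail (absTail μ X) α) (hα : 0 < α) {a b : ℕ → ℝ} (ha : ∀ᶠ n in atTop, 0 ≤ a n)
    (hb : Tendsto b atTop atTop)
    (hab : ∀ v, 0 < v → Tendsto (fun n => a n * absTail μ X (v * b n)) atTop (𝓝 (v ^ (-α)))) :
    (∀ᶠ n in atTop, Integrable (fun ω => prim g (|X ω| / b n)) μ) ∧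
      Tendsto (fun n => a n * ∫ ω, prim g (|X ω| / b n) ∂μ) atTop
        (𝓝 (∫ v in Set.Ioi s, g v * v ^ (-α))) := by
  have hs := hg.start_pos
  -- Any exponent in `(0, α)` serves. Together with `g v ≤ C / v` the Potter bound gives an
  -- integrable majorant on `(s, ∞)`, both for the layer cake formula and for dominated convergence.
  obtain ⟨t₀, ht₀, hpot⟩ := hT.potter (β := α / 2) (by positivity) (by linarith)
  have hbs : ∀ᶠ n in atTop, t₀ ≤ s * b n := (hb.const_mul_atTop hs).eventually_ge_atTop t₀
  have hpot' : ∀ n, t₀ ≤ s * b n → ∀ v, s < v →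
      absTail μ X (v * b n) ≤ 2 ^ (α / 2) * s ^ (α / 2) * v ^ (-(α / 2)) * absTail μ X (s * b n) := by
    intro n hn v hv
    have h1 := hpot _ hn (v / s) ((one_le_div hs).2 hv.le)
    rw [Real.div_rpow (hs.trans hv).le hs.le, Real.rpow_neg hs.le, div_inv_eq_mul] at h1
    rw [show v / s * (s * b n) = v * b n by field_simp] at h1
    linarith
  have htail : ∀ n, 0 < b n → ∀ v, μ.real {ω | v < |X ω| / b n} = absTail μ X (v * b n) := by
    intro n hn v
    simp only [absTail, lt_div_iff₀ hn]
  have hmeasT : ∀ n, Measurable fun v => absTail μ X (v * b n) := fun n =>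
    (absTail_antitone (μ := μ) X).measurable.comp (measurable_id.mul_const (b n))
  have hkint := (hg.integrableOn_rpow (half_pos hα)).const_mul (2 ^ (α / 2) * s ^ (α / 2))
  have hmain : ∀ᶠ n in atTop, Integrable (fun ω => prim g (|X ω| / b n)) μ ∧
      ∫ ω, prim g (|X ω| / b n) ∂μ = ∫ v in Set.Ioi s, g v * absTail μ X (v * b n) := by
    filter_upwards [hbs, hb.eventually_gt_atTop 0] with n h1 h2
    have h3 := hg.integrable_prim_and_integral_eq (μ := μ) (V := fun ω => |X ω| / b n)
      (hX.abs.div_const _) (fun ω => by positivity)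
    simp_rw [htail n h2] at h3
    refine h3 (Integrable.mono' (hkint.mul_const (absTail μ X (s * b n))) ?_ ?_)
    · exact (hg.meas.mul (hmeasT n)).aestronglyMeasurable
    · filter_upwards [ae_restrict_mem measurableSet_Ioi] with v hv
      rw [Real.norm_of_nonneg (mul_nonneg (hg.nonneg v) (absTail_nonneg _ _))]
      calc g v * absTail μ X (v * b n) ≤ g v * (2 ^ (α / 2) * s ^ (α / 2) * v ^ (-(α / 2)) *
            absTail μ X (s * b n)) := by
            gcongr
            · exact hg.nonneg v
            · exact hpot' n h1 v hv
        _ = _ := by ring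
  refine ⟨hmain.mono fun n h => h.1, ?_⟩
  have hlim : Tendsto (fun n => ∫ v in Set.Ioi s, g v * (a n * absTail μ X (v * b n))) atTop
      (𝓝 (∫ v in Set.Ioi s, g v * v ^ (-α))) := by
    refine tendsto_integral_filter_of_dominated_convergence
      (fun v => 2 ^ (α / 2) * s ^ (α / 2) * (g v * v ^ (-(α / 2))) * (s ^ (-α) + 1)) ?_ ?_
      (hkint.mul_const _) ?_
    · exact Eventually.of_forall fun n =>
        (hg.meas.mul ((hmeasT n).const_mul (a n))).aestronglyMeasurable
    · filter_upwards [hbs, ha, (hab s hs).eventually_lt_const (lt_add_one _)] with n h1 h2 h3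
      filter_upwards [ae_restrict_mem measurableSet_Ioi] with v hv
      have h4 : 0 ≤ absTail μ X (v * b n) := absTail_nonneg _ _
      have h5 : 0 < v ^ (-(α / 2)) := Real.rpow_pos_of_pos (hs.trans hv) _
      rw [Real.norm_of_nonneg (mul_nonneg (hg.nonneg v) (mul_nonneg h2 h4))]
      have h6 := hg.nonneg v
      calc g v * (a n * absTail μ X (v * b n))
          ≤ g v * (a n * (2 ^ (α / 2) * s ^ (α / 2) * v ^ (-(α / 2)) * absTail μ X (s * b n))) := by
            gcongr
            exact hpot' n h1 v hv
        _ = 2 ^ (α / 2) * s ^ (α / 2) * (g v * v ^ (-(α / 2))) * (a n * absTail μ X (s * b n)) := by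
            ring
        _ ≤ _ := by gcongr
    · filter_upwards [ae_restrict_mem measurableSet_Ioi] with v hv
      exact (hab v (hs.trans hv)).const_mul (g v)
  refine hlim.congr' ?_
  filter_upwards [hmain] with n hn
  rw [hn.2, ← integral_const_mul]
  congr 1
  ext v
  ring

end Moments

end IsTailKernel

/-! ### Convergence in probability as convergence along a filter -/

section ProbFilter

variable {Ω : Type*} [MeasurableSpace Ω] {μ : Measure Ω}

/-- The filter on `ℕ × Ω` of the sets whose sections have outer probability tending to one.
Convergence in probability of `f n` to a constant is convergence of `(n, ω) ↦ f n ω` along it. -/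
def probFilter (μ : Measure Ω) : Filter (ℕ × Ω) where
  sets := {S | Tendsto (fun n => μ {ω | (n, ω) ∉ S}) atTop (𝓝 0)}
  univ_sets := by simp
  sets_of_superset := fun {S T} hS hST => tendsto_of_tendsto_of_tendsto_of_le_of_le
    tendsto_const_nhds hS (fun _ => zero_le) fun n => measure_mono fun ω hω h => hω (hST h)
  inter_sets := fun {S T} hS hT => by
    have h : Tendsto (fun n => μ {ω | (n, ω) ∉ S} + μ {ω | (n, ω) ∉ T}) atTop (𝓝 0) := by
      simpa using Tendsto.add hS hT
    refine tendsto_of_tendsto_of_tendsto_of_le_of_le tendsto_const_nhds h (fun _ => zero_le)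
      fun n => (measure_mono fun ω hω => ?_).trans (measure_union_le _ _)
    simp only [Set.mem_ofPred_eq, Set.mem_inter_iff, Set.mem_union] at hω ⊢
    tauto

lemma eventually_probFilter {p : ℕ × Ω → Prop} :
    (∀ᶠ q in probFilter μ, p q) ↔ Tendsto (fun n => μ {ω | ¬ p (n, ω)}) atTop (𝓝 0) := Iff.rfl

/-- This transports facts that hold for all large `n`, without randomness, to the filter on pairs,
so that they can be combined with convergence in probability. -/
lemma tendsto_fst_probFilter : Tendsto Prod.fst (probFilter μ) atTop := by
  intro S hS
  obtain ⟨N, hN⟩ := mem_atTop_sets.1 hS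
  change ∀ᶠ q in probFilter μ, q.1 ∈ S
  rw [eventually_probFilter]
  refine tendsto_const_nhds.congr' ?_
  filter_upwards [eventually_ge_atTop N] with n hn
  simp [hN n hn]

lemma tendstoInMeasure_of_tendsto_probFilter {E : Type*} [PseudoEMetricSpace E] {f : ℕ → Ω → E}
    {x : E} (h : Tendsto (fun q : ℕ × Ω => f q.1 q.2) (probFilter μ) (𝓝 x)) :
    TendstoInMeasure μ f atTop fun _ => x := by
  intro ε hε
  have h1 := eventually_probFilter.1 (h.eventually (Metric.eball_mem_nhds x hε))
  simpa using h1

/-- Convergence in mean implies convergence in probability. -/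
lemma tendsto_probFilter_of_integral_abs [IsProbabilityMeasure μ] {f : ℕ → Ω → ℝ} {x : ℝ}
    (hint : ∀ᶠ n in atTop, Integrable (f n) μ)
    (h : Tendsto (fun n => ∫ ω, |f n ω - x| ∂μ) atTop (𝓝 0)) :
    Tendsto (fun q : ℕ × Ω => f q.1 q.2) (probFilter μ) (𝓝 x) := by
  rw [Metric.tendsto_nhds]
  intro ε hε
  rw [eventually_probFilter]
  have h1 : Tendsto (fun n => ENNReal.ofReal (ε⁻¹ * ∫ ω, |f n ω - x| ∂μ)) atTop (𝓝 0) := by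
    simpa using ENNReal.tendsto_ofReal (h.const_mul ε⁻¹)
  refine tendsto_of_tendsto_of_tendsto_of_le_of_le' tendsto_const_nhds h1
    (Eventually.of_forall fun _ => zero_le) ?_
  filter_upwards [hint] with n hn
  have h2 := mul_meas_ge_le_integral_of_nonneg (μ := μ) (f := fun ω => |f n ω - x|)
    (ae_of_all _ fun ω => abs_nonneg _) (hn.sub (integrable_const x)).abs ε
  rw [← ofReal_measureReal]
  apply ENNReal.ofReal_le_ofReal
  rw [le_inv_mul_iff₀ hε]
  simpa [Real.dist_eq] using h2

end ProbFilter

/-! ### A law of large numbers for tail functionals of a linear process -/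

section Variance

variable {Ω : Type*} [MeasurableSpace Ω] {μ : Measure Ω} [IsProbabilityMeasure μ]

/-- A variance bound for sums of bounded nonnegative `m`-dependent variables. -/
lemma variance_sum_le_of_dependent {Y : ℕ → Ω → ℝ} {B e : ℝ} {m : ℕ} (hY : ∀ i, Measurable (Y i))
    (hY0 : ∀ i ω, 0 ≤ Y i ω) (hYB : ∀ i ω, Y i ω ≤ B) (hB : 0 ≤ B) (hYe : ∀ i, ∫ ω, Y i ω ∂μ ≤ e)
    (hind : ∀ i j, i + m ≤ j → IndepFun (Y i) (Y j) μ) (n : ℕ) :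
    Var[∑ i ∈ Finset.range n, Y i; μ] ≤ n * ((2 * m + 1) * (B * e)) := by
  have hL : ∀ i, MemLp (Y i) 2 μ := fun i =>
    MemLp.of_bound (hY i).aestronglyMeasurable B (ae_of_all _ fun ω => by
      rw [Real.norm_of_nonneg (hY0 i ω)]; exact hYB i ω)
  have hI : ∀ i, Integrable (Y i) μ := fun i => (hL i).integrable one_le_two
  have he : 0 ≤ e := (integral_nonneg (hY0 0)).trans (hYe 0)
  -- Only lags up to `m` can contribute. There the covariance is at most `E[Y_i Y_j] ≤ B e`, by
  -- boundedness and nonnegativity, so each row has at most `2 m + 1` such terms.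
  have hcov : ∀ i j, cov[Y i, Y j; μ] ≤ if j ∈ Finset.Icc (i - m) (i + m) then B * e else 0 := by
    intro i j
    split_ifs with h
    · rw [covariance_eq_sub (hL i) (hL j)]
      have h1 : ∫ ω, (Y i * Y j) ω ∂μ ≤ B * e := by
        calc ∫ ω, (Y i * Y j) ω ∂μ ≤ ∫ ω, B * Y j ω ∂μ := by
              refine integral_mono ((hL i).integrable_mul (hL j)) ((hI j).const_mul B) fun ω => ?_
              exact mul_le_mul_of_nonneg_right (hYB i ω) (hY0 j ω)
          _ = B * ∫ ω, Y j ω ∂μ := integral_const_mul _ _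
          _ ≤ B * e := by gcongr; exact hYe j
      have h2 : 0 ≤ (∫ ω, Y i ω ∂μ) * ∫ ω, Y j ω ∂μ :=
        mul_nonneg (integral_nonneg (hY0 i)) (integral_nonneg (hY0 j))
      linarith
    · rw [Finset.mem_Icc] at h
      refine le_of_eq ?_
      by_cases hij : i + m ≤ j
      · exact (hind i j hij).covariance_eq_zero (hL i) (hL j)
      · exact (hind j i (by omega)).symm.covariance_eq_zero (hL i) (hL j)
  rw [variance_sum' fun i _ => hL i]
  calc ∑ i ∈ Finset.range n, ∑ j ∈ Finset.range n, cov[Y i, Y j; μ]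
      ≤ ∑ i ∈ Finset.range n, (2 * m + 1) * (B * e) := by
        refine Finset.sum_le_sum fun i _ => ?_
        refine (Finset.sum_le_sum fun j _ => hcov i j).trans ?_
        rw [← Finset.sum_filter, Finset.sum_const, nsmul_eq_mul]
        gcongr
        have h1 : (Finset.filter (fun j => j ∈ Finset.Icc (i - m) (i + m)) (Finset.range n)).card
            ≤ (Finset.Icc (i - m) (i + m)).card :=
          Finset.card_le_card fun j hj => (Finset.mem_filter.1 hj).2
        rw [Nat.card_Icc] at h1
        have h2 : (Finset.filter (fun j => j ∈ Finset.Icc (i - m) (i + m)) (Finset.range n)).card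
            ≤ 2 * m + 1 := by omega
        exact_mod_cast h2
    _ = _ := by rw [Finset.sum_const, Finset.card_range, nsmul_eq_mul]

/-- Pointwise `|x| ≤ η + x² / η`, which is integrated. -/
lemma integral_abs_sub_integral_le {f : Ω → ℝ} (hf : MemLp f 2 μ) {η : ℝ} (hη : 0 < η) :
    ∫ ω, |f ω - ∫ ω', f ω' ∂μ| ∂μ ≤ η + Var[f; μ] / η := by
  set e := ∫ ω', f ω' ∂μ
  have hI : Integrable (fun ω => f ω - e) μ := (hf.integrable one_le_two).sub (integrable_const e)
  have hI2 : Integrable (fun ω => (f ω - e) ^ 2) μ := (hf.sub (memLp_const e)).integrable_sq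
  calc ∫ ω, |f ω - e| ∂μ ≤ ∫ ω, (η + (f ω - e) ^ 2 / η) ∂μ := by
        refine integral_mono hI.abs ((integrable_const η).add (hI2.div_const η)) fun ω => ?_
        have h1 : 0 ≤ (f ω - e) ^ 2 / η := by positivity
        change |f ω - e| ≤ η + (f ω - e) ^ 2 / η
        rcases le_total |f ω - e| η with h | h
        · linarith
        · have : |f ω - e| ≤ (f ω - e) ^ 2 / η := by
            rw [le_div_iff₀ hη, ← sq_abs]; nlinarith [abs_nonneg (f ω - e)]
          linarith
    _ = _ := by
        rw [integral_add (integrable_const η) (hI2.div_const η), integral_div,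
          variance_eq_integral hf.1.aemeasurable]
        simp [e]

end Variance

/-! ### Approximation by finite moving averages and convergence of tail sums -/

namespace HeavyTailedInnovations

variable {Ω : Type*} [MeasurableSpace Ω] {μ : Measure Ω} [IsProbabilityMeasure μ]
  {Z : ℤ → Ω → ℝ} {c : ℕ → ℝ} {H : ℝ → ℝ} {α δ : ℝ}

/-- The law of the whole past is the same infinite product measure at every time, so every
measurable functional of the past is stationary, including `tsum`. -/
lemma identDistrib_past (h : HeavyTailedInnovations μ Z c H α δ) (n : ℤ) :
    IdentDistrib (fun ω (j : ℕ) => Z (n - j) ω) (fun ω (j : ℕ) => Z (0 - j) ω) μ μ := by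
  have hm : ∀ n : ℤ, Measurable fun ω (j : ℕ) => Z (n - j) ω := fun n =>
    measurable_pi_lambda _ fun j => h.meas _
  have hmap : ∀ n : ℤ, μ.map (fun ω (j : ℕ) => Z (n - j) ω)
      = Measure.infinitePi fun _ : ℕ => μ.map (Z 0) := by
    intro n
    have hi : iIndepFun (fun (j : ℕ) => Z (n - j)) μ :=
      h.indep.precomp (g := fun j : ℕ => n - j) fun a b hab => by simpa using hab
    rw [hi.map_fun_eq_infinitePi_map fun j => h.meas _]
    congr 1
    ext1 j
    exact (h.ident _).map_eq
  exact ⟨(hm n).aemeasurable, (hm 0).aemeasurable, by rw [hmap n, hmap 0]⟩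

/-- Joint stationarity of the linear process and its finite parts. -/
lemma integral_comp_stationary (h : HeavyTailedInnovations μ Z c H α δ) (m : ℕ) (n : ℤ)
    {f : ℝ × ℝ → ℝ} (hf : Measurable f) :
    IdentDistrib (fun ω => f (linearProcess c Z n ω, truncSeries c Z m n ω))
      (fun ω => f (linearProcess c Z 0 ω, truncSeries c Z m 0 ω)) μ μ := by
  have hm : Measurable fun z : ℕ → ℝ =>
      f (∑' j, c j * z j, ∑ j ∈ Finset.range m, c j * z j) :=
    hf.comp ((Measurable.tsum fun j => (measurable_pi_apply j).const_mul _).prodMk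
      (Finset.measurable_fun_sum _ fun j _ => (measurable_pi_apply j).const_mul _))
  exact (h.identDistrib_past n).comp hm

/-- The finite part at time `n` depends only on innovations with index in `(n - m, n]`, and the two
windows are disjoint. -/
lemma indepFun_truncSeries (h : HeavyTailedInnovations μ Z c H α δ) {m : ℕ} {n n' : ℤ}
    (hn : n + m ≤ n') : IndepFun (truncSeries c Z m n) (truncSeries c Z m n') μ := by
  set G : ∀ n : ℤ, (Finset.Ioc (n - m) n → ℝ) → ℝ := fun n x =>
    ∑ j ∈ Finset.range m, c j * (if hj : n - j ∈ Finset.Ioc (n - m) n then x ⟨n - j, hj⟩ else 0)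
  have hG : ∀ n, Measurable (G n) := fun n => by
    refine Finset.measurable_fun_sum _ fun j _ => Measurable.const_mul ?_ _
    split_ifs
    · exact measurable_pi_apply _
    · exact measurable_const
  have hGZ : ∀ n, truncSeries c Z m n
      = G n ∘ fun ω (i : Finset.Ioc (n - m) n) => Z i ω := by
    intro n
    ext ω
    simp only [truncSeries, G, Function.comp]
    refine Finset.sum_congr rfl fun j hj => ?_
    rw [Finset.mem_range] at hj
    rw [dif_pos (by rw [Finset.mem_Ioc]; omega)]
  have hd : Disjoint (Finset.Ioc (n - m) n) (Finset.Ioc (n' - m) n') := by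
    rw [Finset.disjoint_left]
    intro i hi hi'
    rw [Finset.mem_Ioc] at hi hi'
    omega
  rw [hGZ n, hGZ n']
  exact (h.indep.indepFun_finset _ _ hd h.meas).comp (hG n) (hG n')

variable {a b : ℕ → ℝ} {g : ℝ → ℝ} {s C : ℝ}

/-- The functional of the linear process is approximated in mean by a bounded functional of a
finite part of it. -/
lemma exists_approx (h : HeavyTailedInnovations μ Z c H α δ) (hg : IsTailKernel g s C)
    (ha : ∀ᶠ n in atTop, 0 ≤ a n) (hb : Tendsto b atTop atTop)
    (hab : ∀ v, 0 < v → Tendsto (fun n => a n * absTail μ (linearProcess c Z 0) (v * b n)) atTop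
      (𝓝 (v ^ (-α)))) {η : ℝ} (hη : 0 < η) :
    ∃ M, 0 ≤ M ∧ ∃ m : ℕ, ∀ᶠ n in atTop,
      a n * ∫ ω, |prim g (|(linearProcess c Z 0 ω)| / b n) -
        prim ((Set.Iic M).indicator g) (|truncSeries c Z m 0 ω| / b n)| ∂μ ≤ η := by
  have hs := hg.start_pos
  have hX := h.linearProcess_measurable 0
  have hT := h.linearProcess_regVarTail 0
  have hTH := h.linearProcess_tendsto_absTail 0
  have hα := h.index_pos
  set X := linearProcess c Z 0
  have hCs : 0 ≤ C / s := div_nonneg hg.const_nonneg hs.le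
  -- Three errors are each kept below `η / 4`: the density beyond `M` here, a shift of the argument
  -- by at most `ε`, and the event that the series remainder exceeds `ε b`, governed by `ζ`.
  obtain ⟨M, hM0, hM⟩ : ∃ M, 0 ≤ M ∧
      ∫ v in Set.Ioi s, (Set.Ioi M).indicator g v * v ^ (-α) < η / 4 := by
    have hlim : Tendsto (fun M : ℝ => ∫ v in Set.Ioi s, (Set.Ioi M).indicator g v * v ^ (-α)) atTop
        (𝓝 (∫ v in Set.Ioi s, (0 : ℝ))) := by
      refine tendsto_integral_filter_of_dominated_convergence (fun v => g v * v ^ (-α)) ?_ ?_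
        (hg.integrableOn_rpow hα) ?_
      · exact Eventually.of_forall fun M => (((hg.truncate_compl M).meas).mul
          (measurable_id.pow_const _)).aestronglyMeasurable
      · refine Eventually.of_forall fun M => ?_
        filter_upwards [ae_restrict_mem measurableSet_Ioi] with v hv
        have h1 : 0 ≤ v ^ (-α) := Real.rpow_nonneg (hs.trans hv).le _
        rw [Real.norm_of_nonneg (mul_nonneg ((hg.truncate_compl M).nonneg v) h1)]
        gcongr
        exact Set.indicator_le_self' (fun v _ => hg.nonneg v) v
      · filter_upwards with v
        refine tendsto_const_nhds.congr' ?_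
        filter_upwards [eventually_ge_atTop v] with M hM
        rw [Set.indicator_of_notMem (by simpa using hM), zero_mul]
    rw [integral_zero] at hlim
    obtain ⟨M, h1, h2⟩ := ((hlim.eventually_lt_const (show (0 : ℝ) < η / 4 by positivity)).and
      (eventually_ge_atTop 0)).exists
    exact ⟨M, h2, h1⟩
  have hg1 := hg.truncate M
  have hg2 := hg.truncate_compl M
  obtain ⟨hint2, hlim2⟩ := hg2.tendsto_mul_integral_prim (μ := μ) hX hT hα ha hb hab
  obtain ⟨hint0, -⟩ := hg.tendsto_mul_integral_prim (μ := μ) hX hT hα ha hb hab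
  -- The condition `ε ≤ s / 2` ensures that if `|X| ≤ s b / 2` and the remainder is at most `ε b`,
  -- both arguments are at most `s` and both primitives vanish. A shift error thus arises only on
  -- `{|X| > s b / 2}`, whose normalized probability stays bounded.
  obtain ⟨ε, hε0, hεs, hε⟩ : ∃ ε, 0 < ε ∧ ε ≤ s / 2 ∧ C / s * ε * ((s / 2) ^ (-α) + 1) ≤ η / 4 := by
    set D := C / s * ((s / 2) ^ (-α) + 1) + 1
    have hD : 1 ≤ D := by
      have : 0 ≤ C / s * ((s / 2) ^ (-α) + 1) := by positivity
      linarith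
    refine ⟨min (s / 2) (η / 4 / D), by positivity, min_le_left _ _, ?_⟩
    calc C / s * min (s / 2) (η / 4 / D) * ((s / 2) ^ (-α) + 1)
        ≤ C / s * (η / 4 / D) * ((s / 2) ^ (-α) + 1) := by gcongr; exact min_le_right _ _
      _ = (η / 4 / D) * (D - 1) := by simp only [D]; ring
      _ ≤ (η / 4 / D) * D := by gcongr; linarith
      _ = η / 4 := by field_simp
  set K := ∑' j, |c j| ^ α
  have hK : 0 < K := h.tsum_rpow_index_pos
  obtain ⟨ζ, hζ0, hζ⟩ : ∃ ζ > 0, C / s * M * (ζ * (ε ^ (-α) / K + 1)) ≤ η / 4 := by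
    set D := C / s * M * (ε ^ (-α) / K + 1) + 1
    have hD : 1 ≤ D := by
      have : 0 ≤ C / s * M * (ε ^ (-α) / K + 1) := by positivity
      linarith
    refine ⟨η / 4 / D, by positivity, ?_⟩
    calc C / s * M * (η / 4 / D * (ε ^ (-α) / K + 1)) = (η / 4 / D) * (D - 1) := by
          simp only [D]; ring
      _ ≤ (η / 4 / D) * D := by gcongr; linarith
      _ = η / 4 := by field_simp
  obtain ⟨m, hm⟩ := (h.eventually_absTail_sub_le hζ0).exists
  refine ⟨M, hM0, m, ?_⟩
  set X' := truncSeries c Z m 0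
  have hX' : Measurable X' := h.measurable_truncSeries m 0
  have hεb : Tendsto (fun n => ε * b n) atTop atTop := hb.const_mul_atTop hε0
  -- The normalization is by the tail of `X`, whereas the remainder bound is in terms of `H`; the
  -- two differ asymptotically by the factor `K`.
  have hHlim : Tendsto (fun n => a n * H (ε * b n)) atTop (𝓝 (ε ^ (-α) / K)) := by
    refine ((hab ε hε0).div (hTH.comp hεb) hK.ne').congr fun n => ?_
    have h1 := (h.regVar.pos (ε * b n)).ne'
    have h2 := (hT.pos (ε * b n)).ne'
    simp only [Pi.div_apply, Function.comp]
    field_simp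
  filter_upwards [hint2, hint0, hlim2.eventually_lt_const hM, ha, hb.eventually_gt_atTop 0,
    (hab (s / 2) (by positivity)).eventually_lt_const (lt_add_one _), hεb.eventually hm,
    hHlim.eventually_lt_const (lt_add_one _)] with n hi2 hi0 hl2 ha0 hb0 hT1 hR hH1
  have hms1 : MeasurableSet {ω | s / 2 * b n < |X ω|} := measurableSet_absTail hX _
  have hms2 : MeasurableSet {ω | ε * b n < |X ω - X' ω|} := measurableSet_absTail (hX.sub hX') _
  have hpt : ∀ ω, |prim g (|X ω| / b n) - prim ((Set.Iic M).indicator g) (|X' ω| / b n)|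
      ≤ prim ((Set.Ioi M).indicator g) (|X ω| / b n)
        + ({ω | s / 2 * b n < |X ω|}.indicator (fun _ => C / s * ε) ω
        + {ω | ε * b n < |X ω - X' ω|}.indicator (fun _ => C / s * M) ω) := by
    intro ω
    have e1 := hg.prim_truncate_add M (|X ω| / b n)
    have e2 := hg2.prim_nonneg (|X ω| / b n)
    have i1 : 0 ≤ {ω | s / 2 * b n < |X ω|}.indicator (fun _ => C / s * ε) ω :=
      Set.indicator_nonneg (fun _ _ => by positivity) _
    have i2 : 0 ≤ {ω | ε * b n < |X ω - X' ω|}.indicator (fun _ => C / s * M) ω :=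
      Set.indicator_nonneg (fun _ _ => by positivity) _
    have key : |prim ((Set.Iic M).indicator g) (|X ω| / b n)
        - prim ((Set.Iic M).indicator g) (|X' ω| / b n)|
        ≤ {ω | s / 2 * b n < |X ω|}.indicator (fun _ => C / s * ε) ω
        + {ω | ε * b n < |X ω - X' ω|}.indicator (fun _ => C / s * M) ω := by
      by_cases h1 : ε * b n < |X ω - X' ω|
      · have h2 : {ω | ε * b n < |X ω - X' ω|}.indicator (fun _ => C / s * M) ω = C / s * M :=
          Set.indicator_of_mem (by simpa using h1) _
        rw [h2]
        have := abs_sub_le_of_nonneg_of_le (hg1.prim_nonneg (|X ω| / b n))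
          (hg.prim_truncate_le hM0 _) (hg1.prim_nonneg (|X' ω| / b n)) (hg.prim_truncate_le hM0 _)
        linarith
      · rw [not_lt] at h1
        by_cases h2 : s / 2 * b n < |X ω|
        · have h3 : {ω | s / 2 * b n < |X ω|}.indicator (fun _ => C / s * ε) ω = C / s * ε :=
            Set.indicator_of_mem (by simpa using h2) _
          rw [h3]
          have h4 := hg1.abs_prim_sub_le (|X' ω| / b n) (|X ω| / b n)
          have h5 : |(|X ω| / b n - |X' ω| / b n)| ≤ ε := by
            rw [← sub_div, abs_div, abs_of_pos hb0, div_le_iff₀ hb0]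
            exact (abs_abs_sub_abs_le _ _).trans h1
          have := h4.trans (mul_le_mul_of_nonneg_left h5 hCs)
          linarith
        · rw [not_lt] at h2
          have h3 : |X' ω| ≤ s * b n := by
            have := abs_sub_abs_le_abs_sub (X' ω) (X ω)
            rw [abs_sub_comm] at this
            nlinarith
          rw [hg1.prim_of_le ((div_le_iff₀ hb0).2 (h2.trans (by nlinarith))),
            hg1.prim_of_le ((div_le_iff₀ hb0).2 h3)]
          simp only [sub_zero, abs_zero]
          linarith
    rw [← e1, add_sub_right_comm]
    refine (abs_add_le _ _).trans ?_
    rw [abs_of_nonneg e2]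
    linarith
  have hIa : Integrable ({ω | s / 2 * b n < |X ω|}.indicator fun _ => C / s * ε) μ :=
    (integrable_const _).indicator hms1
  have hIb : Integrable ({ω | ε * b n < |X ω - X' ω|}.indicator fun _ => C / s * M) μ :=
    (integrable_const _).indicator hms2
  have hle := integral_mono_of_nonneg (μ := μ) (ae_of_all _ fun ω => abs_nonneg _)
    (hi2.add (hIa.add hIb)) (ae_of_all _ hpt)
  have heq : ∫ ω, (prim ((Set.Ioi M).indicator g) (|X ω| / b n)
        + ({ω | s / 2 * b n < |X ω|}.indicator (fun _ => C / s * ε) ω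
        + {ω | ε * b n < |X ω - X' ω|}.indicator (fun _ => C / s * M) ω)) ∂μ
      = ∫ ω, prim ((Set.Ioi M).indicator g) (|X ω| / b n) ∂μ
        + (absTail μ X (s / 2 * b n) * (C / s * ε)
          + absTail μ (fun ω => X ω - X' ω) (ε * b n) * (C / s * M)) := by
    have e1 := integral_add hi2 (hIa.add hIb)
    simp only [Pi.add_apply] at e1
    rw [e1, integral_add hIa hIb, integral_indicator_const _ hms1,
      integral_indicator_const _ hms2]
    rfl
  have hle' := mul_le_mul_of_nonneg_left (hle.trans_eq heq) ha0
  refine hle'.trans ?_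
  have t1 : a n * absTail μ X (s / 2 * b n) * (C / s * ε) ≤ ((s / 2) ^ (-α) + 1) * (C / s * ε) := by
    gcongr
  have t2 : a n * absTail μ (fun ω => X ω - X' ω) (ε * b n) * (C / s * M)
      ≤ ζ * (ε ^ (-α) / K + 1) * (C / s * M) := by
    refine mul_le_mul_of_nonneg_right ?_ (by positivity)
    calc a n * absTail μ (fun ω => X ω - X' ω) (ε * b n) ≤ a n * (ζ * H (ε * b n)) := by
          gcongr; exact hR 0
      _ = ζ * (a n * H (ε * b n)) := by ring
      _ ≤ _ := by gcongr
  nlinarith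

/-- The normalized sums of a tail functional over the linear process converge in probability. -/
lemma tendsto_tailSum (h : HeavyTailedInnovations μ Z c H α δ) (hg : IsTailKernel g s C)
    {k : ℕ → ℕ} (hk : Tendsto k atTop atTop) (hb : Tendsto b atTop atTop)
    (hab : ∀ v, 0 < v → Tendsto (fun n : ℕ => (n : ℝ) / k n *
      absTail μ (linearProcess c Z 0) (v * b n)) atTop (𝓝 (v ^ (-α)))) :
    Tendsto (fun q : ℕ × Ω => (k q.1 : ℝ)⁻¹ *
        ∑ i ∈ Finset.range q.1, prim g (|(linearProcess c Z (i + 1) q.2)| / b q.1))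
      (probFilter μ) (𝓝 (∫ v in Set.Ioi s, g v * v ^ (-α))) := by
  have ha : ∀ᶠ n : ℕ in atTop, 0 ≤ (n : ℝ) / k n := Eventually.of_forall fun n => by positivity
  have hs := hg.start_pos
  obtain ⟨hint0, hlim0⟩ := hg.tendsto_mul_integral_prim (μ := μ) (h.linearProcess_measurable 0)
    (h.linearProcess_regVarTail 0) h.index_pos ha hb hab
  set Λ := ∫ v in Set.Ioi s, g v * v ^ (-α)
  set Y : ℕ → ℕ → Ω → ℝ := fun n i ω => prim g (|(linearProcess c Z (i + 1) ω)| / b n)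
  have hYd : ∀ n i, IdentDistrib (Y n i) (fun ω => prim g (|(linearProcess c Z 0 ω)| / b n)) μ μ :=
    fun n i => h.integral_comp_stationary 0 (i + 1)
      (f := fun x => prim g (|x.1| / b n))
      (hg.continuous_prim.measurable.comp (by fun_prop))
  have hYint : ∀ᶠ n in atTop, ∀ i, Integrable (Y n i) μ :=
    hint0.mono fun n hn i => (hYd n i).integrable_iff.2 hn
  have hSint : ∀ᶠ n in atTop, Integrable (fun ω => (k n : ℝ)⁻¹ * ∑ i ∈ Finset.range n, Y n i ω) μ :=
    hYint.mono fun n hn => (integrable_finsetSum _ fun i _ => hn i).const_mul _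
  refine tendsto_probFilter_of_integral_abs
    (f := fun n ω => (k n : ℝ)⁻¹ * ∑ i ∈ Finset.range n, Y n i ω) hSint ?_
  rw [Metric.tendsto_nhds]
  intro ε' hε'
  -- The five shares are one for `S - S'`, two for the fluctuation of `S'` (`η` and variance over
  -- `η`), one for the difference of the means, and one for the mean of `S` against its limit.
  obtain ⟨η, hη0, hη⟩ : ∃ η > 0, 5 * η < ε' := ⟨ε' / 6, by positivity, by linarith⟩
  obtain ⟨M, hM0, m, happ⟩ := h.exists_approx hg ha hb hab hη0
  have hg1 := hg.truncate M
  set B := C / s * M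
  have hB : 0 ≤ B := mul_nonneg (div_nonneg hg.const_nonneg hs.le) hM0
  set Y' : ℕ → ℕ → Ω → ℝ := fun n i ω =>
    prim ((Set.Iic M).indicator g) (|truncSeries c Z m (i + 1) ω| / b n)
  have hmφ : ∀ n, Measurable fun x : ℝ => prim ((Set.Iic M).indicator g) (|x| / b n) := fun n =>
    hg1.continuous_prim.measurable.comp (by fun_prop)
  have hY'm : ∀ n i, Measurable (Y' n i) := fun n i =>
    (hmφ n).comp (h.measurable_truncSeries m (i + 1))
  have hY'0 : ∀ n i ω, 0 ≤ Y' n i ω := fun n i ω => hg1.prim_nonneg _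
  have hY'B : ∀ n i ω, Y' n i ω ≤ B := fun n i ω => hg.prim_truncate_le hM0 _
  have hY'L : ∀ n i, MemLp (Y' n i) 2 μ := fun n i =>
    MemLp.of_bound (hY'm n i).aestronglyMeasurable B (ae_of_all _ fun ω => by
      rw [Real.norm_of_nonneg (hY'0 n i ω)]; exact hY'B n i ω)
  have hY'int : ∀ n i, Integrable (Y' n i) μ := fun n i => (hY'L n i).integrable one_le_two
  have hY'ind : ∀ n i j : ℕ, i + m ≤ j → IndepFun (Y' n i) (Y' n j) μ := fun n i j hij =>
    (h.indepFun_truncSeries (n := (i : ℤ) + 1) (n' := (j : ℤ) + 1) (by omega)).comp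
      (hmφ n) (hmφ n)
  have hd : ∀ n i, ∫ ω, |Y n i ω - Y' n i ω| ∂μ
      = ∫ ω, |prim g (|(linearProcess c Z 0 ω)| / b n) -
        prim ((Set.Iic M).indicator g) (|truncSeries c Z m 0 ω| / b n)| ∂μ := fun n i =>
    (h.integral_comp_stationary m (i + 1) (f := fun x => |prim g (|x.1| / b n) -
      prim ((Set.Iic M).indicator g) (|x.2| / b n)|)
      (((hg.continuous_prim.measurable.comp (by fun_prop)).sub
        (hg1.continuous_prim.measurable.comp (by fun_prop))).abs)).integral_eq
  set E : ℕ → ℝ := fun n => ∫ ω, prim g (|(linearProcess c Z 0 ω)| / b n) ∂μ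
  set D : ℕ → ℝ := fun n => ∫ ω, |prim g (|(linearProcess c Z 0 ω)| / b n) -
        prim ((Set.Iic M).indicator g) (|truncSeries c Z m 0 ω| / b n)| ∂μ
  have hvar : Tendsto (fun n => (k n : ℝ)⁻¹ * ((2 * m + 1) * (B * (Λ + 1 + η))) / η) atTop (𝓝 0) := by
    have := ((tendsto_inv_atTop_zero.comp (tendsto_natCast_atTop_atTop.comp hk)).mul_const
      ((2 * m + 1) * (B * (Λ + 1 + η)))).div_const η
    simpa using this
  filter_upwards [hYint, happ, hvar.eventually_lt_const hη0, hk.eventually_gt_atTop 0,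
    hlim0.eventually (Metric.ball_mem_nhds Λ hη0), hlim0.eventually_lt_const (lt_add_one Λ),
    hSint] with n hYi hD hv hk0 hE hE1 hSi
  have hk0' : (0 : ℝ) < k n := by exact_mod_cast hk0
  set S : Ω → ℝ := fun ω => (k n : ℝ)⁻¹ * ∑ i ∈ Finset.range n, Y n i ω
  set S' : Ω → ℝ := fun ω => (k n : ℝ)⁻¹ * (∑ i ∈ Finset.range n, Y' n i) ω
  have hS'L : MemLp S' 2 μ := (memLp_finsetSum' _ fun i _ => hY'L n i).const_mul _
  have hS'i : Integrable S' μ := hS'L.integrable one_le_two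
  have hYY' : ∀ i, Integrable (fun ω => |Y n i ω - Y' n i ω|) μ := fun i =>
    ((hYi i).sub (hY'int n i)).abs
  have hSS'i : Integrable (fun ω => |S ω - S' ω|) μ := (hSi.sub hS'i).abs
  have hS'ei : Integrable (fun ω => |S' ω - ∫ ω', S' ω' ∂μ|) μ :=
    (hS'i.sub (integrable_const _)).abs
  have hY'e : ∀ i, ∫ ω, Y' n i ω ∂μ ≤ E n + D n := by
    intro i
    calc ∫ ω, Y' n i ω ∂μ ≤ ∫ ω, (Y n i ω + |Y n i ω - Y' n i ω|) ∂μ := by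
          refine integral_mono (hY'int n i) ((hYi i).add (hYY' i)) fun ω => ?_
          have := neg_abs_le (Y n i ω - Y' n i ω)
          change Y' n i ω ≤ Y n i ω + |Y n i ω - Y' n i ω|
          linarith
      _ = E n + D n := by
          rw [integral_add (hYi i) (hYY' i), hd, (hYd n i).integral_eq]
  -- The variance bound is linear in the mean of one summand, which is of order `k / n`. The factor
  -- `k⁻² · n` thus becomes `k⁻¹`; a bound by `B²` alone would leave `n / k²`, which need not tend
  -- to `0`.
  have hV : Var[S'; μ] ≤ (k n : ℝ)⁻¹ * ((2 * m + 1) * (B * (Λ + 1 + η))) := by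
    rw [variance_const_mul]
    have h1 := variance_sum_le_of_dependent (hY'm n) (hY'0 n) (hY'B n) hB hY'e (hY'ind n) n
    calc ((k n : ℝ)⁻¹) ^ 2 * Var[∑ i ∈ Finset.range n, Y' n i; μ]
        ≤ ((k n : ℝ)⁻¹) ^ 2 * (n * ((2 * m + 1) * (B * (E n + D n)))) := by gcongr
      _ = (k n : ℝ)⁻¹ * ((2 * m + 1) * (B * (n / k n * E n + n / k n * D n))) := by
          field_simp
      _ ≤ _ := by gcongr
  have hSS' : ∫ ω, |S ω - S' ω| ∂μ ≤ η := by
    calc ∫ ω, |S ω - S' ω| ∂μ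
        ≤ ∫ ω, (k n : ℝ)⁻¹ * ∑ i ∈ Finset.range n, |Y n i ω - Y' n i ω| ∂μ := by
          refine integral_mono (hSi.sub hS'i).abs ((integrable_finsetSum _ fun i _ => hYY' i).const_mul _) fun ω => ?_
          simp only [S, S', Finset.sum_apply]
          rw [← mul_sub, ← Finset.sum_sub_distrib, abs_mul, abs_of_pos (inv_pos.2 hk0')]
          gcongr
          exact Finset.abs_sum_le_sum_abs _ _
      _ = (n : ℝ) / k n * D n := by
          rw [integral_const_mul, integral_finsetSum _ fun i _ => hYY' i]
          simp_rw [hd]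
          rw [Finset.sum_const, Finset.card_range, nsmul_eq_mul]
          ring
      _ ≤ η := hD
  have hES : ∫ ω, S ω ∂μ = n / k n * E n := by
    simp only [S]
    rw [integral_const_mul, integral_finsetSum _ fun i _ => hYi i]
    simp_rw [fun i => (hYd n i).integral_eq]
    rw [Finset.sum_const, Finset.card_range, nsmul_eq_mul]
    ring
  have hdiff : |∫ ω, S' ω ∂μ - ∫ ω, S ω ∂μ| ≤ η := by
    rw [← integral_sub hS'i hSi]
    refine (abs_integral_le_integral_abs).trans (le_of_eq_of_le ?_ hSS')
    simp_rw [abs_sub_comm]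
  have hfin : ∫ ω, |S ω - Λ| ∂μ ≤ ∫ ω, (|S ω - S' ω| + |S' ω - ∫ ω', S' ω' ∂μ|
      + (|∫ ω, S' ω ∂μ - ∫ ω, S ω ∂μ| + |∫ ω, S ω ∂μ - Λ|)) ∂μ := by
    refine integral_mono (hSi.sub (integrable_const Λ)).abs
      ((hSS'i.add hS'ei).add (integrable_const _))
      fun ω => ?_
    change |S ω - Λ| ≤ |S ω - S' ω| + |S' ω - ∫ ω', S' ω' ∂μ|
      + (|∫ ω, S' ω ∂μ - ∫ ω, S ω ∂μ| + |∫ ω, S ω ∂μ - Λ|)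
    have h1 := abs_sub_le (S ω) (S' ω) Λ
    have h2 := abs_sub_le (S' ω) (∫ ω, S' ω ∂μ) Λ
    have h3 := abs_sub_le (∫ ω, S' ω ∂μ) (∫ ω, S ω ∂μ) Λ
    linarith
  have hsplit := integral_add (hSS'i.add hS'ei)
    (integrable_const (μ := μ) (|∫ ω, S' ω ∂μ - ∫ ω, S ω ∂μ| + |∫ ω, S ω ∂μ - Λ|))
  simp only [Pi.add_apply] at hsplit
  rw [hsplit, integral_add hSS'i hS'ei,
    integral_const, probReal_univ, one_smul] at hfin
  have h4 := integral_abs_sub_integral_le hS'L hη0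
  have h5 : Var[S'; μ] / η ≤ (k n : ℝ)⁻¹ * ((2 * m + 1) * (B * (Λ + 1 + η))) / η := by gcongr
  have h6 : |∫ ω, S ω ∂μ - Λ| ≤ η := by
    rw [hES]
    rw [Real.dist_eq] at hE
    exact hE.le
  rw [Real.dist_eq, sub_zero, abs_of_nonneg (integral_nonneg fun ω => abs_nonneg _)]
  linarith

end HeavyTailedInnovations

/-! ### Order statistics -/

section OrderStat

variable {n k : ℕ} {x : Fin n → ℝ}

lemma orderStat_sub (x : Fin n → ℝ) {i : ℕ} (hi : i < n) :
    orderStat x (n - i) = x (Tuple.sort x ⟨n - 1 - i, by omega⟩) := by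
  rw [orderStat, dif_pos (by omega)]
  congr 3
  omega

lemma sort_le_sort (x : Fin n → ℝ) {i j : Fin n} (h : i ≤ j) :
    x (Tuple.sort x i) ≤ x (Tuple.sort x j) := Tuple.monotone_sort x h

lemma orderStat_sub_le (x : Fin n → ℝ) {i j : ℕ} (hij : i ≤ j) (hj : j < n) :
    orderStat x (n - j) ≤ orderStat x (n - i) := by
  rw [orderStat_sub x hj, orderStat_sub x (hij.trans_lt hj)]
  exact sort_le_sort x (Fin.mk_le_mk.2 (by omega))

/-- A sum over the excesses of the `k` largest observations as a sum over all observations. -/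
lemma sum_excess_orderStat (x : Fin n → ℝ) (hk : k < n) {φ : ℝ → ℝ} (hφ : ∀ y ≤ 0, φ y = 0) :
    ∑ i ∈ Finset.range k, φ (orderStat x (n - i) - orderStat x (n - k))
      = ∑ j, φ (x j - orderStat x (n - k)) := by
  set V := orderStat x (n - k)
  rw [← Equiv.sum_comp (Tuple.sort x)]
  set f : ℕ → ℝ := fun l => if h : l < n then φ (x (Tuple.sort x ⟨l, h⟩) - V) else 0
  have h1 : ∑ j, φ (x (Tuple.sort x j) - V) = ∑ l ∈ Finset.range n, f l := by
    rw [Finset.sum_range]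
    exact Finset.sum_congr rfl fun j _ => by simp [f]
  rw [h1, ← Finset.sum_range_reflect f n]
  -- After reversal the first `k` terms are the top `k` observations; the others have nonpositive
  -- argument and contribute `0`.
  rw [← Finset.sum_subset (Finset.range_subset_range.2 hk.le)]
  · refine Finset.sum_congr rfl fun i hi => ?_
    rw [Finset.mem_range] at hi
    simp only [f]
    rw [dif_pos (by omega), orderStat_sub x (hi.trans hk)]
  · intro i hi hik
    rw [Finset.mem_range] at hi hik
    simp only [f]
    rw [dif_pos (by omega)]
    apply hφ
    rw [← orderStat_sub x hi, sub_nonpos]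
    exact orderStat_sub_le x (by omega) hi

/-- If the order statistic were at most `t`, every observation above `t` would have rank from the
top in `{0, …, k - 1}`, and ranks are distinct. -/
lemma lt_orderStat_of_lt_card (hk : k < n) {t : ℝ}
    (h : k < (Finset.univ.filter fun j => t < x j).card) : t < orderStat x (n - k) := by
  by_contra! hV
  refine h.not_ge ?_
  rw [← Finset.card_range k]
  refine Finset.card_le_card_of_injOn (fun j => n - 1 - ((Tuple.sort x).symm j : ℕ)) ?_ ?_
  · intro j hj
    rw [Finset.mem_coe, Finset.mem_filter] at hj
    rw [Finset.mem_coe, Finset.mem_range]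
    by_contra! hlt
    have h1 : x (Tuple.sort x ((Tuple.sort x).symm j)) ≤ orderStat x (n - k) := by
      rw [orderStat_sub x hk]
      refine sort_le_sort x ?_
      rw [Fin.le_def]
      change ((Tuple.sort x).symm j : ℕ) ≤ n - 1 - k
      omega
    rw [Equiv.apply_symm_apply] at h1
    linarith [hj.2]
  · intro i _ j _ hij
    have h1 := ((Tuple.sort x).symm i).isLt
    have h2 := ((Tuple.sort x).symm j).isLt
    dsimp only at hij
    exact (Tuple.sort x).symm.injective (Fin.ext (by omega))

/-- If the order statistic exceeded `t`, so would the `k + 1` largest observations. -/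
lemma orderStat_le_of_card_le (hk : k < n) {t : ℝ}
    (h : (Finset.univ.filter fun j => t < x j).card ≤ k) : orderStat x (n - k) ≤ t := by
  by_contra! hV
  refine h.not_gt ?_
  rw [Nat.lt_iff_add_one_le, ← Finset.card_range (k + 1)]
  refine Finset.card_le_card_of_injOn
    -- The default in the second branch is never reached, since `i ≤ k < n` on the set considered.
    (fun i => if hi : i < n then Tuple.sort x ⟨n - 1 - i, by omega⟩ else ⟨0, by omega⟩) ?_ ?_
  · intro i hi
    rw [Finset.mem_coe, Finset.mem_range] at hi
    have hin : i < n := by omega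
    rw [Finset.mem_coe, Finset.mem_filter]
    refine ⟨Finset.mem_univ _, ?_⟩
    dsimp only
    rw [dif_pos hin, ← orderStat_sub x hin]
    exact hV.trans_le (orderStat_sub_le x (by omega) hk)
  · intro i hi j hj hij
    rw [Finset.mem_coe, Finset.mem_range] at hi hj
    have hin : i < n := by omega
    have hjn : j < n := by omega
    dsimp only at hij
    rw [dif_pos hin, dif_pos hjn, EmbeddingLike.apply_eq_iff_eq, Fin.mk.injEq] at hij
    omega

end OrderStat

/-! ### A ramp kernel -/

/-- The density of the uniform distribution on `(t, t']`. -/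
noncomputable def rampKernel (t t' : ℝ) : ℝ → ℝ := (Set.Ioc t t').indicator fun _ => (t' - t)⁻¹

section Ramp

variable {t t' : ℝ}

lemma isTailKernel_ramp (ht : 0 < t) (htt' : t < t') :
    IsTailKernel (rampKernel t t') t (t' * (t' - t)⁻¹) where
  meas := measurable_const.indicator measurableSet_Ioc
  nonneg := fun v => Set.indicator_nonneg (fun _ _ => inv_nonneg.2 (by linarith)) v
  start_pos := ht
  zero := fun v hv => Set.indicator_of_notMem (fun h => hv.not_gt h.1) _
  le := fun v hv => by
    have h1 : 0 < (t' - t)⁻¹ := inv_pos.2 (by linarith)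
    have hv0 : 0 < v := ht.trans hv
    rw [rampKernel, Set.indicator]
    split_ifs with h
    · rw [le_div_iff₀ hv0, mul_comm]
      exact mul_le_mul_of_nonneg_right h.2 h1.le
    · have : 0 < t' := by linarith
      positivity

lemma prim_ramp_of_ge (ht : 0 < t) (htt' : t < t') {x : ℝ} (hx : t' ≤ x) :
    prim (rampKernel t t') x = 1 := by
  have h := (isTailKernel_ramp ht htt')
  rw [← sub_zero (prim _ x), ← h.prim_of_le le_rfl, h.prim_sub,
    intervalIntegral.integral_of_le (htt'.le.trans hx), rampKernel,
    setIntegral_indicator measurableSet_Ioc,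
    Set.inter_eq_right.2 (Set.Ioc_subset_Ioc_right hx), setIntegral_const]
  simp only [Real.volume_real_Ioc, smul_eq_mul, max_eq_left (sub_nonneg.2 htt'.le)]
  exact mul_inv_cancel₀ (by linarith)

lemma prim_ramp_le_one (ht : 0 < t) (htt' : t < t') (x : ℝ) : prim (rampKernel t t') x ≤ 1 := by
  rcases le_total t' x with h | h
  · exact (prim_ramp_of_ge ht htt' h).le
  · exact ((isTailKernel_ramp ht htt').prim_mono h).trans (prim_ramp_of_ge ht htt' le_rfl).le

lemma integral_ramp_mem (ht : 0 < t) (htt' : t < t') {α : ℝ} (hα : 0 < α) :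
    t' ^ (-α) ≤ ∫ v in Set.Ioi t, rampKernel t t' v * v ^ (-α) ∧
      ∫ v in Set.Ioi t, rampKernel t t' v * v ^ (-α) ≤ t ^ (-α) := by
  have hd : 0 < t' - t := by linarith
  have h1 : ∫ v in Set.Ioi t, rampKernel t t' v * v ^ (-α)
      = ∫ v in Set.Ioc t t', (t' - t)⁻¹ * v ^ (-α) := by
    have : (fun v => rampKernel t t' v * v ^ (-α))
        = (Set.Ioc t t').indicator fun v => (t' - t)⁻¹ * v ^ (-α) := by
      ext v
      simp only [rampKernel, Set.indicator]
      split_ifs <;> simp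
    rw [this, setIntegral_indicator measurableSet_Ioc,
      Set.inter_eq_right.2 Set.Ioc_subset_Ioi_self]
  have hint : IntegrableOn (fun v => (t' - t)⁻¹ * v ^ (-α)) (Set.Ioc t t') := by
    rw [← intervalIntegrable_iff_integrableOn_Ioc_of_le htt'.le]
    refine (intervalIntegral.intervalIntegrable_rpow (Or.inr ?_)).const_mul _
    rw [Set.uIcc_of_le htt'.le]
    exact fun h => ht.not_ge h.1
  have hconst : ∀ y : ℝ, ∫ _ in Set.Ioc t t', (t' - t)⁻¹ * y = y := by
    intro y
    rw [setIntegral_const, Real.volume_real_Ioc, max_eq_left hd.le, smul_eq_mul,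
      mul_inv_cancel_left₀ hd.ne']
  rw [h1]
  constructor
  · rw [← hconst (t' ^ (-α))]
    refine setIntegral_mono_on (integrableOn_const (by simp)) hint measurableSet_Ioc fun v hv => ?_
    have : t' ^ (-α) ≤ v ^ (-α) :=
      Real.rpow_le_rpow_of_nonpos (ht.trans hv.1) hv.2 (by linarith)
    gcongr
  · rw [← hconst (t ^ (-α))]
    refine setIntegral_mono_on hint (integrableOn_const (by simp)) measurableSet_Ioc fun v hv => ?_
    have : v ^ (-α) ≤ t ^ (-α) := Real.rpow_le_rpow_of_nonpos ht hv.1.le (by linarith)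
    gcongr

/-- An exceedance count is not a sum of primitives of a kernel, but the ramp lies between the
indicators of `(t', ∞)` and `(t, ∞)`, so the law of large numbers bounds counts from both sides. -/
lemma sum_prim_ramp_le_card (ht : 0 < t) (htt' : t < t') {n : ℕ} (x : Fin n → ℝ) :
    ∑ j, prim (rampKernel t t') (x j) ≤ (Finset.univ.filter fun j => t < x j).card := by
  rw [Finset.card_filter]
  push_cast
  refine Finset.sum_le_sum fun j _ => ?_
  split_ifs with h
  · exact prim_ramp_le_one ht htt' _
  · exact ((isTailKernel_ramp ht htt').prim_of_le (not_lt.1 h)).le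

lemma card_le_sum_prim_ramp (ht : 0 < t) (htt' : t < t') {n : ℕ} (x : Fin n → ℝ) :
    ((Finset.univ.filter fun j => t' < x j).card : ℝ) ≤ ∑ j, prim (rampKernel t t') (x j) := by
  rw [Finset.card_filter]
  push_cast
  refine Finset.sum_le_sum fun j _ => ?_
  split_ifs with h
  · exact (prim_ramp_of_ge ht htt' h.le).ge
  · exact (isTailKernel_ramp ht htt').prim_nonneg _

end Ramp

/-! ### Convergence of functionals of the excesses -/

namespace HeavyTailedInnovations

variable {Ω : Type*} [MeasurableSpace Ω] {μ : Measure Ω} [IsProbabilityMeasure μ]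
  {Z : ℤ → Ω → ℝ} {c : ℕ → ℝ} {H : ℝ → ℝ} {α δ : ℝ} {b : ℕ → ℝ} {k : ℕ → ℕ}

lemma tendsto_tailSum_fin (h : HeavyTailedInnovations μ Z c H α δ) (hk : Tendsto k atTop atTop)
    (hb : Tendsto b atTop atTop)
    (hab : ∀ v, 0 < v → Tendsto (fun n : ℕ => (n : ℝ) / k n *
      absTail μ (linearProcess c Z 0) (v * b n)) atTop (𝓝 (v ^ (-α))))
    {g : ℝ → ℝ} {s C : ℝ} (hg : IsTailKernel g s C) :
    Tendsto (fun q : ℕ × Ω => (k q.1 : ℝ)⁻¹ *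
        ∑ j : Fin q.1, prim g (|(linearProcess c Z ((j : ℕ) + 1 : ℤ) q.2)| / b q.1))
      (probFilter μ) (𝓝 (∫ v in Set.Ioi s, g v * v ^ (-α))) := by
  refine (h.tendsto_tailSum hg hk hb hab).congr fun q => ?_
  rw [Finset.sum_range]

/-- The normalized intermediate order statistic converges to one in probability. -/
lemma tendsto_absOrderStat_div (h : HeavyTailedInnovations μ Z c H α δ)
    (hk : Tendsto k atTop atTop) (hkn : ∀ᶠ n in atTop, k n < n) (hb : Tendsto b atTop atTop)
    (hab : ∀ v, 0 < v → Tendsto (fun n : ℕ => (n : ℝ) / k n *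
      absTail μ (linearProcess c Z 0) (v * b n)) atTop (𝓝 (v ^ (-α)))) :
    Tendsto (fun q : ℕ × Ω => absOrderStat (linearProcess c Z) q.1 (q.1 - k q.1) q.2 / b q.1)
      (probFilter μ) (𝓝 1) := by
  have hfst := tendsto_fst_probFilter (μ := μ)
  have hα := h.index_pos
  have hfilter : ∀ (n : ℕ) (ω : Ω) (t : ℝ), 0 < b n →
      (Finset.univ.filter fun j : Fin n => t < |(linearProcess c Z ((j : ℕ) + 1 : ℤ) ω)| / b n)
      = Finset.univ.filter fun j : Fin n => t * b n < |(linearProcess c Z ((j : ℕ) + 1 : ℤ) ω)| := by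
    intro n ω t hbn
    simp only [lt_div_iff₀ hbn]
  refine tendsto_order.2 ⟨fun t ht => ?_, fun t ht => ?_⟩
  -- For levels `0 < t₁ < t₂ < 1` the ramp sum tends to at least `t₂ ^ (-α) > 1`, so more than `k`
  -- observations exceed `t₁ b`. The maximum with `0` covers nonpositive `t`.
  · obtain ⟨t₁, ht₁, ht₁1⟩ : ∃ t₁, max t 0 < t₁ ∧ t₁ < 1 := exists_between (by simpa using ht)
    obtain ⟨t₂, ht₂, ht₂1⟩ := exists_between ht₁1
    have ht₁0 : 0 < t₁ := (le_max_right _ _).trans_lt ht₁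
    have hlim := h.tendsto_tailSum_fin hk hb hab (isTailKernel_ramp ht₁0 ht₂)
    have h1 : 1 < ∫ v in Set.Ioi t₁, rampKernel t₁ t₂ v * v ^ (-α) :=
      lt_of_lt_of_le (Real.one_lt_rpow_of_pos_of_lt_one_of_neg (ht₁0.trans ht₂) ht₂1 (by linarith))
        (integral_ramp_mem ht₁0 ht₂ hα).1
    filter_upwards [hlim.eventually_const_lt h1, hfst.eventually hkn,
      hfst.eventually (hb.eventually_gt_atTop 0), hfst.eventually (hk.eventually_gt_atTop 0)]
      with q hq hkq hbq hk0
    have hk0' : (0 : ℝ) < k q.1 := by exact_mod_cast hk0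
    rw [lt_inv_mul_iff₀ hk0', mul_one] at hq
    have h2 := hq.trans_le (sum_prim_ramp_le_card ht₁0 ht₂ _)
    rw [hfilter _ _ _ hbq] at h2
    have h3 : t₁ * b q.1 < absOrderStat (linearProcess c Z) q.1 (q.1 - k q.1) q.2 :=
      lt_orderStat_of_lt_card hkq (by exact_mod_cast h2)
    rw [lt_div_iff₀ hbq]
    refine lt_of_le_of_lt ?_ h3
    gcongr
    exact (le_max_left _ _).trans ht₁.le
  · obtain ⟨t₂, ht₂, ht₂1⟩ := exists_between ht
    obtain ⟨t₁, ht₁, ht₁1⟩ := exists_between ht₂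
    have ht₁0 : 0 < t₁ := by linarith
    have hlim := h.tendsto_tailSum_fin hk hb hab (isTailKernel_ramp ht₁0 ht₁1)
    have h1 : ∫ v in Set.Ioi t₁, rampKernel t₁ t₂ v * v ^ (-α) < 1 :=
      lt_of_le_of_lt (integral_ramp_mem ht₁0 ht₁1 hα).2
        (Real.rpow_lt_one_of_one_lt_of_neg ht₁ (by linarith))
    filter_upwards [hlim.eventually_lt_const h1, hfst.eventually hkn,
      hfst.eventually (hb.eventually_gt_atTop 0), hfst.eventually (hk.eventually_gt_atTop 0)]
      with q hq hkq hbq hk0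
    have hk0' : (0 : ℝ) < k q.1 := by exact_mod_cast hk0
    rw [inv_mul_lt_iff₀ hk0', mul_one] at hq
    have h2 := (card_le_sum_prim_ramp ht₁0 ht₁1 _).trans_lt hq
    rw [hfilter _ _ _ hbq] at h2
    have h3 : absOrderStat (linearProcess c Z) q.1 (q.1 - k q.1) q.2 ≤ t₂ * b q.1 :=
      orderStat_le_of_card_le hkq (by exact_mod_cast h2.le)
    rw [div_lt_iff₀ hbq]
    refine lt_of_le_of_lt h3 ?_
    gcongr

/-- Convergence in probability of functionals of the normalized excesses. -/
lemma tendsto_excessSum (h : HeavyTailedInnovations μ Z c H α δ)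
    (hk : Tendsto k atTop atTop) (hkn : ∀ᶠ n in atTop, k n < n) (hb : Tendsto b atTop atTop)
    (hab : ∀ v, 0 < v → Tendsto (fun n : ℕ => (n : ℝ) / k n *
      absTail μ (linearProcess c Z 0) (v * b n)) atTop (𝓝 (v ^ (-α))))
    {g : ℝ → ℝ} {C : ℝ} (hg : IsTailKernel g 1 C) :
    Tendsto (fun q : ℕ × Ω => (k q.1 : ℝ)⁻¹ * ∑ i ∈ Finset.range (k q.1),
        prim g (1 + excess (linearProcess c Z) q.1 (k q.1) i q.2 / b q.1))
      (probFilter μ) (𝓝 (∫ v in Set.Ioi 1, g v * v ^ (-α))) := by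
  have hfst := tendsto_fst_probFilter (μ := μ)
  have hV := h.tendsto_absOrderStat_div hk hkn hb hab
  set V : ℕ × Ω → ℝ := fun q =>
    absOrderStat (linearProcess c Z) q.1 (q.1 - k q.1) q.2 / b q.1
  have hlim := h.tendsto_tailSum_fin hk hb hab hg
  -- Replacing the random threshold by `b` shifts each argument by `V - 1`. When `|V - 1| < 1/2`,
  -- observations with `|X_j| / b ≤ 1/2` contribute nothing before or after the shift. The ramp
  -- dominates the indicator of the others, so the total error is at most `C |V - 1|` times a
  -- normalized sum that converges.
  have hramp : (0 : ℝ) < 1 / 4 ∧ (1 / 4 : ℝ) < 1 / 2 := by norm_num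
  have hN := h.tendsto_tailSum_fin hk hb hab (isTailKernel_ramp hramp.1 hramp.2)
  set N := ∫ v in Set.Ioi (1 / 4), rampKernel (1 / 4) (1 / 2) v * v ^ (-α)
  have hC := hg.const_nonneg
  have herr : Tendsto (fun q : ℕ × Ω => C * |V q - 1| * ((k q.1 : ℝ)⁻¹ *
      ∑ j : Fin q.1, prim (rampKernel (1 / 4) (1 / 2))
        (|(linearProcess c Z ((j : ℕ) + 1 : ℤ) q.2)| / b q.1))) (probFilter μ) (𝓝 0) := by
    have := ((hV.sub_const 1).abs.const_mul C).mul hN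
    simpa using this
  have hdiff : Tendsto (fun q : ℕ × Ω => (k q.1 : ℝ)⁻¹ * ∑ i ∈ Finset.range (k q.1),
        prim g (1 + excess (linearProcess c Z) q.1 (k q.1) i q.2 / b q.1) -
      (k q.1 : ℝ)⁻¹ * ∑ j : Fin q.1, prim g (|(linearProcess c Z ((j : ℕ) + 1 : ℤ) q.2)| / b q.1))
      (probFilter μ) (𝓝 0) := by
    refine squeeze_zero_norm' ?_ herr
    filter_upwards [hfst.eventually hkn, hfst.eventually (hb.eventually_gt_atTop 0),
      hV.eventually (Metric.ball_mem_nhds 1 (show (0 : ℝ) < 1 / 2 by norm_num))] with q hkq hbq hVq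
    rw [Real.dist_eq] at hVq
    have hVq' := abs_lt.1 hVq
    have h1 : ∑ i ∈ Finset.range (k q.1),
          prim g (1 + excess (linearProcess c Z) q.1 (k q.1) i q.2 / b q.1)
        = ∑ j : Fin q.1, prim g (|(linearProcess c Z ((j : ℕ) + 1 : ℤ) q.2)| / b q.1 - (V q - 1)) := by
      refine (sum_excess_orderStat (fun j : Fin q.1 => |(linearProcess c Z ((j : ℕ) + 1 : ℤ) q.2)|)
        hkq (φ := fun y => prim g (1 + y / b q.1)) fun y hy => hg.prim_of_le ?_).trans ?_
      · have := div_nonpos_of_nonpos_of_nonneg hy hbq.le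
        linarith
      · refine Finset.sum_congr rfl fun j _ => ?_
        congr 1
        simp only [V, absOrderStat]
        ring
    rw [h1, ← mul_sub, ← Finset.sum_sub_distrib, Real.norm_eq_abs, abs_mul,
      abs_of_nonneg (inv_nonneg.2 (Nat.cast_nonneg _)), mul_left_comm]
    refine mul_le_mul_of_nonneg_left ?_ (inv_nonneg.2 (Nat.cast_nonneg _))
    rw [Finset.mul_sum]
    refine (Finset.abs_sum_le_sum_abs _ _).trans (Finset.sum_le_sum fun j _ => ?_)
    set y := |(linearProcess c Z ((j : ℕ) + 1 : ℤ) q.2)| / b q.1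
    rcases le_total (1 / 2) y with hy | hy
    · rw [prim_ramp_of_ge hramp.1 hramp.2 hy, mul_one]
      have := hg.abs_prim_sub_le y (y - (V q - 1))
      rwa [sub_sub_cancel_left, abs_neg, div_one] at this
    · rw [hg.prim_of_le (by linarith), hg.prim_of_le (by linarith), sub_zero, abs_zero]
      exact mul_nonneg (mul_nonneg hC (abs_nonneg _))
        ((isTailKernel_ramp hramp.1 hramp.2).prim_nonneg _)
  have := hdiff.add hlim
  simpa using this

end HeavyTailedInnovations

/-! ### Monotonicity of the likelihood moment equation -/

/-- In other words `log (1 + θ₁ y) / log (1 + θ₂ y)` increases in `y`. Choose `lam` with `(1 + θ₂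
y') ^ lam = 1 + θ₂ y`. Strict concavity of `x ^ lam` between `1` and `1 + θ₂ y'`, with weight `θ₁ /
θ₂`, gives `1 + θ₁ y < (1 + θ₁ y') ^ lam`; then take logarithms. -/
lemma log_mul_log_lt {θ₁ θ₂ y y' : ℝ} (h1 : 0 < θ₁) (h12 : θ₁ < θ₂) (hy : 0 < y) (hyy : y < y') :
    Real.log (1 + θ₁ * y) * Real.log (1 + θ₂ * y') < Real.log (1 + θ₁ * y') * Real.log (1 + θ₂ * y) := by
  have hy' : 0 < y' := hy.trans hyy
  have h2 : 0 < θ₂ := h1.trans h12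
  have hA1 : 1 < 1 + θ₂ * y' := by have := mul_pos h2 hy'; linarith
  have hB1 : 1 < 1 + θ₂ * y := by have := mul_pos h2 hy; linarith
  have hBA : 1 + θ₂ * y < 1 + θ₂ * y' := by have := mul_lt_mul_of_pos_left hyy h2; linarith
  have hL : 0 < Real.log (1 + θ₂ * y') := Real.log_pos hA1
  set lam := Real.log (1 + θ₂ * y) / Real.log (1 + θ₂ * y')
  have hl0 : 0 < lam := div_pos (Real.log_pos hB1) hL
  have hl1 : lam < 1 := (div_lt_one hL).2 (Real.log_lt_log (by linarith) hBA)
  have hAl : (1 + θ₂ * y') ^ lam = 1 + θ₂ * y := by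
    rw [Real.rpow_def_of_pos (by linarith), mul_div_cancel₀ _ hL.ne', Real.exp_log (by linarith)]
  have ha1 : θ₁ / θ₂ < 1 := (div_lt_one h2).2 h12
  have ha0 : 0 < θ₁ / θ₂ := div_pos h1 h2
  have hconc := (Real.strictConcaveOn_rpow hl0 hl1).2 (x := 1) (y := 1 + θ₂ * y')
    (by simp) (by simp; linarith) hA1.ne (sub_pos.2 ha1) ha0 (by ring)
  simp only [smul_eq_mul, Real.one_rpow, hAl] at hconc
  have e1 : (1 - θ₁ / θ₂) * 1 + θ₁ / θ₂ * (1 + θ₂ * y) = 1 + θ₁ * y := by field_simp; ring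
  have e2 : (1 - θ₁ / θ₂) * 1 + θ₁ / θ₂ * (1 + θ₂ * y') = 1 + θ₁ * y' := by field_simp; ring
  rw [e1, e2] at hconc
  have hp : 0 < 1 + θ₁ * y := by positivity
  have hp' : 0 < 1 + θ₁ * y' := by positivity
  have := Real.log_lt_log hp hconc
  rw [Real.log_rpow hp', div_mul_eq_mul_div, lt_div_iff₀ hL] at this
  linarith

lemma log_mul_log_le {θ₁ θ₂ y y' : ℝ} (h1 : 0 < θ₁) (h12 : θ₁ < θ₂) (hy : 0 ≤ y) (hyy : y ≤ y') :
    Real.log (1 + θ₁ * y) * Real.log (1 + θ₂ * y') ≤ Real.log (1 + θ₁ * y') * Real.log (1 + θ₂ * y) := by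
  rcases hy.eq_or_lt with rfl | hy
  · simp
  rcases hyy.eq_or_lt with rfl | hyy
  · exact le_rfl
  exact (log_mul_log_lt h1 h12 hy hyy).le

/-- The same concavity argument with the roles of the points changed: for `θ₁ < 0` the number `1`
lies between `1 + θ₁ y'` and `1 + θ₂ y'`, with weights in the ratio `1 : t`. -/
lemma log_mul_log_le_of_neg {θ₁ θ₂ y y' : ℝ} (h1 : θ₁ < 0) (h2 : 0 < θ₂) (hy : 0 ≤ y)
    (hyy : y ≤ y') (hdom : 0 < 1 + θ₁ * y') :
    Real.log (1 + θ₁ * y') * Real.log (1 + θ₂ * y) ≤ Real.log (1 + θ₁ * y) * Real.log (1 + θ₂ * y') := by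
  rcases (hy.trans hyy).eq_or_lt with hy' | hy'
  · have : y = 0 := le_antisymm (hyy.trans hy'.ge) hy
    simp [this]
  have hA1 : 1 < 1 + θ₂ * y' := by have := mul_pos h2 hy'; linarith
  have hB1 : 1 ≤ 1 + θ₂ * y := by have := mul_nonneg h2.le hy; linarith
  have hBA : 1 + θ₂ * y ≤ 1 + θ₂ * y' := by have := mul_le_mul_of_nonneg_left hyy h2.le; linarith
  have hL : 0 < Real.log (1 + θ₂ * y') := Real.log_pos hA1
  set lam := Real.log (1 + θ₂ * y) / Real.log (1 + θ₂ * y')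
  have hl0 : 0 ≤ lam := div_nonneg (Real.log_nonneg hB1) hL.le
  have hl1 : lam ≤ 1 := (div_le_one hL).2 (Real.log_le_log (by linarith) hBA)
  have hAl : (1 + θ₂ * y') ^ lam = 1 + θ₂ * y := by
    rw [Real.rpow_def_of_pos (by linarith), mul_div_cancel₀ _ hL.ne', Real.exp_log (by linarith)]
  set t := -θ₁ / θ₂
  have ht : 0 < t := div_pos (by linarith) h2
  have hx : 1 + θ₁ * y' ∈ Set.Ici (0 : ℝ) := hdom.le
  have hz : 1 + θ₂ * y' ∈ Set.Ici (0 : ℝ) := (zero_lt_one.trans hA1).le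
  have ha : 0 ≤ (1 + t)⁻¹ := by positivity
  have hb : 0 ≤ t * (1 + t)⁻¹ := by positivity
  have hconc := (Real.concaveOn_rpow hl0 hl1).2 hx hz ha hb (by field_simp)
  have htθ : t * θ₂ = -θ₁ := div_mul_cancel₀ _ h2.ne'
  have e1 : (1 + t)⁻¹ * (1 + θ₁ * y') + t * (1 + t)⁻¹ * (1 + θ₂ * y') = 1 := by
    have : (1 + t)⁻¹ * (1 + θ₁ * y') + t * (1 + t)⁻¹ * (1 + θ₂ * y')
        = (1 + t)⁻¹ * (1 + t + (θ₁ + t * θ₂) * y') := by ring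
    rw [this, htθ]
    field_simp
    ring
  simp only [smul_eq_mul, hAl, e1, Real.one_rpow] at hconc
  have h3 : (1 + θ₁ * y') ^ lam ≤ 1 + θ₁ * y := by
    have h4 : (1 + t) * ((1 + t)⁻¹ * (1 + θ₁ * y') ^ lam + t * (1 + t)⁻¹ * (1 + θ₂ * y))
        = (1 + θ₁ * y') ^ lam + t * (1 + θ₂ * y) := by field_simp
    have h5 := mul_le_mul_of_nonneg_left hconc (by positivity : 0 ≤ 1 + t)
    rw [h4] at h5
    have h6 : t * (1 + θ₂ * y) = t - θ₁ * y := by rw [mul_add, ← mul_assoc, htθ]; ring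
    linarith
  have := Real.log_le_log (Real.rpow_pos_of_pos hdom _) h3
  rw [Real.log_rpow hdom, div_mul_eq_mul_div, div_le_iff₀ hL] at this
  linarith

/-- If `f₂ / f₁` is nondecreasing then `f₂ - f₁` changes sign at most once. -/
lemma exists_single_crossing {S : Set ℝ} {f₁ f₂ : ℝ → ℝ}
    (hmono : ∀ y ∈ S, ∀ y' ∈ S, y ≤ y' → f₁ y ≤ f₁ y')
    (h1 : ∀ y ∈ S, 0 ≤ f₁ y) (h2 : ∀ y ∈ S, 0 ≤ f₂ y)
    (hratio : ∀ y ∈ S, ∀ y' ∈ S, y ≤ y' → f₂ y * f₁ y' ≤ f₂ y' * f₁ y)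
    (hex : ∃ y ∈ S, f₁ y < f₂ y) :
    ∃ c, ∀ y ∈ S, 0 ≤ (f₁ y - c) * (f₂ y - f₁ y) := by
  obtain ⟨y₀, hy₀, h₀⟩ := hex
  -- The crossing level is the supremum of `f₁` over the points where `f₂ < f₁`. At points with `f₁
  -- y` equal to that level the sign of `f₂ - f₁` is irrelevant. If there are no such points, the
  -- default supremum `0` works because `f₁ ≥ 0`.
  set A := f₁ '' {y ∈ S | f₂ y < f₁ y}
  have hbdd : BddAbove A := by
    refine ⟨f₁ y₀, ?_⟩
    rintro _ ⟨y, ⟨hy, hlt⟩, rfl⟩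
    rcases le_total y y₀ with h | h
    · exact hmono y hy y₀ hy₀ h
    · exfalso
      have h3 := hratio y₀ hy₀ y hy h
      have h4 : 0 < f₂ y₀ := (h1 y₀ hy₀).trans_lt h₀
      have h5 := h2 y hy
      nlinarith
  refine ⟨sSup A, fun y hy => ?_⟩
  rcases lt_trichotomy (f₁ y) (sSup A) with h | h | h
  · rcases A.eq_empty_or_nonempty with hA | hA
    · refine absurd ?_ (not_lt.2 (h1 y hy))
      rwa [hA, Real.sSup_empty] at h
    · obtain ⟨_, ⟨y', ⟨hy', hlt'⟩, rfl⟩, h3⟩ := exists_lt_of_lt_csSup hA h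
      have hyy : y ≤ y' := by
        by_contra! h4
        exact (hmono y' hy' y hy h4.le).not_gt h3
      have h5 := hratio y hy y' hy' hyy
      have h6 := h1 y hy
      have h7 : f₂ y ≤ f₁ y := by
        by_contra! h8
        nlinarith
      exact mul_nonneg_of_nonpos_of_nonpos (by linarith) (by linarith)
  · rw [h, sub_self, zero_mul]
  · have h3 : f₁ y ≤ f₂ y := by
      by_contra! h4
      exact (le_csSup hbdd ⟨y, ⟨hy, h4⟩, rfl⟩).not_gt h
    exact mul_nonneg (by linarith) (by linarith)

/-- The function `x ↦ exp (r x) - r exp (r c) x` is strictly convex with minimum at `c`, and the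
hypothesis says that going from `a` to `b` does not move towards `c`. The linear term cancels after
averaging over functions with equal means. -/
lemma exp_sub_lt_of_crossing {r a b c : ℝ} (hr : r < 0) (h : 0 ≤ (a - c) * (b - a)) (hab : a ≠ b) :
    Real.exp (r * a) - r * Real.exp (r * c) * a < Real.exp (r * b) - r * Real.exp (r * c) * b := by
  have h1 : Real.exp (r * a) * (r * (b - a) + 1) < Real.exp (r * b) := by
    have h2 := Real.add_one_lt_exp (x := r * (b - a)) (mul_ne_zero hr.ne (sub_ne_zero.2 hab.symm))
    calc Real.exp (r * a) * (r * (b - a) + 1) < Real.exp (r * a) * Real.exp (r * (b - a)) := by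
          gcongr
      _ = Real.exp (r * b) := by rw [← Real.exp_add]; ring_nf
  have h3 : 0 ≤ (Real.exp (r * a) - Real.exp (r * c)) * (r * (b - a)) := by
    rcases le_total a c with hac | hac
    · have h4 : Real.exp (r * c) ≤ Real.exp (r * a) := Real.exp_le_exp.2 (by nlinarith)
      rcases hac.eq_or_lt with rfl | hac
      · simp
      · have : b - a ≤ 0 := by
          by_contra! h5
          nlinarith
        exact mul_nonneg (by linarith) (mul_nonneg_of_nonpos_of_nonpos hr.le this)
    · have h4 : Real.exp (r * a) ≤ Real.exp (r * c) := Real.exp_le_exp.2 (by nlinarith)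
      rcases hac.eq_or_lt with rfl | hac
      · simp
      · have : 0 ≤ b - a := by
          by_contra! h5
          nlinarith
        exact mul_nonneg_of_nonpos_of_nonpos (by linarith)
          (mul_nonpos_of_nonpos_of_nonneg hr.le this)
  nlinarith

lemma exp_sub_le_of_crossing {r a b c : ℝ} (hr : r < 0) (h : 0 ≤ (a - c) * (b - a)) :
    Real.exp (r * a) - r * Real.exp (r * c) * a ≤ Real.exp (r * b) - r * Real.exp (r * c) * b := by
  rcases eq_or_ne a b with rfl | hab
  · exact le_rfl
  · exact (exp_sub_lt_of_crossing hr h hab).le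

/-- The normalized functions `log (1 + θ y) / ℓ` have nondecreasing ratios. -/
lemma log_div_mul_le {θ₁ θ₂ ℓ₁ ℓ₂ y y' : ℝ} (h12 : θ₁ < θ₂) (h2 : 0 < θ₂) (hℓ₁ : 0 < θ₁ * ℓ₁)
    (hℓ₂ : 0 < ℓ₂) (hy : 0 ≤ y) (hyy : y ≤ y') (hdom : 0 < 1 + θ₁ * y') :
    Real.log (1 + θ₁ * y) / ℓ₁ * (Real.log (1 + θ₂ * y') / ℓ₂) ≤
      Real.log (1 + θ₁ * y') / ℓ₁ * (Real.log (1 + θ₂ * y) / ℓ₂) := by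
  rw [div_mul_div_comm, div_mul_div_comm]
  rcases pos_and_pos_or_neg_and_neg_of_mul_pos hℓ₁ with ⟨h1, h3⟩ | ⟨h1, h3⟩
  · exact div_le_div_of_nonneg_right (log_mul_log_le h1 h12 hy hyy) (mul_pos h3 hℓ₂).le
  · exact div_le_div_of_nonpos_of_le (mul_neg_of_neg_of_pos h3 hℓ₂).le
      (log_mul_log_le_of_neg h1 h2 hy hyy hdom)

lemma log_div_nonneg {θ ℓ y : ℝ} (hℓ : 0 < θ * ℓ) (hy : 0 ≤ y) (hdom : 0 < 1 + θ * y) :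
    0 ≤ Real.log (1 + θ * y) / ℓ := by
  rcases pos_and_pos_or_neg_and_neg_of_mul_pos hℓ with ⟨h1, h3⟩ | ⟨h1, h3⟩
  · exact div_nonneg (Real.log_nonneg (by nlinarith)) h3.le
  · exact div_nonneg_of_nonpos (Real.log_nonpos hdom.le (by nlinarith)) h3.le

/-- The mean of `log (1 + θ y_i)`. -/
noncomputable def logMean (k : ℕ) (y : ℕ → ℝ) (θ : ℝ) : ℝ :=
  (1 / (k : ℝ)) * ∑ i ∈ Finset.range k, Real.log (1 + θ * y i)

/-- The left side of the second likelihood moment equation, after elimination of the shape. -/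
noncomputable def powMean (r : ℝ) (k : ℕ) (y : ℕ → ℝ) (θ : ℝ) : ℝ :=
  (1 / (k : ℝ)) * ∑ i ∈ Finset.range k, Real.exp (r * (Real.log (1 + θ * y i) / logMean k y θ))

/-! ### Existence and localization of solutions through `θ = g / s` -/

section LME

variable {r : ℝ} {k : ℕ} {y : ℕ → ℝ}

lemma mul_logMean_pos (hy : ∀ i < k, 0 ≤ y i) (hpos : ∃ i < k, 0 < y i) {θ : ℝ} (hθ : θ ≠ 0)
    (hdom : ∀ i < k, 0 < 1 + θ * y i) : 0 < θ * logMean k y θ := by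
  obtain ⟨i₀, hi₀, hyi₀⟩ := hpos
  have hk : (0 : ℝ) < k := by exact_mod_cast (Nat.zero_le _).trans_lt hi₀
  have : θ * logMean k y θ = (1 / (k : ℝ)) * ∑ i ∈ Finset.range k, θ * Real.log (1 + θ * y i) := by
    rw [logMean, ← Finset.mul_sum]; ring
  rw [this]
  refine mul_pos (by positivity) (Finset.sum_pos' (fun i hi => ?_) ⟨i₀, Finset.mem_range.2 hi₀, ?_⟩)
  · rw [Finset.mem_range] at hi
    rcases hθ.lt_or_gt with h | h
    · exact mul_nonneg_of_nonpos_of_nonpos h.le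
        (Real.log_nonpos (hdom i hi).le (by nlinarith [hy i hi]))
    · exact mul_nonneg h.le (Real.log_nonneg (by nlinarith [hy i hi]))
  · rcases hθ.lt_or_gt with h | h
    · exact mul_pos_of_neg_of_neg h (Real.log_neg (hdom i₀ hi₀) (by nlinarith))
    · exact mul_pos h (Real.log_pos (by nlinarith))

lemma logMean_mono (hy : ∀ i < k, 0 ≤ y i) {θ₁ θ₂ : ℝ} (h12 : θ₁ ≤ θ₂)
    (hdom : ∀ i < k, 0 < 1 + θ₁ * y i) : logMean k y θ₁ ≤ logMean k y θ₂ := by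
  refine mul_le_mul_of_nonneg_left (Finset.sum_le_sum fun i hi => ?_) (by positivity)
  rw [Finset.mem_range] at hi
  exact Real.log_le_log (hdom i hi) (by nlinarith [hy i hi])

lemma sum_log_div_logMean (hk : 0 < k) {θ : ℝ} (h : logMean k y θ ≠ 0) :
    ∑ i ∈ Finset.range k, Real.log (1 + θ * y i) / logMean k y θ = k := by
  have hk' : (k : ℝ) ≠ 0 := by positivity
  rw [← Finset.sum_div, div_eq_iff h, logMean]
  field_simp

/-- The function `powMean` is nonincreasing. -/
lemma powMean_anti (hr : r < 0) (hy : ∀ i < k, 0 ≤ y i) (hpos : ∃ i < k, 0 < y i) {θ₁ θ₂ : ℝ}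
    (h12 : θ₁ < θ₂) (h1 : θ₁ ≠ 0) (h2 : 0 < θ₂) (hdom : ∀ i < k, 0 < 1 + θ₁ * y i) :
    powMean r k y θ₂ ≤ powMean r k y θ₁ := by
  have hk : 0 < k := by obtain ⟨i, hi, -⟩ := hpos; omega
  have hdom₂ : ∀ i < k, 0 < 1 + θ₂ * y i := fun i hi => by nlinarith [hy i hi]
  have hℓ₁ := mul_logMean_pos hy hpos h1 hdom
  have hℓ₂ := mul_logMean_pos hy hpos h2.ne' hdom₂
  have hs₁ := sum_log_div_logMean hk (right_ne_zero_of_mul hℓ₁.ne')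
  have hs₂ := sum_log_div_logMean hk (right_ne_zero_of_mul hℓ₂.ne')
  set ℓ₁ := logMean k y θ₁
  set ℓ₂ := logMean k y θ₂
  have hℓ₂0 : 0 < ℓ₂ := (pos_iff_pos_of_mul_pos hℓ₂).1 h2
  set f₁ : ℝ → ℝ := fun x => Real.log (1 + θ₂ * x) / ℓ₂
  set f₂ : ℝ → ℝ := fun x => Real.log (1 + θ₁ * x) / ℓ₁
  refine mul_le_mul_of_nonneg_left ?_ (by positivity)
  change ∑ i ∈ Finset.range k, Real.exp (r * f₁ (y i)) ≤ ∑ i ∈ Finset.range k, Real.exp (r * f₂ (y i))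
  have hs : ∑ i ∈ Finset.range k, f₁ (y i) = ∑ i ∈ Finset.range k, f₂ (y i) := hs₂.trans hs₁.symm
  -- The smaller parameter gives the more spread out normalized function, here `f₂`. If `f₂` nowhere
  -- exceeds `f₁`, equality of the sums forces them to coincide at the data.
  by_cases hex : ∃ x ∈ y '' Set.Iio k, f₁ x < f₂ x
  · obtain ⟨c, hc⟩ := exists_single_crossing (S := y '' Set.Iio k) (f₁ := f₁) (f₂ := f₂) (by
        rintro _ ⟨i, hi, rfl⟩ _ ⟨j, hj, rfl⟩ hij
        exact div_le_div_of_nonneg_right (Real.log_le_log (hdom₂ i hi) (by nlinarith)) hℓ₂0.le)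
      (by rintro _ ⟨i, hi, rfl⟩; exact log_div_nonneg hℓ₂ (hy i hi) (hdom₂ i hi))
      (by rintro _ ⟨i, hi, rfl⟩; exact log_div_nonneg hℓ₁ (hy i hi) (hdom i hi))
      (by
        rintro _ ⟨i, hi, rfl⟩ _ ⟨j, hj, rfl⟩ hij
        exact log_div_mul_le h12 h2 hℓ₁ hℓ₂0 (hy i hi) hij (hdom j hj)) hex
    have h3 := Finset.sum_le_sum fun i (hi : i ∈ Finset.range k) =>
      exp_sub_le_of_crossing hr (hc (y i) ⟨i, Finset.mem_range.1 hi, rfl⟩)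
    rw [Finset.sum_sub_distrib, Finset.sum_sub_distrib, ← Finset.mul_sum, ← Finset.mul_sum, hs] at h3
    linarith
  · push Not at hex
    have h3 : ∀ i ∈ Finset.range k, f₂ (y i) = f₁ (y i) :=
      (Finset.sum_eq_sum_iff_of_le fun i hi =>
        hex (y i) ⟨i, Finset.mem_range.1 hi, rfl⟩).1 hs.symm
    exact (Finset.sum_congr rfl fun i hi => by rw [h3 i hi]).le

lemma continuousOn_powMean (hy : ∀ i < k, 0 ≤ y i) (hpos : ∃ i < k, 0 < y i) :
    ContinuousOn (powMean r k y) (Set.Ioi 0) := by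
  have hdom : ∀ i < k, ∀ θ ∈ Set.Ioi (0 : ℝ), 1 + θ * y i ≠ 0 := fun i hi θ hθ => by
    have := mul_nonneg (le_of_lt hθ) (hy i hi)
    linarith
  have hlog : ∀ i ∈ Finset.range k, ContinuousOn (fun θ => Real.log (1 + θ * y i)) (Set.Ioi 0) :=
    fun i hi => ContinuousOn.log (by fun_prop) (hdom i (Finset.mem_range.1 hi))
  have hL : ContinuousOn (logMean k y) (Set.Ioi 0) :=
    (continuousOn_finsetSum _ hlog).const_mul _
  have hL0 : ∀ θ ∈ Set.Ioi (0 : ℝ), logMean k y θ ≠ 0 := fun θ hθ =>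
    right_ne_zero_of_mul (mul_logMean_pos hy hpos (ne_of_gt hθ) fun i hi => by
      have := mul_nonneg (le_of_lt hθ) (hy i hi)
      linarith).ne'
  refine (continuousOn_finsetSum _ fun i hi => ?_).const_mul _
  exact (((hlog i hi).div hL hL0).const_mul r).rexp

lemma exp_mul_log_div {x g : ℝ} (hx : 0 < x) : Real.exp (r * (Real.log x / g)) = x ^ (r / g) := by
  rw [Real.rpow_def_of_pos hx]
  ring_nf

/-- A crossing of the level `(1 - r)⁻¹` yields a solution of the likelihood moment equations. -/
lemma exists_isLMESolution (hy : ∀ i < k, 0 ≤ y i) (hpos : ∃ i < k, 0 < y i) {θ₁ θ₂ : ℝ}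
    (h1 : 0 < θ₁) (h12 : θ₁ ≤ θ₂) (hlo : powMean r k y θ₂ ≤ (1 - r)⁻¹)
    (hhi : (1 - r)⁻¹ ≤ powMean r k y θ₁) : ∃ g s, IsLMESolution r k y g s := by
  have hc : ContinuousOn (powMean r k y) (Set.Icc θ₁ θ₂) :=
    (continuousOn_powMean hy hpos).mono fun θ hθ => h1.trans_le hθ.1
  obtain ⟨θ, hθ, hθe⟩ := intermediate_value_Icc' h12 hc ⟨hlo, hhi⟩
  have hθ0 : 0 < θ := h1.trans_le hθ.1
  have hdom : ∀ i < k, 0 < 1 + θ * y i := fun i hi => by nlinarith [hy i hi]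
  have hg : 0 < logMean k y θ := (pos_iff_pos_of_mul_pos
    (mul_logMean_pos hy hpos hθ0.ne' hdom)).1 hθ0
  have he : logMean k y θ / (logMean k y θ / θ) = θ := div_div_cancel₀ hg.ne'
  refine ⟨logMean k y θ, logMean k y θ / θ, div_pos hg hθ0, ?_, ?_, ?_⟩ <;> rw [he]
  · exact hdom
  · rfl
  · rw [← hθe, powMean]
    congr 1
    exact Finset.sum_congr rfl fun i hi => (exp_mul_log_div (hdom i (Finset.mem_range.1 hi))).symm

/-- Every solution has `powMean (g / s) = (1 - r)⁻¹`, so monotonicity locates `g / s`, also against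
negative values. The case `g = 0` is excluded because `r / 0 = 0` would make the left side of the
second equation `1`. The bounds on `g` follow because the mean logarithm increases. -/
lemma IsLMESolution.bounds {g s : ℝ} (h : IsLMESolution r k y g s) (hr : r < 0)
    (hy : ∀ i < k, 0 ≤ y i) (hpos : ∃ i < k, 0 < y i) {θ₁ θ₂ : ℝ} (h1 : 0 < θ₁) (h12 : θ₁ < θ₂)
    (hlo : powMean r k y θ₂ < (1 - r)⁻¹) (hhi : (1 - r)⁻¹ < powMean r k y θ₁) :
    θ₁ ≤ g / s ∧ g / s ≤ θ₂ ∧ logMean k y θ₁ ≤ g ∧ g ≤ logMean k y θ₂ := by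
  have hk : (k : ℝ) ≠ 0 := by
    obtain ⟨i, hi, -⟩ := hpos
    have : 0 < k := by omega
    positivity
  have hg0 : g ≠ 0 := by
    rintro rfl
    have h3 := h.eq_pow
    simp only [div_zero, Real.rpow_zero, Finset.sum_const, Finset.card_range, nsmul_eq_mul,
      mul_one, one_div, inv_mul_cancel₀ hk] at h3
    have h4 : (1 - r)⁻¹ < 1 := inv_lt_one_of_one_lt₀ (by linarith)
    linarith
  have hθ0 : g / s ≠ 0 := div_ne_zero hg0 h.scale_pos.ne'
  have hL : logMean k y (g / s) = g := h.eq_log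
  have hP : powMean r k y (g / s) = (1 - r)⁻¹ := by
    rw [← h.eq_pow, powMean, hL]
    congr 1
    exact Finset.sum_congr rfl fun i hi => exp_mul_log_div (h.domain i (Finset.mem_range.1 hi))
  have hl : θ₁ ≤ g / s := by
    by_contra! hlt
    have := powMean_anti hr hy hpos hlt hθ0 h1 h.domain
    linarith
  have hu : g / s ≤ θ₂ := by
    by_contra! hlt
    have := powMean_anti hr hy hpos hlt (h1.trans h12).ne' ((h1.trans h12).trans hlt)
      (fun i hi => by nlinarith [hy i hi])
    linarith
  refine ⟨hl, hu, ?_, ?_⟩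
  · exact (logMean_mono hy hl fun i hi => by nlinarith [hy i hi]).trans_eq hL
  · exact hL.symm.trans_le (logMean_mono hy hu h.domain)

/-- Bernoulli's inequality `(1 + x) ^ τ ≤ 1 + τ x` for each term. With the companion bound for `τ ≥
1` it confines `g` relative to the mean logarithm at one fixed parameter. -/
lemma mul_logMean_one_le (hy : ∀ i < k, 0 ≤ y i) {θ τ : ℝ} (hθ : 0 < θ) (hτ0 : 0 < τ) (hτ1 : τ ≤ 1) :
    τ * logMean k y θ ≤ logMean k y (τ * θ) := by
  rw [logMean, logMean, mul_left_comm, Finset.mul_sum]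
  refine mul_le_mul_of_nonneg_left (Finset.sum_le_sum fun i hi => ?_) (by positivity)
  have hyi := hy i (Finset.mem_range.1 hi)
  have h0 : 0 < 1 + θ * y i := by positivity
  rw [← Real.log_rpow h0]
  refine Real.log_le_log (Real.rpow_pos_of_pos h0 _) ?_
  have := rpow_one_add_le_one_add_mul_self
    (show -1 ≤ θ * y i by have := mul_nonneg hθ.le hyi; linarith) hτ0.le hτ1
  linarith

lemma logMean_mul_le (hy : ∀ i < k, 0 ≤ y i) {θ τ : ℝ} (hθ : 0 < θ) (hτ1 : 1 ≤ τ) :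
    logMean k y (τ * θ) ≤ τ * logMean k y θ := by
  rw [logMean, logMean, mul_left_comm τ, Finset.mul_sum _ _ τ]
  refine mul_le_mul_of_nonneg_left (Finset.sum_le_sum fun i hi => ?_) (by positivity)
  have hyi := hy i (Finset.mem_range.1 hi)
  have h0 : 0 < 1 + θ * y i := by positivity
  rw [← Real.log_rpow h0]
  refine Real.log_le_log (by positivity) ?_
  have h1 : -1 ≤ θ * y i := (by norm_num : (-1 : ℝ) ≤ 0).trans (mul_nonneg hθ.le hyi)
  have h2 := one_add_mul_self_le_rpow_one_add h1 hτ1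
  linarith

end LME

/-! ### Limits of the likelihood moment functionals -/

/-- The density of `v ↦ log (1 + τ (v - 1))` on `(1, ∞)`. -/
noncomputable def logKernel (τ : ℝ) : ℝ → ℝ :=
  (Set.Ioi 1).indicator fun v => τ / (1 + τ * (v - 1))

/-- The density of `v ↦ 1 - exp (-ρ log (1 + τ (v - 1)))` on `(1, ∞)`. -/
noncomputable def powKernel (τ ρ : ℝ) : ℝ → ℝ :=
  (Set.Ioi 1).indicator fun v =>
    ρ * (τ / (1 + τ * (v - 1))) * Real.exp (-(ρ * Real.log (1 + τ * (v - 1))))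

section Kernels

variable {τ ρ : ℝ}

lemma div_one_add_le (hτ : 0 < τ) {v : ℝ} (hv : 1 < v) :
    τ / (1 + τ * (v - 1)) ≤ max τ 1 / v := by
  have hv0 : 0 < v := by linarith
  have hd : 0 < 1 + τ * (v - 1) := by have := mul_pos hτ (sub_pos.2 hv); linarith
  rw [div_le_div_iff₀ hd hv0]
  have h1 := le_max_left τ 1
  have h2 := le_max_right τ 1
  have h3 := mul_nonneg (sub_nonneg.2 h2) (mul_pos hτ (sub_pos.2 hv)).le
  nlinarith

lemma isTailKernel_log (hτ : 0 < τ) : IsTailKernel (logKernel τ) 1 (max τ 1) where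
  meas := Measurable.indicator (by fun_prop) measurableSet_Ioi
  nonneg := Set.indicator_nonneg fun v hv => by
    have := mul_pos hτ (sub_pos.2 (Set.mem_Ioi.1 hv))
    positivity
  start_pos := one_pos
  zero := fun v hv => Set.indicator_of_notMem (by simpa using hv) _
  le := fun v hv => by
    rw [logKernel, Set.indicator_of_mem (Set.mem_Ioi.2 hv)]
    exact div_one_add_le hτ hv

lemma isTailKernel_pow (hτ : 0 < τ) (hρ : 0 < ρ) :
    IsTailKernel (powKernel τ ρ) 1 (ρ * max τ 1) where
  meas := Measurable.indicator (by fun_prop) measurableSet_Ioi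
  nonneg := Set.indicator_nonneg fun v hv => by
    have := mul_pos hτ (sub_pos.2 (Set.mem_Ioi.1 hv))
    positivity
  start_pos := one_pos
  zero := fun v hv => Set.indicator_of_notMem (by simpa using hv) _
  le := fun v hv => by
    rw [powKernel, Set.indicator_of_mem (Set.mem_Ioi.2 hv)]
    have h0 : 0 < τ * (v - 1) := mul_pos hτ (sub_pos.2 hv)
    have h1 : Real.exp (-(ρ * Real.log (1 + τ * (v - 1)))) ≤ 1 := by
      rw [Real.exp_le_one_iff, neg_nonpos]
      exact mul_nonneg hρ.le (Real.log_nonneg (by linarith))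
    calc ρ * (τ / (1 + τ * (v - 1))) * Real.exp (-(ρ * Real.log (1 + τ * (v - 1))))
        ≤ ρ * (τ / (1 + τ * (v - 1))) * 1 := by gcongr
      _ ≤ ρ * (max τ 1 / v) := by
          rw [mul_one]
          exact mul_le_mul_of_nonneg_left (div_one_add_le hτ hv) hρ.le
      _ = _ := by ring

lemma prim_indicator_eq_sub {f F : ℝ → ℝ} {C : ℝ} (hg : IsTailKernel ((Set.Ioi 1).indicator f) 1 C)
    (hF : ∀ v, 1 ≤ v → HasDerivAt F (f v) v) {y : ℝ} (hy : 0 ≤ y) :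
    prim ((Set.Ioi 1).indicator f) (1 + y) = F (1 + y) - F 1 := by
  have h1 : (1 : ℝ) ≤ 1 + y := by linarith
  have hcongr : Set.EqOn ((Set.Ioi 1).indicator f) f (Set.Ioc 1 (1 + y)) := fun v hv =>
    Set.indicator_of_mem (Set.mem_Ioi.2 hv.1) f
  rw [← sub_zero (prim _ _), ← hg.prim_of_le le_rfl, hg.prim_sub,
    intervalIntegral.integral_of_le h1, setIntegral_congr_fun measurableSet_Ioc hcongr,
    ← intervalIntegral.integral_of_le h1]
  refine intervalIntegral.integral_eq_sub_of_hasDerivAt (fun v hv => ?_) ?_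
  · rw [Set.uIcc_of_le h1] at hv
    exact hF v hv.1
  · rw [intervalIntegrable_iff_integrableOn_Ioc_of_le h1]
    exact (integrableOn_congr_fun hcongr measurableSet_Ioc).1
      ((intervalIntegrable_iff_integrableOn_Ioc_of_le h1).1 (hg.intervalIntegrable _ _))

lemma hasDerivAt_log_one_add (hτ : 0 < τ) {v : ℝ} (hv : 1 ≤ v) :
    HasDerivAt (fun v => Real.log (1 + τ * (v - 1))) (τ / (1 + τ * (v - 1))) v := by
  have h0 : 0 ≤ τ * (v - 1) := mul_nonneg hτ.le (sub_nonneg.2 hv)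
  have h1 : HasDerivAt (fun v => 1 + τ * (v - 1)) τ v := by
    simpa using (((hasDerivAt_id v).sub_const 1).const_mul τ).const_add 1
  exact h1.log (by linarith)

lemma prim_logKernel (hτ : 0 < τ) {y : ℝ} (hy : 0 ≤ y) :
    prim (logKernel τ) (1 + y) = Real.log (1 + τ * y) := by
  rw [logKernel, prim_indicator_eq_sub (isTailKernel_log hτ)
    (fun v hv => hasDerivAt_log_one_add hτ hv) hy]
  simp

/-- Primitives of kernels vanish at excess `0`, where the exponential equals `1`; for this reason
the complement to `1` is represented. -/
lemma prim_powKernel (hτ : 0 < τ) (hρ : 0 < ρ) {y : ℝ} (hy : 0 ≤ y) :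
    prim (powKernel τ ρ) (1 + y) = 1 - Real.exp (-(ρ * Real.log (1 + τ * y))) := by
  rw [powKernel, prim_indicator_eq_sub (isTailKernel_pow hτ hρ)
    (F := fun v => -Real.exp (-(ρ * Real.log (1 + τ * (v - 1))))) (fun v hv => ?_) hy]
  · simp only [add_sub_cancel_left, sub_self, mul_zero, add_zero, Real.log_one, neg_zero,
      Real.exp_zero]
    ring
  · refine ((((hasDerivAt_log_one_add hτ hv).const_mul ρ).neg).exp.neg).congr_deriv ?_
    simp only [Pi.neg_apply]
    ring

end Kernels

/-! ### Pareto limits and their strict monotonicity -/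

section Pareto

variable {α : ℝ}

/-- The limit of `logMean`. -/
noncomputable def logLimit (α τ : ℝ) : ℝ := ∫ v in Set.Ioi 1, logKernel τ v * v ^ (-α)

/-- The limit of `1 - powMean`. -/
noncomputable def powLimit (r α τ : ℝ) : ℝ :=
  ∫ v in Set.Ioi 1, powKernel τ (-r / logLimit α τ) v * v ^ (-α)

/-- At the true value `τ = 1` the kernel is `1 / v`, and the limit is the mean of the logarithm of a
Pareto variable. -/
lemma logLimit_one (hα : 0 < α) : logLimit α 1 = 1 / α := by
  have h1 : logLimit α 1 = ∫ v in Set.Ioi (1 : ℝ), v ^ (-1 - α) := by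
    refine setIntegral_congr_fun measurableSet_Ioi fun v hv => ?_
    have hv0 : 0 < v := zero_lt_one.trans hv
    simp only [logKernel]
    rw [Set.indicator_of_mem hv, sub_eq_add_neg (-1 : ℝ), Real.rpow_add hv0, Real.rpow_neg_one]
    congr 1
    rw [one_mul, add_sub_cancel, one_div]
  rw [h1, integral_Ioi_rpow_of_lt (by linarith) one_pos, Real.one_rpow,
    show -1 - α + 1 = -α by ring, neg_div_neg_eq]

/-- The kernel dominates `min τ 1` times the kernel at `τ = 1`, whose integral is known. -/
lemma logLimit_pos (hα : 0 < α) {τ : ℝ} (hτ : 0 < τ) : 0 < logLimit α τ := by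
  have hm : 0 < min τ 1 := by positivity
  have h1 : min τ 1 * logLimit α 1 ≤ logLimit α τ := by
    rw [logLimit, logLimit, ← integral_const_mul]
    refine setIntegral_mono_on (((isTailKernel_log one_pos).integrableOn_rpow hα).const_mul _)
      ((isTailKernel_log hτ).integrableOn_rpow hα) measurableSet_Ioi fun v hv => ?_
    rw [← mul_assoc]
    refine mul_le_mul_of_nonneg_right ?_ (Real.rpow_nonneg (zero_le_one.trans (le_of_lt hv)) _)
    have hv1 : 0 < v - 1 := sub_pos.2 hv
    have hd : 0 < 1 + τ * (v - 1) := by positivity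
    have hv0 : 0 < v := by linarith
    rw [logKernel, logKernel, Set.indicator_of_mem hv, Set.indicator_of_mem hv, one_mul,
      add_sub_cancel, mul_one_div, div_le_div_iff₀ hv0 hd]
    rcases le_total τ 1 with h | h
    · rw [min_eq_left h]; nlinarith [mul_nonneg (sub_nonneg.2 h) hv1.le]
    · rw [min_eq_right h]; nlinarith
  refine lt_of_lt_of_le ?_ h1
  rw [logLimit_one hα]
  positivity

/-- At `τ = 1` the exponent is `ρ = -r α`, and the Pareto mean of `v ^ (-ρ)` is `α / (α + ρ) = (1 -
r)⁻¹`; this is the origin of the right side of the second equation. -/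
lemma powLimit_one {r : ℝ} (hr : r < 0) (hα : 0 < α) : powLimit r α 1 = -r / (1 - r) := by
  set ρ := -r / logLimit α 1
  have hρ : ρ = -r * α := by simp only [ρ, logLimit_one hα]; field_simp
  have h1 : powLimit r α 1 = ∫ v in Set.Ioi (1 : ℝ), ρ * v ^ (-ρ - 1 - α) := by
    refine setIntegral_congr_fun measurableSet_Ioi fun v hv => ?_
    have hv0 : 0 < v := zero_lt_one.trans hv
    change powKernel 1 ρ v * v ^ (-α) = ρ * v ^ (-ρ - 1 - α)
    rw [powKernel, Set.indicator_of_mem hv, one_mul, add_sub_cancel, sub_eq_add_neg _ α,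
      Real.rpow_add hv0, sub_eq_add_neg, Real.rpow_add hv0, Real.rpow_neg_one,
      Real.rpow_def_of_pos hv0 (-ρ)]
    rw [show -(ρ * Real.log v) = Real.log v * -ρ by ring]
    ring
  have hρ0 : 0 < ρ := by rw [hρ]; exact mul_pos (by linarith) hα
  rw [h1, integral_const_mul, integral_Ioi_rpow_of_lt (by linarith) one_pos, Real.one_rpow, hρ]
  have h2 : (1 - r) ≠ 0 := by linarith
  have h3 : -(-r * α) - 1 - α + 1 = -(α * (1 - r)) := by ring
  rw [h3]
  field_simp

lemma paretoMeasure_real_abs (hα : 0 < α) {v : ℝ} (hv : 1 ≤ v) :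
    (paretoMeasure 1 α).real {x | v < |x|} = v ^ (-α) := by
  have hv0 : 0 < v := by linarith
  have h1 : paretoMeasure 1 α (Set.Ioi v) = ENNReal.ofReal (v ^ (-α)) := by
    rw [paretoMeasure, withDensity_apply _ measurableSet_Ioi]
    have h2 : ∫⁻ x in Set.Ioi v, paretoPDF 1 α x
        = ∫⁻ x in Set.Ioi v, ENNReal.ofReal (α * x ^ (-(α + 1))) := by
      refine setLIntegral_congr_fun measurableSet_Ioi fun x hx => ?_
      rw [paretoPDF_of_le (hv.trans (le_of_lt hx)), Real.one_rpow, mul_one]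
    rw [h2, ← ofReal_integral_eq_lintegral_ofReal, integral_const_mul,
      integral_Ioi_rpow_of_lt (by linarith) hv0]
    · congr 1
      rw [show -(α + 1) + 1 = -α by ring]
      field_simp
    · exact (integrableOn_Ioi_rpow_of_lt (by linarith) hv0).const_mul α
    · filter_upwards [ae_restrict_mem measurableSet_Ioi] with x hx
      exact mul_nonneg hα.le (Real.rpow_nonneg (hv0.trans hx).le _)
  have h3 : paretoMeasure 1 α (Set.Iio (-v)) = 0 := by
    rw [paretoMeasure, withDensity_apply _ measurableSet_Iio]
    exact lintegral_paretoPDF_of_le (by linarith)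
  have h4 : {x : ℝ | v < |x|} = Set.Ioi v ∪ Set.Iio (-v) := by
    ext x
    simp only [Set.mem_ofPred_eq, lt_abs, Set.mem_union, Set.mem_Ioi, Set.mem_Iio, lt_neg]
  have h5 : paretoMeasure 1 α {x | v < |x|} = ENNReal.ofReal (v ^ (-α)) := by
    rw [h4]
    refine le_antisymm ((measure_union_le _ _).trans ?_) (h1 ▸ measure_mono Set.subset_union_left)
    rw [h1, h3, add_zero]
  rw [measureReal_def, h5, ENNReal.toReal_ofReal (Real.rpow_nonneg hv0.le _)]

lemma ae_paretoMeasure (hα : 0 < α) : ∀ᵐ x ∂paretoMeasure 1 α, 1 < |x| := by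
  have := isProbabilityMeasure_paretoMeasure one_pos hα
  have h1 := paretoMeasure_real_abs hα (le_refl 1)
  rw [Real.one_rpow] at h1
  rw [measureReal_def, ENNReal.toReal_eq_one_iff] at h1
  rw [ae_iff_prob_eq_one (by fun_prop)]
  exact h1

/-- The limit integrals become expectations, so the crossing argument used for sample means applies
to them. The absolute value makes the variable nonnegative everywhere, as the layer cake formula
requires. -/
lemma IsTailKernel.integral_paretoMeasure (hα : 0 < α) {g : ℝ → ℝ} {C : ℝ}
    (hg : IsTailKernel g 1 C) :
    Integrable (fun x => prim g |x|) (paretoMeasure 1 α) ∧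
      ∫ x, prim g |x| ∂paretoMeasure 1 α = ∫ v in Set.Ioi 1, g v * v ^ (-α) := by
  have := isProbabilityMeasure_paretoMeasure one_pos hα
  have hcongr : Set.EqOn (fun v => g v * (paretoMeasure 1 α).real {x | v < |x|})
      (fun v => g v * v ^ (-α)) (Set.Ioi 1) := fun v hv => by
    simp only [paretoMeasure_real_abs hα (le_of_lt hv)]
  have h := hg.integrable_prim_and_integral_eq (μ := paretoMeasure 1 α) (V := fun x => |x|)
    (by fun_prop) (fun x => abs_nonneg x)
    ((integrableOn_congr_fun hcongr measurableSet_Ioi).2 (hg.integrableOn_rpow hα))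
  exact ⟨h.1, h.2.trans (setIntegral_congr_fun measurableSet_Ioi hcongr)⟩

/-- The limit functional is strictly increasing. -/
lemma powLimit_strictMono {r : ℝ} (hr : r < 0) (hα : 0 < α) {τ₁ τ₂ : ℝ} (h1 : 0 < τ₁)
    (h12 : τ₁ < τ₂) : powLimit r α τ₁ < powLimit r α τ₂ := by
  have h2 := h1.trans h12
  have := isProbabilityMeasure_paretoMeasure one_pos hα
  set ν := paretoMeasure 1 α
  have hae : ∀ᵐ x ∂ν, 1 < |x| := ae_paretoMeasure hα
  have hℓ : ∀ {τ}, 0 < τ → 0 < logLimit α τ := fun hτ => logLimit_pos hα hτ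
  have hρ : ∀ {τ}, 0 < τ → 0 < -r / logLimit α τ := fun hτ => div_pos (by linarith) (hℓ hτ)
  set F : ℝ → ℝ → ℝ := fun τ y => Real.log (1 + τ * y) / logLimit α τ
  have hlog : ∀ {τ}, 0 < τ → Integrable (fun x => F τ (|x| - 1)) ν ∧
      ∫ x, F τ (|x| - 1) ∂ν = 1 := by
    intro τ hτ
    obtain ⟨h3, h4⟩ := (isTailKernel_log hτ).integral_paretoMeasure hα
    have h5 : (fun x => prim (logKernel τ) |x| / logLimit α τ) =ᵐ[ν] fun x => F τ (|x| - 1) := by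
      filter_upwards [hae] with x hx
      simp only [F]
      rw [← prim_logKernel hτ (by linarith), add_sub_cancel]
    refine ⟨(h3.div_const _).congr h5, ?_⟩
    rw [← integral_congr_ae h5, integral_div, h4]
    exact div_self (hℓ hτ).ne'
  have hpow : ∀ {τ}, 0 < τ → Integrable (fun x => Real.exp (r * F τ (|x| - 1))) ν ∧
      ∫ x, Real.exp (r * F τ (|x| - 1)) ∂ν = 1 - powLimit r α τ := by
    intro τ hτ
    obtain ⟨h3, h4⟩ := (isTailKernel_pow hτ (hρ hτ)).integral_paretoMeasure hα
    have h5 : (fun x => 1 - prim (powKernel τ (-r / logLimit α τ)) |x|) =ᵐ[ν]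
        fun x => Real.exp (r * F τ (|x| - 1)) := by
      filter_upwards [hae] with x hx
      have h6 := prim_powKernel hτ (hρ hτ) (y := |x| - 1) (by linarith)
      rw [add_sub_cancel] at h6
      rw [h6, sub_sub_cancel]
      congr 1
      simp only [F]
      ring
    refine ⟨((integrable_const 1).sub h3).congr h5, ?_⟩
    rw [← integral_congr_ae h5, integral_sub (integrable_const _) h3, h4]
    simp [powLimit]
  -- The ratio of the two logarithms is strictly monotone, so the normalized functions agree for at
  -- most one value of `|x|`, hence for finitely many `x`, a null set for a law with a density.
  have hne : ¬ ∀ᵐ x ∂ν, F τ₂ (|x| - 1) = F τ₁ (|x| - 1) := by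
    intro heq
    have hfalse : ∀ᵐ x ∂ν, ¬ (1 < |x| ∧ F τ₂ (|x| - 1) = F τ₁ (|x| - 1)) := by
      have hac : ν ≪ volume := withDensity_absolutelyContinuous _ _
      refine hac ?_
      have hsub : (fun x : ℝ => |x|) '' {x | 1 < |x| ∧ F τ₂ (|x| - 1) = F τ₁ (|x| - 1)} |>.Subsingleton := by
        rintro _ ⟨x, ⟨hx, hxe⟩, rfl⟩ _ ⟨y, ⟨hy, hye⟩, rfl⟩
        by_contra hxy
        wlog hlt : |x| < |y| generalizing x y
        · exact this y hy hye x hx hxe (Ne.symm hxy) (lt_of_le_of_ne (not_lt.1 hlt) (Ne.symm hxy))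
        have h3 := log_mul_log_lt h1 h12 (y := |x| - 1) (y' := |y| - 1) (by linarith) (by linarith)
        simp only [F] at hxe hye
        rw [div_eq_div_iff (hℓ h2).ne' (hℓ h1).ne'] at hxe hye
        have h4 : Real.log (1 + τ₁ * (|x| - 1)) * Real.log (1 + τ₂ * (|y| - 1)) * logLimit α τ₁
            = Real.log (1 + τ₁ * (|y| - 1)) * Real.log (1 + τ₂ * (|x| - 1)) * logLimit α τ₁ := by
          linear_combination Real.log (1 + τ₁ * (|x| - 1)) * hye -
            Real.log (1 + τ₁ * (|y| - 1)) * hxe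
        exact h3.ne (mul_right_cancel₀ (hℓ h1).ne' h4)
      have hfin : {x : ℝ | 1 < |x| ∧ F τ₂ (|x| - 1) = F τ₁ (|x| - 1)}.Finite := by
        refine Set.Finite.of_finite_fibers (fun x : ℝ => |x|) hsub.finite fun y _ => ?_
        refine (Set.toFinite {y, -y}).subset fun x hx => ?_
        have : |x| = y := hx.2
        rcases abs_choice x with h | h
        · left; linarith
        · right; simp only [Set.mem_singleton_iff]; linarith
      exact measure_mono_null (fun x hx => not_not.1 hx) (hfin.measure_zero volume)
    obtain ⟨x, ⟨h3, h4⟩, h5⟩ := ((hae.and heq).and hfalse).exists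
    exact h5 ⟨h3, h4⟩
  have hmem : ∀ᵐ x ∂ν, |x| - 1 ∈ Set.Ioi (0 : ℝ) := by
    filter_upwards [hae] with x hx using Set.mem_Ioi.2 (sub_pos.2 hx)
  have hnonneg : ∀ {τ}, 0 < τ → ∀ y ∈ Set.Ioi (0 : ℝ), 0 ≤ F τ y := fun {τ} hτ y hy =>
    log_div_nonneg (mul_pos hτ (hℓ hτ)) (le_of_lt hy)
      (by have := mul_pos hτ (Set.mem_Ioi.1 hy); linarith)
  obtain ⟨hL1, hI1⟩ := hlog h1
  obtain ⟨hL2, hI2⟩ := hlog h2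
  obtain ⟨hE1, hJ1⟩ := hpow h1
  obtain ⟨hE2, hJ2⟩ := hpow h2
  by_cases hex : ∃ y ∈ Set.Ioi (0 : ℝ), F τ₂ y < F τ₁ y
  · obtain ⟨c, hc⟩ := exists_single_crossing (S := Set.Ioi 0) (f₁ := F τ₂) (f₂ := F τ₁)
      (fun y hy y' _ hyy => by
        have := mul_pos h2 (Set.mem_Ioi.1 hy)
        exact div_le_div_of_nonneg_right (Real.log_le_log (by linarith) (by gcongr)) (hℓ h2).le)
      (hnonneg h2) (hnonneg h1)
      (fun y hy y' hy' hyy => log_div_mul_le h12 h2 (mul_pos h1 (hℓ h1)) (hℓ h2) (le_of_lt hy) hyy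
        (by have := mul_pos h1 (Set.mem_Ioi.1 hy'); linarith)) hex
    set A := r * Real.exp (r * c)
    set G : ℝ → ℝ → ℝ := fun τ x => Real.exp (r * F τ (|x| - 1)) - A * F τ (|x| - 1)
    have hG1 : Integrable (G τ₁) ν := hE1.sub (hL1.const_mul A)
    have hG2 : Integrable (G τ₂) ν := hE2.sub (hL2.const_mul A)
    have hle : 0 ≤ᵐ[ν] fun x => G τ₁ x - G τ₂ x := by
      filter_upwards [hmem] with x hx
      exact sub_nonneg.2 (exp_sub_le_of_crossing hr (hc _ hx))
    have hint : ∫ x, (G τ₁ x - G τ₂ x) ∂ν = powLimit r α τ₂ - powLimit r α τ₁ := by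
      rw [integral_sub hG1 hG2]
      simp only [G]
      rw [integral_sub hE1 (hL1.const_mul A), integral_sub hE2 (hL2.const_mul A),
        integral_const_mul, integral_const_mul, hI1, hI2, hJ1, hJ2]
      ring
    -- Without strict increase the nonnegative difference `G τ₁ - G τ₂` has integral `0` and
    -- vanishes almost everywhere; strictness of the convexity bound then forces the two functions
    -- to agree almost everywhere.
    by_contra! hcon
    have hzero : ∫ x, (G τ₁ x - G τ₂ x) ∂ν = 0 :=
      le_antisymm (by rw [hint]; linarith) (integral_nonneg_of_ae hle)
    rw [integral_eq_zero_iff_of_nonneg_ae hle (hG1.sub hG2)] at hzero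
    refine hne ?_
    filter_upwards [hzero, hmem] with x hx hxm
    by_contra hxne
    have h3 := exp_sub_lt_of_crossing hr (hc _ hxm) hxne
    have h4 : G τ₁ x - G τ₂ x = 0 := hx
    simp only [G, A] at h4
    linarith
  · push Not at hex
    exfalso
    have hle : 0 ≤ᵐ[ν] fun x => F τ₂ (|x| - 1) - F τ₁ (|x| - 1) := by
      filter_upwards [hmem] with x hx using sub_nonneg.2 (hex _ hx)
    have hzero : ∫ x, (F τ₂ (|x| - 1) - F τ₁ (|x| - 1)) ∂ν = 0 := by
      rw [integral_sub hL2 hL1, hI1, hI2, sub_self]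
    rw [integral_eq_zero_iff_of_nonneg_ae hle (hL2.sub hL1)] at hzero
    refine hne ?_
    filter_upwards [hzero] with x hx using sub_eq_zero.1 hx

end Pareto

/-! ### Consistency of the likelihood moment estimators -/

section PowMean

variable {r : ℝ} {k : ℕ} {y : ℕ → ℝ}

/-- `powMean` depends on its normalization in a Lipschitz way. -/
lemma abs_powMean_sub_le (hr : r < 0) (hy : ∀ i < k, 0 ≤ y i) {θ ℓ : ℝ} (hθ : 0 < θ) (hℓ : 0 < ℓ)
    (hL : 0 < logMean k y θ) :
    |powMean r k y θ - (1 / (k : ℝ)) * ∑ i ∈ Finset.range k,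
      Real.exp (r * (Real.log (1 + θ * y i) / ℓ))| ≤
      |r| * |1 / logMean k y θ - 1 / ℓ| * logMean k y θ := by
  -- The exponential is `1`-Lipschitz on the nonpositive half-line, which contains all exponents
  -- because `r < 0` and the logarithms are nonnegative.
  have hexp : ∀ u v : ℝ, u ≤ 0 → v ≤ 0 → |Real.exp u - Real.exp v| ≤ |u - v| := by
    have key : ∀ u v : ℝ, u ≤ 0 → v ≤ u → |Real.exp u - Real.exp v| ≤ |u - v| := by
      intro u v hu hvu
      rw [abs_of_nonneg (sub_nonneg.2 (Real.exp_le_exp.2 hvu)), abs_of_nonneg (sub_nonneg.2 hvu)]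
      have h1 : Real.exp v = Real.exp u * Real.exp (v - u) := by rw [← Real.exp_add]; ring_nf
      have h2 := Real.add_one_le_exp (v - u)
      have h3 : Real.exp u ≤ 1 := Real.exp_le_one_iff.2 hu
      have h4 := Real.exp_pos u
      rw [h1]
      nlinarith
    intro u v hu hv
    rcases le_total v u with h | h
    · exact key u v hu h
    · rw [abs_sub_comm, abs_sub_comm u]
      exact key v u hv h
  rw [powMean, ← mul_sub, ← Finset.sum_sub_distrib, abs_mul, abs_of_nonneg (by positivity)]
  conv_rhs => rw [logMean.eq_1 k y θ]
  rw [mul_left_comm, ← logMean.eq_1 k y θ]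
  refine mul_le_mul_of_nonneg_left ((Finset.abs_sum_le_sum_abs _ _).trans ?_) (by positivity)
  rw [Finset.mul_sum]
  refine Finset.sum_le_sum fun i hi => ?_
  have ha : 0 ≤ Real.log (1 + θ * y i) := Real.log_nonneg <| by
    have := mul_nonneg hθ.le (hy i (Finset.mem_range.1 hi)); linarith
  refine (hexp _ _ (mul_nonpos_of_nonpos_of_nonneg hr.le (div_nonneg ha hL.le))
    (mul_nonpos_of_nonpos_of_nonneg hr.le (div_nonneg ha hℓ.le))).trans_eq ?_
  rw [← mul_sub, div_eq_mul_one_div _ ℓ, div_eq_mul_one_div _ (logMean k y θ), ← mul_sub, abs_mul,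
    abs_mul, abs_of_nonneg ha]
  ring

end PowMean

lemma excess_nonneg {Ω : Type*} (X : ℤ → Ω → ℝ) {n k i : ℕ} (hi : i ≤ k) (hk : k < n) (ω : Ω) :
    0 ≤ excess X n k i ω :=
  sub_nonneg.2 (orderStat_sub_le _ hi hk)

namespace HeavyTailedInnovations

variable {Ω : Type*} [MeasurableSpace Ω] {μ : Measure Ω} [IsProbabilityMeasure μ]
  {Z : ℤ → Ω → ℝ} {c : ℕ → ℝ} {H : ℝ → ℝ} {α δ r τ : ℝ} {k : ℕ → ℕ} {b : ℕ → ℝ}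

lemma tendsto_logMean_excess (h : HeavyTailedInnovations μ Z c H α δ)
    (hk : Tendsto k atTop atTop) (hkn : ∀ᶠ n in atTop, k n < n) (hb : Tendsto b atTop atTop)
    (hab : ∀ v, 0 < v → Tendsto (fun n : ℕ => (n : ℝ) / k n *
      absTail μ (linearProcess c Z 0) (v * b n)) atTop (𝓝 (v ^ (-α)))) (hτ : 0 < τ) :
    Tendsto (fun q : ℕ × Ω => logMean (k q.1)
        (fun i => excess (linearProcess c Z) q.1 (k q.1) i q.2) (τ / b q.1))
      (probFilter μ) (𝓝 (logLimit α τ)) := by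
  refine (h.tendsto_excessSum hk hkn hb hab (isTailKernel_log hτ)).congr' ?_
  filter_upwards [tendsto_fst_probFilter.eventually hkn,
    tendsto_fst_probFilter.eventually (hb.eventually_gt_atTop 0)] with q hq hbq
  rw [logMean, one_div]
  congr 1
  refine Finset.sum_congr rfl fun i hi => ?_
  have he := excess_nonneg (linearProcess c Z) (Finset.mem_range.1 hi).le hq q.2
  rw [prim_logKernel hτ (div_nonneg he hbq.le), mul_div_assoc', div_mul_eq_mul_div]

lemma tendsto_powMean_excess (h : HeavyTailedInnovations μ Z c H α δ)
    (hk : Tendsto k atTop atTop) (hkn : ∀ᶠ n in atTop, k n < n) (hb : Tendsto b atTop atTop)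
    (hab : ∀ v, 0 < v → Tendsto (fun n : ℕ => (n : ℝ) / k n *
      absTail μ (linearProcess c Z 0) (v * b n)) atTop (𝓝 (v ^ (-α)))) (hr : r < 0) (hτ : 0 < τ) :
    Tendsto (fun q : ℕ × Ω => powMean r (k q.1)
        (fun i => excess (linearProcess c Z) q.1 (k q.1) i q.2) (τ / b q.1))
      (probFilter μ) (𝓝 (1 - powLimit r α τ)) := by
  have hℓ := logLimit_pos h.index_pos hτ
  have hρ : 0 < -r / logLimit α τ := div_pos (by linarith) hℓ
  have hL := h.tendsto_logMean_excess hk hkn hb hab hτ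
  have hk0 : ∀ᶠ n in atTop, 0 < k n := hk.eventually_gt_atTop 0
  -- The normalization inside `powMean` is random, so the law of large numbers is applied with its
  -- limit `logLimit α τ` in its place; the Lipschitz bound then removes the difference.
  have h1 : Tendsto (fun q : ℕ × Ω => (1 / (k q.1 : ℝ)) * ∑ i ∈ Finset.range (k q.1), Real.exp (r *
      (Real.log (1 + τ / b q.1 * excess (linearProcess c Z) q.1 (k q.1) i q.2) / logLimit α τ)))
      (probFilter μ) (𝓝 (1 - powLimit r α τ)) := by
    refine ((h.tendsto_excessSum hk hkn hb hab (isTailKernel_pow hτ hρ)).const_sub 1).congr' ?_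
    filter_upwards [tendsto_fst_probFilter.eventually hkn, tendsto_fst_probFilter.eventually hk0,
      tendsto_fst_probFilter.eventually (hb.eventually_gt_atTop 0)] with q hq hkq hbq
    have hkq' : (k q.1 : ℝ) ≠ 0 := by positivity
    have h2 : ∀ i ∈ Finset.range (k q.1), prim (powKernel τ (-r / logLimit α τ))
        (1 + excess (linearProcess c Z) q.1 (k q.1) i q.2 / b q.1) = 1 - Real.exp (r *
        (Real.log (1 + τ / b q.1 * excess (linearProcess c Z) q.1 (k q.1) i q.2) /
          logLimit α τ)) := fun i hi => by
      have he := excess_nonneg (linearProcess c Z) (Finset.mem_range.1 hi).le hq q.2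
      rw [prim_powKernel hτ hρ (div_nonneg he hbq.le), mul_div_assoc', div_mul_eq_mul_div]
      congr 2
      ring_nf
    rw [Finset.sum_congr rfl h2, Finset.sum_sub_distrib, Finset.sum_const, Finset.card_range,
      nsmul_eq_mul, mul_one, mul_sub, inv_mul_cancel₀ hkq', one_div, sub_sub_cancel]
  have hinv := ((tendsto_const_nhds (x := (1 : ℝ))).div hL hℓ.ne').sub_const (1 / logLimit α τ)
  have h3 := (hinv.abs.const_mul |r|).mul hL
  simp only [sub_self, abs_zero, mul_zero, zero_mul] at h3
  have h4 := squeeze_zero_norm' (f := fun q : ℕ × Ω => powMean r (k q.1)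
        (fun i => excess (linearProcess c Z) q.1 (k q.1) i q.2) (τ / b q.1) -
      (1 / (k q.1 : ℝ)) * ∑ i ∈ Finset.range (k q.1), Real.exp (r *
      (Real.log (1 + τ / b q.1 * excess (linearProcess c Z) q.1 (k q.1) i q.2) / logLimit α τ)))
    ?_ h3
  · simpa using h4.add h1
  · filter_upwards [tendsto_fst_probFilter.eventually hkn, hL.eventually (lt_mem_nhds hℓ),
      tendsto_fst_probFilter.eventually (hb.eventually_gt_atTop 0)] with q hq hLq hbq
    exact abs_powMean_sub_le hr (fun i hi => excess_nonneg _ hi.le hq q.2) (div_pos hτ hbq) hℓ hLq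

/-- With probability tending to one, the likelihood moment equations have a solution, and every
solution is close to the true parameters. -/
lemma eventually_isLMESolution (h : HeavyTailedInnovations μ Z c H α δ)
    (hk : Tendsto k atTop atTop) (hkn : ∀ᶠ n in atTop, k n < n) (hb : Tendsto b atTop atTop)
    (hab : ∀ v, 0 < v → Tendsto (fun n : ℕ => (n : ℝ) / k n *
      absTail μ (linearProcess c Z 0) (v * b n)) atTop (𝓝 (v ^ (-α)))) (hr : r < 0) {ε : ℝ}
    (hε : 0 < ε) (hε1 : ε < 1) :
    ∀ᶠ q : ℕ × Ω in probFilter μ,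
      (∃ g s, IsLMESolution r (k q.1)
        (fun i => excess (linearProcess c Z) q.1 (k q.1) i q.2) g s) ∧
      ∀ g s, IsLMESolution r (k q.1)
        (fun i => excess (linearProcess c Z) q.1 (k q.1) i q.2) g s →
        g / s * b q.1 ∈ Set.Icc (1 - ε) (1 + ε) ∧
        g ∈ Set.Icc ((1 - ε) * logMean (k q.1)
          (fun i => excess (linearProcess c Z) q.1 (k q.1) i q.2) (1 / b q.1))
          ((1 + ε) * logMean (k q.1)
          (fun i => excess (linearProcess c Z) q.1 (k q.1) i q.2) (1 / b q.1)) := by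
  have hα := h.index_pos
  have hlo : 0 < 1 - ε := by linarith
  have hhi : 0 < 1 + ε := by linarith
  -- The target level is the limit at `τ = 1`; by strict monotonicity it lies strictly between the
  -- limits at `1 - ε` and `1 + ε`.
  have hone : 1 - powLimit r α 1 = (1 - r)⁻¹ := by
    rw [powLimit_one hr hα]
    have : (1 - r) ≠ 0 := by linarith
    field_simp
    ring
  have hm1 := powLimit_strictMono hr hα hlo (show 1 - ε < 1 by linarith)
  have hm2 := powLimit_strictMono hr hα one_pos (show 1 < 1 + ε by linarith)
  filter_upwards [tendsto_fst_probFilter.eventually hkn,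
    tendsto_fst_probFilter.eventually (hb.eventually_gt_atTop 0),
    (h.tendsto_logMean_excess hk hkn hb hab one_pos).eventually
      (lt_mem_nhds (logLimit_pos hα one_pos)),
    (h.tendsto_powMean_excess hk hkn hb hab hr hlo).eventually
      (lt_mem_nhds (show (1 - r)⁻¹ < _ by linarith)),
    (h.tendsto_powMean_excess hk hkn hb hab hr hhi).eventually
      (gt_mem_nhds (show _ < (1 - r)⁻¹ by linarith))] with q hq hbq hL h1 h2
  have hy : ∀ i < k q.1, 0 ≤ (fun i => excess (linearProcess c Z) q.1 (k q.1) i q.2) i :=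
    fun i hi => excess_nonneg _ hi.le hq q.2
  generalize (fun i => excess (linearProcess c Z) q.1 (k q.1) i q.2) = y at *
  -- Not all excesses vanish, since otherwise the mean logarithm would be `0` instead of near its
  -- positive limit.
  have hpos : ∃ i < k q.1, 0 < y i := by
    by_contra! hcon
    have h0 : logMean (k q.1) y (1 / b q.1) = 0 := by
      rw [logMean, Finset.sum_eq_zero fun i hi => ?_, mul_zero]
      have hi' := Finset.mem_range.1 hi
      rw [le_antisymm (hcon i hi') (hy i hi'), mul_zero, add_zero, Real.log_one]
    exact hL.ne' h0
  have hθ1 := div_pos hlo hbq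
  have hθ12 : (1 - ε) / b q.1 < (1 + ε) / b q.1 := by gcongr; linarith
  refine ⟨exists_isLMESolution hy hpos hθ1 hθ12.le h2.le h1.le, fun g s hgs => ?_⟩
  obtain ⟨h3, h4, h5, h6⟩ := hgs.bounds hr hy hpos hθ1 hθ12 h2 h1
  have hinv := one_div_pos.2 hbq
  have h7 := mul_logMean_one_le hy hinv hlo (by linarith)
  have h8 := logMean_mul_le hy hinv (show 1 ≤ 1 + ε by linarith)
  rw [mul_one_div] at h7 h8
  exact ⟨⟨(div_le_iff₀ hbq).1 h3, (le_div_iff₀ hbq).1 h4⟩, h7.trans h5, h6.trans h8⟩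

/-- Consistency of the shape and scale estimators. -/
lemma tendsto_isLMEstimator (h : HeavyTailedInnovations μ Z c H α δ)
    (hk : Tendsto k atTop atTop) (hkn : ∀ᶠ n in atTop, k n < n) (hb : Tendsto b atTop atTop)
    (hab : ∀ v, 0 < v → Tendsto (fun n : ℕ => (n : ℝ) / k n *
      absTail μ (linearProcess c Z 0) (v * b n)) atTop (𝓝 (v ^ (-α)))) (hr : r < 0)
    {γhat σhat : ℕ → Ω → ℝ}
    (hLME : ∀ n, IsLMEstimator r (linearProcess c Z) n (k n) (γhat n) (σhat n)) :
    Tendsto (fun q : ℕ × Ω => γhat q.1 q.2) (probFilter μ) (𝓝 (1 / α)) ∧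
      Tendsto (fun q : ℕ × Ω => σhat q.1 q.2 / b q.1) (probFilter μ) (𝓝 (1 / α)) := by
  have hα := h.index_pos
  set L : ℕ × Ω → ℝ := fun q => logMean (k q.1)
    (fun i => excess (linearProcess c Z) q.1 (k q.1) i q.2) (1 / b q.1)
  have hL : Tendsto L (probFilter μ) (𝓝 (1 / α)) := by
    rw [← logLimit_one hα]
    exact h.tendsto_logMean_excess hk hkn hb hab one_pos
  have hα' : 0 < 1 / α := by positivity
  have hpos : ∀ᶠ q in probFilter μ, 0 < L q := hL.eventually (lt_mem_nhds hα')
  have hbound : ∀ ε : ℝ, 0 < ε → ε < 1 → ∀ᶠ q : ℕ × Ω in probFilter μ, 0 < σhat q.1 q.2 ∧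
      γhat q.1 q.2 / σhat q.1 q.2 * b q.1 ∈ Set.Icc (1 - ε) (1 + ε) ∧
      γhat q.1 q.2 / L q ∈ Set.Icc (1 - ε) (1 + ε) := by
    intro ε hε hε1
    filter_upwards [h.eventually_isLMESolution hk hkn hb hab hr hε hε1, hpos] with q hq hLq
    have hsol := hLME q.1 q.2 hq.1
    obtain ⟨h1, h2, h3⟩ := hq.2 _ _ hsol
    exact ⟨hsol.scale_pos, h1, (le_div_iff₀ hLq).2 h2, (div_le_iff₀ hLq).2 h3⟩
  have hlim : ∀ f : ℕ × Ω → ℝ, (∀ ε : ℝ, 0 < ε → ε < 1 → ∀ᶠ q : ℕ × Ω in probFilter μ,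
      f q ∈ Set.Icc (1 - ε) (1 + ε)) → Tendsto f (probFilter μ) (𝓝 1) := by
    intro f hf
    refine Metric.tendsto_nhds.2 fun ε hε => ?_
    have hm : 0 < min ε 1 := lt_min hε one_pos
    filter_upwards [hf (min ε 1 / 2) (by positivity) (by linarith [min_le_right ε 1])] with q hq
    rw [Real.dist_eq, abs_lt]
    have := min_le_left ε 1
    constructor <;> linarith [hq.1, hq.2]
  have h1 : Tendsto (fun q : ℕ × Ω => γhat q.1 q.2 / σhat q.1 q.2 * b q.1) (probFilter μ) (𝓝 1) :=
    hlim _ fun ε h0 h1 => (hbound ε h0 h1).mono fun q hq => hq.2.1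
  have h2 : Tendsto (fun q : ℕ × Ω => γhat q.1 q.2 / L q) (probFilter μ) (𝓝 1) :=
    hlim _ fun ε h0 h1 => (hbound ε h0 h1).mono fun q hq => hq.2.2
  have hγ : Tendsto (fun q : ℕ × Ω => γhat q.1 q.2) (probFilter μ) (𝓝 (1 / α)) := by
    have h3 := h2.mul hL
    rw [one_mul] at h3
    refine h3.congr' ?_
    filter_upwards [hpos] with q hq using div_mul_cancel₀ _ hq.ne'
  refine ⟨hγ, ?_⟩
  -- The scale is recovered from `σ / b = γ / ((γ / σ) b)`, where the denominator tends to `1`.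
  have h4 := hγ.div h1 one_ne_zero
  rw [div_one] at h4
  refine h4.congr' ?_
  filter_upwards [tendsto_fst_probFilter.eventually (hb.eventually_gt_atTop 0),
    hγ.eventually (lt_mem_nhds hα'), hbound (1 / 2) (by norm_num) (by norm_num)] with q hbq hg hs
  have := hs.1.ne'
  have := hbq.ne'
  have := hg.ne'
  simp only [Pi.div_apply]
  field_simp

end HeavyTailedInnovations

/-! ### The consistency theorem -/

theorem mainTheorem1 {Ω : Type*} [MeasurableSpace Ω] (μ : Measure Ω) [IsProbabilityMeasure μ]
    (γ : ℝ) (hγ : 0 < γ)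
    (Z : ℤ → Ω → ℝ) (hZ_meas : ∀ n, Measurable (Z n)) (hZ_indep : iIndepFun Z μ)
    (hZ_ident : ∀ n, IdentDistrib (Z n) (Z 0) μ μ) (hZ_tail : RegVaryingTails μ γ (Z 0))
    (c : ℕ → ℝ) (hc_ne : ∃ j, c j ≠ 0)
    (δ : ℝ) (hδ_pos : 0 < δ) (hδ_lt : δ < min (1 / γ) 1) (hc_sum : Summable (fun j => |c j| ^ δ))
    (σstar : ℝ → ℝ) (hσstar : IsGPDScale μ γ (linearProcess c Z 0) σstar)
    (r : ℝ) (hr : r < 0)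
    (k : ℕ → ℕ) (hk : Tendsto k atTop atTop)
    (hnk : Tendsto (fun n : ℕ => (n : ℝ) / (k n : ℝ)) atTop atTop)
    (γhat σhat : ℕ → Ω → ℝ)
    (hLME : ∀ n, IsLMEstimator r (linearProcess c Z) n (k n) (γhat n) (σhat n)) :
    (∀ n : ℤ, ∀ᵐ ω ∂μ, Summable (fun j : ℕ => |c j * Z (n - j) ω|)) ∧
    TendstoInMeasure μ
      (fun (n : ℕ) (ω : Ω) =>
        (γhat n ω,
          σhat n ω / σstar (absQuantile μ (linearProcess c Z 0) ((n : ℝ) / (k n : ℝ)))))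
      atTop (fun _ => (γ, (1 : ℝ))) := by
  obtain ⟨hδ1, hδ2⟩ := lt_min_iff.1 hδ_lt
  have h : HeavyTailedInnovations μ Z c (absTail μ (Z 0)) (1 / γ) δ :=
    { meas := hZ_meas
      indep := hZ_indep
      ident := hZ_ident
      tail := fun n t => by
        rw [absTail, absTail, measureReal_def, measureReal_def]
        exact congrArg _ ((hZ_ident n).measure_mem_eq
          (s := {x | t < |x|}) (measurableSet_lt measurable_const (by fun_prop)))
      regVar := hZ_tail.regVarTail (hZ_meas 0)
      index_pos := by positivity
      exp_pos := hδ_pos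
      exp_lt := hδ1
      exp_lt_one := hδ2
      summable := hc_sum
      exists_ne := hc_ne }
  refine ⟨h.ae_summable, ?_⟩
  have hX := h.linearProcess_measurable 0
  have hT := h.linearProcess_regVarTail 0
  have hb := (tendsto_absQuantile hX hT h.index_pos).comp hnk
  have hkn : ∀ᶠ n in atTop, k n < n := by
    filter_upwards [hnk.eventually_gt_atTop 1, hk.eventually_gt_atTop 0] with n h1 h2
    rw [lt_div_iff₀ (by exact_mod_cast h2), one_mul] at h1
    exact_mod_cast h1
  obtain ⟨h1, h2⟩ := h.tendsto_isLMEstimator hk hkn hb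
    (fun v hv => (tendsto_mul_absTail_absQuantile hX hT h.index_pos hv).comp hnk) hr hLME
  rw [one_div_one_div] at h1 h2
  -- Both the scale estimator and `σstar` at the quantile are asymptotic to `γ` times the quantile,
  -- so their ratio tends to `1`.
  have h3 := ((hσstar.tendsto_div hγ hX hT).comp hb).comp (tendsto_fst_probFilter (μ := μ))
  have h4 := h2.div h3 hγ.ne'
  rw [div_self hγ.ne'] at h4
  refine tendstoInMeasure_of_tendsto_probFilter (h1.prodMk_nhds (h4.congr' ?_))
  filter_upwards [tendsto_fst_probFilter.eventually (hb.eventually_gt_atTop 0)] with q hq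
  exact div_div_div_cancel_right₀ hq.ne' _ _
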